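/- Work in the category of symmetric spectra of (pointed) simplicial sets. "Equivalence" means stable equivalence (a map $f$ inducing a bijection $E^0(f)$ for every injective $\Omega$-spectrum $E$), and $X\simeq Y$ means that $X$ and $Y$ are connected by a zigzag of stable equivalences. $\Sigma X=X\wedge S^1$. For a strictly commutative $n$-cube $\Gamma:\{0\to 1\}^n\to$ symmetric spectra, the higher cofiber $C_n\Gamma$ is defined inductively: $C_0$ is the identity, and $C_n\Gamma$ is the homotopy cofiber (mapping cone) of $C_{n-1}\Gamma(?,\dots,?,0)\to C_{n-1}\Gamma(?,\dots,?,1)$. Let $N$ be a strictly commutative cube of symmetric spectra with vertices $N_{ijk}$, $i,j,k\in\{0,1\}$, and edges $$\alpha:N_{001}\to N_{011},\quad \beta:N_{001}\to N_{101},\quad \gamma:N_{101}\to N_{111},\quad \delta:N_{011}\to N_{111},$$ $$\eta:N_{000}\to N_{100},\quad \nu:N_{000}\to N_{010},\quad \mu:N_{100}\to N_{110},\quad \lambda:N_{010}\to N_{110},$$ $$\zeta:N_{000}\to N_{001},\quad \epsilon:N_{100}\to N_{101},\quad \kappa:N_{010}\to N_{011},\quad \pi:N_{110}\to N_{111}.$$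 Assume that there is a map $s:N_{111}\to N_{101}$ such that $\gamma s=\mathrm{Id}$ and $\beta\vee s:N_{001}\vee N_{111}\to N_{101}$ is an equivalence, and that there is a map $t:N_{100}\to N_{001}$ such that $\beta t=\epsilon$ and $t\eta=\zeta$. Then $$C_3N\simeq \Sigma C_2M,$$ where $M$ is the commutative square with $M_{00}=N_{000}$, $M_{10}=N_{100}$, $M_{01}=N_{010}$, $M_{11}=N_{110}\times N_{011}$ and maps $\eta:M_{00}\to M_{10}$, $\nu:M_{00}\to M_{01}$, $(\mu,\alpha t):M_{10}\to M_{11}$, $(\lambda,\kappa):M_{01}\to M_{11}$. -/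

import Mathlib

open CategoryTheory Opposite MonoidalCategory

universe u

/-! ### Pointed simplicial sets -/

/-- A pointed simplicial set: a simplicial set with a compatible choice of a base point in every
simplicial degree (that is, a base vertex together with its degeneracies). -/
structure PSSet : Type (u + 1) where
  toSSet : SSet.{u}
  pt : ∀ k : SimplexCategoryᵒᵖ, toSSet.obj k
  map_pt : ∀ {k l : SimplexCategoryᵒᵖ} (θ : k ⟶ l), toSSet.map θ (pt k) = pt l

namespace PSSet

/-- The set of simplices in degree `k`. -/
abbrev obj (X : PSSet.{u}) (k : SimplexCategoryᵒᵖ) : Type u := X.toSSet.obj k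

/-- The action of a simplicial operator on simplices. -/
abbrev map (X : PSSet.{u}) {k l : SimplexCategoryᵒᵖ} (θ : k ⟶ l) (x : X.obj k) : X.obj l :=
  X.toSSet.map θ x

/-- A base point preserving map of simplicial sets. -/
@[ext]
structure Hom (X Y : PSSet.{u}) : Type u where
  toHom : X.toSSet ⟶ Y.toSSet
  app_pt : ∀ k, toHom.app k (X.pt k) = Y.pt k

instance : Category.{u} PSSet.{u} where
  Hom := Hom
  id X := ⟨𝟙 X.toSSet, fun _ => rfl⟩
  comp f g := ⟨f.toHom ≫ g.toHom, fun k => by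
    change g.toHom.app k (f.toHom.app k _) = _
    rw [f.app_pt, g.app_pt]⟩

/-- The map induced on simplices of degree `k`. -/
def app {X Y : PSSet.{u}} (f : X ⟶ Y) (k : SimplexCategoryᵒᵖ) (x : X.obj k) : Y.obj k :=
  f.toHom.app k x

lemma hom_ext {X Y : PSSet.{u}} {f g : X ⟶ Y} (h : ∀ k x, app f k x = app g k x) : f = g := by
  apply Hom.ext
  ext k x
  exact h k x

@[simp] lemma app_pt {X Y : PSSet.{u}} (f : X ⟶ Y) (k) : app f k (X.pt k) = Y.pt k := f.app_pt k

lemma app_map {X Y : PSSet.{u}} (f : X ⟶ Y) {k l} (θ : k ⟶ l) (x : X.obj k) :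
    app f l (X.map θ x) = Y.map θ (app f k x) :=
  ConcreteCategory.congr_hom (f.toHom.naturality θ) x

@[simp] lemma app_id (X : PSSet.{u}) (k) (x : X.obj k) : app (𝟙 X) k x = x := rfl

@[simp] lemma app_comp {X Y Z : PSSet.{u}} (f : X ⟶ Y) (g : Y ⟶ Z) (k) (x : X.obj k) :
    app (f ≫ g) k x = app g k (app f k x) := rfl

lemma map_id (X : PSSet.{u}) {k} (x : X.obj k) : X.map (𝟙 k) x = x := by simp [map]

lemma map_comp (X : PSSet.{u}) {k l m} (θ : k ⟶ l) (θ' : l ⟶ m) (x : X.obj k) :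
    X.map (θ ≫ θ') x = X.map θ' (X.map θ x) := by simp [map]

/-- Constructor for pointed simplicial sets from sets, operators and base points. -/
def ofData (S : SimplexCategoryᵒᵖ → Type u) (act : ∀ {k l} (_ : k ⟶ l), S k → S l)
    (h_id : ∀ k (x : S k), act (𝟙 k) x = x)
    (h_comp : ∀ {k l m} (θ : k ⟶ l) (θ' : l ⟶ m) (x : S k), act (θ ≫ θ') x = act θ' (act θ x))
    (p : ∀ k, S k) (hp : ∀ {k l} (θ : k ⟶ l), act θ (p k) = p l) : PSSet.{u} where
  toSSet :=
    { obj := S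
      map := fun θ => ↾(act θ)
      map_id := fun k => by ext x; exact h_id k x
      map_comp := fun θ θ' => by ext x; exact h_comp θ θ' x }
  pt := p
  map_pt := hp

/-- Constructor for pointed maps from functions commuting with the operators. -/
def homMk {X Y : PSSet.{u}} (φ : ∀ k, X.obj k → Y.obj k)
    (nat : ∀ {k l} (θ : k ⟶ l) (x : X.obj k), φ l (X.map θ x) = Y.map θ (φ k x))
    (hpt : ∀ k, φ k (X.pt k) = Y.pt k) : X ⟶ Y where
  toHom :=
    { app := fun k => ↾(φ k)
      naturality := fun k l θ => by ext x; exact nat θ x }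
  app_pt := hpt

@[simp] lemma app_homMk {X Y : PSSet.{u}} (φ : ∀ k, X.obj k → Y.obj k) (nat) (hpt) (k)
    (x : X.obj k) : app (homMk φ nat hpt) k x = φ k x := rfl

/-- The simplicial interval `Δ[1]`. -/
abbrev delta1 : SSet.{u} := SSet.stdSimplex.obj (SimplexCategory.mk 1)

/-- The totally degenerate `k`-simplex of `Δ[1]` at the vertex `i`. -/
def vertex (i : Fin 2) (k : SimplexCategoryᵒᵖ) : delta1.{u}.obj k :=
  SSet.stdSimplex.objEquiv.symm (SimplexCategory.const k.unop (.mk 1) i)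

/-- The unit interval `Δ[1]`, pointed at the vertex `0`. -/
def interval : PSSet.{u} where
  toSSet := delta1
  pt := vertex 0
  map_pt _ := rfl

/-- The end point `1` of the interval, in simplicial degree `k`. -/
def one (k : SimplexCategoryᵒᵖ) : interval.{u}.obj k := vertex 1 k

lemma map_one {k l : SimplexCategoryᵒᵖ} (θ : k ⟶ l) : interval.{u}.map θ (one k) = one l := rfl

/-- The relation on the simplices of `Δ[1]` identifying all simplices of `∂Δ[1]`. -/
def circleRel (k : SimplexCategoryᵒᵖ) (a b : delta1.{u}.obj k) : Prop :=
  a ∈ (SSet.boundary.{u} 1).obj k ∧ b ∈ (SSet.boundary.{u} 1).obj k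

/-- The simplicial circle `S¹ = Δ[1] / ∂Δ[1]`, pointed at the class of `∂Δ[1]`. -/
def circle : PSSet.{u} :=
  ofData (fun k => Quot (circleRel.{u} k))
    (fun {_ _} θ => Quot.map (delta1.{u}.map θ) (fun _ _ h =>
      ⟨(SSet.boundary.{u} 1).map θ h.1, (SSet.boundary.{u} 1).map θ h.2⟩))
    (by rintro k ⟨x⟩; exact congrArg (Quot.mk _) (map_id interval x))
    (by rintro k l m θ θ' ⟨x⟩; exact congrArg (Quot.mk _) (map_comp interval θ θ' x))
    (fun k => Quot.mk _ (vertex 0 k)) (fun _ => rfl)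

/-! #### Smash product, product, wedge and mapping cone -/

/-- The relation on `X × Y` collapsing `X ∨ Y = X × * ∪ * × Y` to a point. -/
def smashRel (X Y : PSSet.{u}) (k : SimplexCategoryᵒᵖ) (p q : X.obj k × Y.obj k) : Prop :=
  (p.1 = X.pt k ∨ p.2 = Y.pt k) ∧ (q.1 = X.pt k ∨ q.2 = Y.pt k)

/-- The smash product `X ∧ Y = (X × Y) / (X ∨ Y)`. -/
def smash (X Y : PSSet.{u}) : PSSet.{u} :=
  ofData (fun k => Quot (smashRel X Y k))
    (fun {_ _} θ => Quot.map (fun p => (X.map θ p.1, Y.map θ p.2)) (by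
      rintro ⟨a, b⟩ ⟨c, d⟩ ⟨h, h'⟩
      exact ⟨h.imp (fun e => by simp only at e; rw [e]; exact X.map_pt θ)
          (fun e => by simp only at e; rw [e]; exact Y.map_pt θ),
        h'.imp (fun e => by simp only at e; rw [e]; exact X.map_pt θ)
          (fun e => by simp only at e; rw [e]; exact Y.map_pt θ)⟩))
    (by rintro k ⟨x, y⟩; exact congrArg (Quot.mk _) (Prod.ext (map_id X x) (map_id Y y)))
    (by
      rintro k l m θ θ' ⟨x, y⟩
      exact congrArg (Quot.mk _) (Prod.ext (map_comp X θ θ' x) (map_comp Y θ θ' y)))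
    (fun k => Quot.mk _ (X.pt k, Y.pt k))
    (fun θ => congrArg (Quot.mk _) (Prod.ext (X.map_pt θ) (Y.map_pt θ)))

/-- The simplex `x ∧ y` of `X ∧ Y`. -/
def smashMk {X Y : PSSet.{u}} {k} (x : X.obj k) (y : Y.obj k) : (smash X Y).obj k :=
  Quot.mk _ (x, y)

lemma smashMk_pt_left {X Y : PSSet.{u}} {k} (y : Y.obj k) :
    smashMk (X.pt k) y = (smash X Y).pt k := Quot.sound ⟨Or.inl rfl, Or.inl rfl⟩

lemma smashMk_pt_right {X Y : PSSet.{u}} {k} (x : X.obj k) :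
    smashMk x (Y.pt k) = (smash X Y).pt k := Quot.sound ⟨Or.inr rfl, Or.inl rfl⟩

lemma map_smashMk {X Y : PSSet.{u}} {k l} (θ : k ⟶ l) (x : X.obj k) (y : Y.obj k) :
    (smash X Y).map θ (smashMk x y) = smashMk (X.map θ x) (Y.map θ y) := rfl

lemma smash_ind {X Y : PSSet.{u}} {k} {P : (smash X Y).obj k → Prop}
    (h : ∀ x y, P (smashMk x y)) (z) : P z := by
  obtain ⟨x, y⟩ := z
  exact h x y

/-- The pointed map `X ∧ Y ⟶ Z` given by a natural family of maps `X × Y ⟶ Z` that send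
`X ∨ Y` to the base point. -/
def smashDesc {X Y Z : PSSet.{u}} (φ : ∀ k, X.obj k → Y.obj k → Z.obj k)
    (nat : ∀ {k l} (θ : k ⟶ l) x y, φ l (X.map θ x) (Y.map θ y) = Z.map θ (φ k x y))
    (hl : ∀ k y, φ k (X.pt k) y = Z.pt k) (hr : ∀ k x, φ k x (Y.pt k) = Z.pt k) :
    smash X Y ⟶ Z :=
  homMk (fun k => Quot.lift (fun p => φ k p.1 p.2) (by
      have key : ∀ p : X.obj k × Y.obj k, (p.1 = X.pt k ∨ p.2 = Y.pt k) →
          φ k p.1 p.2 = Z.pt k := by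
        rintro p (h | h)
        · rw [h, hl]
        · rw [h, hr]
      rintro p q ⟨h, h'⟩
      rw [key p h, key q h']))
    (by rintro k l θ ⟨x, y⟩; exact nat θ x y) (fun k => hl k _)

@[simp] lemma smashDesc_mk {X Y Z : PSSet.{u}} (φ : ∀ k, X.obj k → Y.obj k → Z.obj k) (nat) (hl)
    (hr) (k) (x : X.obj k) (y : Y.obj k) :
    app (smashDesc φ nat hl hr) k (smashMk x y) = φ k x y := rfl

/-- The map `x ∧ a ↦ φ x ∧ a` in a fixed simplicial degree. -/
def smashMapAt {X X' : PSSet.{u}} (K : PSSet.{u}) {k} (φ : X.obj k → X'.obj k)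
    (hφ : φ (X.pt k) = X'.pt k) : (smash X K).obj k → (smash X' K).obj k :=
  Quot.map (fun p => (φ p.1, p.2)) (by
    rintro ⟨a, b⟩ ⟨c, d⟩ ⟨h, h'⟩
    exact ⟨h.imp (fun e => by simp only at e; rw [e]; exact hφ) id,
      h'.imp (fun e => by simp only at e; rw [e]; exact hφ) id⟩)

@[simp] lemma smashMapAt_mk {X X' : PSSet.{u}} (K : PSSet.{u}) {k} (φ : X.obj k → X'.obj k)
    (hφ : φ (X.pt k) = X'.pt k) (x : X.obj k) (a : K.obj k) :
    smashMapAt K φ hφ (smashMk x a) = smashMk (φ x) a := rfl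

/-- Functoriality of `X ∧ K` in `X`. -/
def smashMap {X X' : PSSet.{u}} (f : X ⟶ X') (K : PSSet.{u}) : smash X K ⟶ smash X' K :=
  homMk (fun k => smashMapAt K (app f k) (app_pt f k))
    (fun {k l} θ => smash_ind fun x a => by
      rw [map_smashMk, smashMapAt_mk, smashMapAt_mk, map_smashMk, app_map])
    (fun k => congrArg (smashMk · (K.pt k)) (app_pt f k))

@[simp] lemma smashMap_mk {X X' : PSSet.{u}} (f : X ⟶ X') (K : PSSet.{u}) (k) (x : X.obj k)
    (a : K.obj k) : app (smashMap f K) k (smashMk x a) = smashMk (app f k x) a := rfl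

/-- The cartesian product of pointed simplicial sets. -/
def prod (X Y : PSSet.{u}) : PSSet.{u} :=
  ofData (fun k => X.obj k × Y.obj k) (fun {_ _} θ p => (X.map θ p.1, Y.map θ p.2))
    (fun _ p => Prod.ext (map_id X p.1) (map_id Y p.2))
    (fun θ θ' p => Prod.ext (map_comp X θ θ' p.1) (map_comp Y θ θ' p.2))
    (fun k => (X.pt k, Y.pt k)) (fun θ => Prod.ext (X.map_pt θ) (Y.map_pt θ))

/-- The relation on `X ⊔ Y` identifying the two base points. -/
def wedgeRel (X Y : PSSet.{u}) (k : SimplexCategoryᵒᵖ) (p q : X.obj k ⊕ Y.obj k) : Prop :=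
  p = Sum.inl (X.pt k) ∧ q = Sum.inr (Y.pt k)

/-- The wedge `X ∨ Y`: the disjoint union with base points identified. -/
def wedge (X Y : PSSet.{u}) : PSSet.{u} :=
  ofData (fun k => Quot (wedgeRel X Y k))
    (fun {_ _} θ => Quot.map (Sum.map (X.map θ) (Y.map θ)) (by
      rintro _ _ ⟨rfl, rfl⟩
      simp only [Sum.map_inl, Sum.map_inr, map, X.map_pt, Y.map_pt]
      exact ⟨rfl, rfl⟩))
    (by
      rintro k ⟨x | y⟩
      · exact congrArg (fun z => Quot.mk _ (Sum.inl z)) (map_id X x)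
      · exact congrArg (fun z => Quot.mk _ (Sum.inr z)) (map_id Y y))
    (by
      rintro k l m θ θ' ⟨x | y⟩
      · exact congrArg (fun z => Quot.mk _ (Sum.inl z)) (map_comp X θ θ' x)
      · exact congrArg (fun z => Quot.mk _ (Sum.inr z)) (map_comp Y θ θ' y))
    (fun k => Quot.mk _ (Sum.inl (X.pt k)))
    (fun θ => congrArg (fun z => Quot.mk _ (Sum.inl z)) (X.map_pt θ))

/-- The inclusion of the left summand of a wedge, on simplices. -/
def wedgeInl {X Y : PSSet.{u}} {k} (x : X.obj k) : (wedge X Y).obj k := Quot.mk _ (Sum.inl x)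

/-- The inclusion of the right summand of a wedge, on simplices. -/
def wedgeInr {X Y : PSSet.{u}} {k} (y : Y.obj k) : (wedge X Y).obj k := Quot.mk _ (Sum.inr y)

lemma wedgeInl_pt {X Y : PSSet.{u}} {k} : wedgeInl (X.pt k) = (wedge X Y).pt k := rfl

lemma wedgeInr_pt {X Y : PSSet.{u}} {k} : wedgeInr (Y.pt k) = (wedge X Y).pt k :=
  (Quot.sound ⟨rfl, rfl⟩).symm

lemma wedge_ind {X Y : PSSet.{u}} {k} {P : (wedge X Y).obj k → Prop}
    (hl : ∀ x, P (wedgeInl x)) (hr : ∀ y, P (wedgeInr y)) (z) : P z := by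
  obtain ⟨x | y⟩ := z
  · exact hl x
  · exact hr y

lemma map_wedgeInl {X Y : PSSet.{u}} {k l} (θ : k ⟶ l) (x : X.obj k) :
    (wedge X Y).map θ (wedgeInl x) = wedgeInl (X.map θ x) := rfl

lemma map_wedgeInr {X Y : PSSet.{u}} {k l} (θ : k ⟶ l) (y : Y.obj k) :
    (wedge X Y).map θ (wedgeInr y) = wedgeInr (Y.map θ y) := rfl

/-- The map of wedges induced by two pointed maps, in a fixed simplicial degree. -/
def wedgeMapAt {X Y X' Y' : PSSet.{u}} {k} (φ : X.obj k → X'.obj k) (ψ : Y.obj k → Y'.obj k)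
    (hφ : φ (X.pt k) = X'.pt k) (hψ : ψ (Y.pt k) = Y'.pt k) :
    (wedge X Y).obj k → (wedge X' Y').obj k :=
  Quot.map (Sum.map φ ψ) (by
    rintro _ _ ⟨rfl, rfl⟩
    exact ⟨congrArg Sum.inl hφ, congrArg Sum.inr hψ⟩)

/-- Functoriality of the wedge. -/
def wedgeMap {X Y X' Y' : PSSet.{u}} (f : X ⟶ X') (g : Y ⟶ Y') : wedge X Y ⟶ wedge X' Y' :=
  homMk (fun k => wedgeMapAt (app f k) (app g k) (app_pt f k) (app_pt g k))
    (fun θ => wedge_ind (fun x => congrArg wedgeInl (app_map f θ x))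
      (fun y => congrArg wedgeInr (app_map g θ y)))
    (fun k => congrArg wedgeInl (app_pt f k))

/-- The map `f ∨ g : X ∨ Y ⟶ Z` restricting to `f` on `X` and to `g` on `Y`. -/
def wedgeDesc {X Y Z : PSSet.{u}} (f : X ⟶ Z) (g : Y ⟶ Z) : wedge X Y ⟶ Z :=
  homMk (fun k => Quot.lift (Sum.elim (app f k) (app g k)) (by
      rintro _ _ ⟨rfl, rfl⟩
      simp))
    (by
      rintro k l θ ⟨x | y⟩
      · exact app_map f θ x
      · exact app_map g θ y)
    (fun k => app_pt f k)

@[simp] lemma wedgeDesc_inl {X Y Z : PSSet.{u}} (f : X ⟶ Z) (g : Y ⟶ Z) (k) (x : X.obj k) :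
    app (wedgeDesc f g) k (wedgeInl x) = app f k x := rfl

@[simp] lemma wedgeDesc_inr {X Y Z : PSSet.{u}} (f : X ⟶ Z) (g : Y ⟶ Z) (k) (y : Y.obj k) :
    app (wedgeDesc f g) k (wedgeInr y) = app g k y := rfl

/-- The relation on `(X ∧ interval) ⊔ Y` gluing `x ∧ 1` to `f x`. -/
def coneRel {X Y : PSSet.{u}} (f : X ⟶ Y) (k : SimplexCategoryᵒᵖ)
    (p q : (smash X interval).obj k ⊕ Y.obj k) : Prop :=
  ∃ x : X.obj k, p = Sum.inl (smashMk x (one k)) ∧ q = Sum.inr (app f k x)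

/-- The reduced mapping cone of `f : X ⟶ Y`: the pushout of the reduced cone
`X ∧ interval` and `Y` along `X`. -/
def cone {X Y : PSSet.{u}} (f : X ⟶ Y) : PSSet.{u} :=
  ofData (fun k => Quot (coneRel f k))
    (fun {_ _} θ => Quot.map (Sum.map ((smash X interval).map θ) (Y.map θ)) (by
      rintro _ _ ⟨x, rfl, rfl⟩
      simp only [Sum.map_inl, Sum.map_inr, ← app_map]
      exact ⟨X.map _ x, rfl, rfl⟩))
    (by
      rintro k ⟨x | y⟩
      · exact congrArg (fun z => Quot.mk _ (Sum.inl z)) (map_id _ x)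
      · exact congrArg (fun z => Quot.mk _ (Sum.inr z)) (map_id Y y))
    (by
      rintro k l m θ θ' ⟨x | y⟩
      · exact congrArg (fun z => Quot.mk _ (Sum.inl z)) (map_comp _ θ θ' x)
      · exact congrArg (fun z => Quot.mk _ (Sum.inr z)) (map_comp Y θ θ' y))
    (fun k => Quot.mk _ (Sum.inr (Y.pt k)))
    (fun θ => congrArg (fun z => Quot.mk _ (Sum.inr z)) (Y.map_pt θ))

/-- The simplex of the mapping cone represented by `x ∧ a`. -/
def coneInl {X Y : PSSet.{u}} (f : X ⟶ Y) {k} (x : X.obj k) (a : interval.{u}.obj k) :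
    (cone f).obj k := Quot.mk _ (Sum.inl (smashMk x a))

/-- The inclusion of the target in the mapping cone, on simplices. -/
def coneInr {X Y : PSSet.{u}} (f : X ⟶ Y) {k} (y : Y.obj k) : (cone f).obj k :=
  Quot.mk _ (Sum.inr y)

section cone

variable {X Y : PSSet.{u}} (f : X ⟶ Y)

lemma coneInr_pt {k} : coneInr f (Y.pt k) = (cone f).pt k := rfl

lemma coneInl_one {k} (x : X.obj k) : coneInl f x (one k) = coneInr f (app f k x) :=
  Quot.sound ⟨x, rfl, rfl⟩

lemma coneInl_pt_left {k} (a : interval.{u}.obj k) : coneInl f (X.pt k) a = (cone f).pt k := by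
  have h : coneInl f (X.pt k) a = coneInl f (X.pt k) (one k) := by
    exact congrArg (fun z => Quot.mk _ (Sum.inl z))
      ((smashMk_pt_left a).trans (smashMk_pt_left (one k)).symm)
  rw [h, coneInl_one, app_pt, coneInr_pt]

lemma coneInl_zero {k} (x : X.obj k) : coneInl f x (interval.pt k) = (cone f).pt k := by
  rw [← coneInl_pt_left f (interval.pt k)]
  exact congrArg (fun z => Quot.mk _ (Sum.inl z))
    ((smashMk_pt_right x).trans (smashMk_pt_left (interval.pt k)).symm)

lemma map_coneInl {k l} (θ : k ⟶ l) (x : X.obj k) (a : interval.{u}.obj k) :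
    (cone f).map θ (coneInl f x a) = coneInl f (X.map θ x) (interval.map θ a) := rfl

lemma map_coneInr {k l} (θ : k ⟶ l) (y : Y.obj k) :
    (cone f).map θ (coneInr f y) = coneInr f (Y.map θ y) := rfl

lemma cone_ind {k} {P : (cone f).obj k → Prop} (hl : ∀ x a, P (coneInl f x a))
    (hr : ∀ y, P (coneInr f y)) (z) : P z := by
  obtain ⟨⟨x, a⟩ | y⟩ := z
  · exact hl x a
  · exact hr y

/-- The map of mapping cones induced by a commutative square, in a fixed simplicial degree. -/
def coneMapAt {X' Y' : PSSet.{u}} (f : X ⟶ Y) (f' : X' ⟶ Y') {k} (φ : X.obj k → X'.obj k)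
    (ψ : Y.obj k → Y'.obj k) (hφ : φ (X.pt k) = X'.pt k)
    (w : ∀ x, app f' k (φ x) = ψ (app f k x)) : (cone f).obj k → (cone f').obj k :=
  Quot.map (Sum.map (smashMapAt interval φ hφ) ψ) (by
    rintro _ _ ⟨x, rfl, rfl⟩
    exact ⟨φ x, rfl, congrArg Sum.inr (w x).symm⟩)

/-- The map of mapping cones induced by a commutative square. -/
def coneMap {X' Y' : PSSet.{u}} {f : X ⟶ Y} {f' : X' ⟶ Y'} (p : X ⟶ X') (q : Y ⟶ Y')
    (w : p ≫ f' = f ≫ q) : cone f ⟶ cone f' :=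
  homMk (fun k => coneMapAt f f' (app p k) (app q k) (app_pt p k)
      (fun x => congrArg (fun g => app g k x) w))
    (fun θ => cone_ind f (fun x _ => congrArg (coneInl f' · _) (app_map p θ x))
      (fun y => congrArg (coneInr f') (app_map q θ y)))
    (fun k => congrArg (coneInr f') (app_pt q k))

@[simp] lemma coneMap_inl {X' Y' : PSSet.{u}} {f : X ⟶ Y} {f' : X' ⟶ Y'} (p : X ⟶ X')
    (q : Y ⟶ Y') (w : p ≫ f' = f ≫ q) (k) (x : X.obj k) (a : interval.{u}.obj k) :
    app (coneMap p q w) k (coneInl f x a) = coneInl f' (app p k x) a := rfl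

@[simp] lemma coneMap_inr {X' Y' : PSSet.{u}} {f : X ⟶ Y} {f' : X' ⟶ Y'} (p : X ⟶ X')
    (q : Y ⟶ Y') (w : p ≫ f' = f ≫ q) (k) (y : Y.obj k) :
    app (coneMap p q w) k (coneInr f y) = coneInr f' (app q k y) := rfl

end cone

/-- The loop space `ΩY`: its simplices in degree `k` are the maps `Δ[k] × S¹ ⟶ Y` that send
`Δ[k] × *` to the base point, i.e. the pointed maps `Δ[k]₊ ∧ S¹ ⟶ Y`. -/
def loop (Y : PSSet.{u}) : SSet.{u} where
  obj k := {f : SSet.stdSimplex.{u}.obj k.unop ⊗ circle.toSSet ⟶ Y.toSSet //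
    ∀ l (a : (SSet.stdSimplex.{u}.obj k.unop).obj l), f.app l (a, circle.pt l) = Y.pt l}
  map θ := ↾fun f => ⟨SSet.stdSimplex.map θ.unop ▷ circle.toSSet ≫ f.1,
    fun l a => f.2 l ((SSet.stdSimplex.map θ.unop).app l a)⟩
  map_id k := by
    ext f : 3
    apply Subtype.ext
    change SSet.stdSimplex.map (𝟙 k).unop ▷ circle.toSSet ≫ f.1 = f.1
    have e : SSet.stdSimplex.{u}.map (𝟙 k).unop = 𝟙 (SSet.stdSimplex.{u}.obj k.unop) :=
      SSet.stdSimplex.{u}.map_id k.unop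
    rw [e, id_whiskerRight, Category.id_comp]
  map_comp θ θ' := by
    ext f : 3
    apply Subtype.ext
    change SSet.stdSimplex.map (θ ≫ θ').unop ▷ circle.toSSet ≫ f.1 =
      SSet.stdSimplex.map θ'.unop ▷ circle.toSSet ≫ SSet.stdSimplex.map θ.unop ▷ circle.toSSet ≫ f.1
    have e : SSet.stdSimplex.{u}.map (θ ≫ θ').unop =
        SSet.stdSimplex.map θ'.unop ≫ SSet.stdSimplex.map θ.unop :=
      SSet.stdSimplex.{u}.map_comp θ'.unop θ.unop
    rw [e, comp_whiskerRight, Category.assoc]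

/-- The map `X × Y ⟶ X ∧ Y`. -/
def toSmash (X Y : PSSet.{u}) : X.toSSet ⊗ Y.toSSet ⟶ (smash X Y).toSSet where
  app _ := ↾fun p => smashMk p.1 p.2
  naturality _ _ _ := rfl

/-- The map `X ⟶ ΩY` adjoint to `σ : X ∧ S¹ ⟶ Y`; it sends `x` to `(θ, b) ↦ σ (θ^* x ∧ b)`. -/
def toLoop {X Y : PSSet.{u}} (σ : smash X circle ⟶ Y) : X.toSSet ⟶ loop Y where
  app _ := ↾fun x => ⟨SSet.yonedaEquiv.symm x ▷ circle.toSSet ≫ toSmash X circle ≫ σ.toHom,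
    fun l a => by
      change app σ l (smashMk ((SSet.yonedaEquiv.symm x).app l a) (circle.pt l)) = _
      rw [smashMk_pt_right, app_pt]⟩
  naturality _ _ θ := by
    ext x : 3
    apply Subtype.ext
    change SSet.yonedaEquiv.symm (X.toSSet.map θ x) ▷ _ ≫ _ =
      SSet.stdSimplex.map θ.unop ▷ _ ≫ SSet.yonedaEquiv.symm x ▷ _ ≫ _
    rw [← comp_whiskerRight_assoc]
    congr 2
    exact (SSet.yonedaEquiv_symm_naturality_left _ _).symm

end PSSet

/-! ### Weak equivalences of simplicial sets -/

/-- Precomposition with `f` preserves simplicial homotopy. -/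
lemma sset_homotopy_precomp {X Y K : SSet.{u}} (f : X ⟶ Y) (g g' : Y ⟶ K)
    (h : Nonempty (SSet.Homotopy g g')) : Nonempty (SSet.Homotopy (f ≫ g) (f ≫ g')) := by
  obtain ⟨H⟩ := h
  exact ⟨{ h := f ▷ _ ≫ H.h
           h₀ := by
            rw [SSet.ι₀_comp_assoc, SSet.Homotopy.h₀ H]; rfl
           h₁ := by
            rw [SSet.ι₁_comp_assoc, SSet.Homotopy.h₁ H]; rfl
           rel := by
            ext k ⟨⟨_, hx⟩, _⟩
            exact hx.elim }⟩

/-- A map `f : X ⟶ Y` of simplicial sets is a weak (homotopy) equivalence if it induces a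
bijection `[Y, K] → [X, K]` on simplicial homotopy classes of maps to every Kan complex `K`. -/
def IsWeakEquiv {X Y : SSet.{u}} (f : X ⟶ Y) : Prop :=
  ∀ K : SSet.{u}, SSet.KanComplex K →
    Function.Bijective (Quot.map (ra := fun g g' : Y ⟶ K => Nonempty (SSet.Homotopy g g'))
      (rb := fun g g' : X ⟶ K => Nonempty (SSet.Homotopy g g'))
      (fun g => f ≫ g) (sset_homotopy_precomp f))

/-! ### Symmetric spectra -/

/-- The underlying data of a symmetric spectrum (of simplicial sets): pointed simplicial sets
`X 0, X 1, …` with left actions of the symmetric groups and structure maps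
`X n ∧ S¹ ⟶ X (n + 1)`. -/
structure SpectrumData : Type (u + 1) where
  level : ℕ → PSSet.{u}
  act : ∀ n, Equiv.Perm (Fin n) →* End (level n)
  str : ∀ n, PSSet.smash (level n) PSSet.circle ⟶ level (n + 1)

namespace SpectrumData

/-- The structure map on simplices: `x, b ↦ σ (x ∧ b)`. -/
def σ (X : SpectrumData.{u}) {n : ℕ} {k : SimplexCategoryᵒᵖ} (x : (X.level n).obj k)
    (b : PSSet.circle.{u}.obj k) : (X.level (n + 1)).obj k :=
  PSSet.app (X.str n) k (PSSet.smashMk x b)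

/-- The action of a permutation on simplices. -/
def perm (X : SpectrumData.{u}) {n : ℕ} {k : SimplexCategoryᵒᵖ} (ρ : Equiv.Perm (Fin n))
    (x : (X.level n).obj k) : (X.level n).obj k :=
  PSSet.app (X.act n ρ) k x

/-- The iterated structure map `X n ∧ S^m ⟶ X (n + m)`, on simplices
`x ∧ b 0 ∧ ⋯ ∧ b (m - 1)`. -/
def iter (X : SpectrumData.{u}) {n : ℕ} {k : SimplexCategoryᵒᵖ} (x : (X.level n).obj k) :
    ∀ m : ℕ, (Fin m → PSSet.circle.{u}.obj k) → (X.level (n + m)).obj k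
  | 0, _ => x
  | m + 1, b => X.σ (X.iter x m (Fin.init b)) (b (Fin.last m))

end SpectrumData

/-- The block sum `Σ_n × Σ_m → Σ_{n+m}`. -/
def blockSum {n m : ℕ} (ρ : Equiv.Perm (Fin n)) (τ : Equiv.Perm (Fin m)) :
    Equiv.Perm (Fin (n + m)) :=
  finSumFinEquiv.permCongr (Equiv.Perm.sumCongr ρ τ)

/-- A symmetric spectrum: the iterated structure maps `X n ∧ S^m ⟶ X (n + m)` are
`Σ_n × Σ_m`-equivariant, where `Σ_m` permutes the smash factors of `S^m = S¹ ∧ ⋯ ∧ S¹`. -/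
structure SymSpectrum : Type (u + 1) extends SpectrumData.{u} where
  equivariant : ∀ (n m : ℕ) (ρ : Equiv.Perm (Fin n)) (τ : Equiv.Perm (Fin m))
    (k : SimplexCategoryᵒᵖ) (x : (level n).obj k) (b : Fin m → PSSet.circle.{u}.obj k),
    toSpectrumData.iter (toSpectrumData.perm ρ x) m (fun i => b (τ.symm i)) =
      toSpectrumData.perm (blockSum ρ τ) (toSpectrumData.iter x m b)

namespace SymSpectrum

/-- A morphism of symmetric spectra: equivariant pointed maps commuting with structure maps. -/
@[ext]
structure Hom (X Y : SymSpectrum.{u}) : Type u where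
  app : ∀ n, X.level n ⟶ Y.level n
  app_perm : ∀ (n : ℕ) (ρ : Equiv.Perm (Fin n)) (k) (x : (X.level n).obj k),
    PSSet.app (app n) k (X.perm ρ x) = Y.perm ρ (PSSet.app (app n) k x)
  app_σ : ∀ (n : ℕ) (k) (x : (X.level n).obj k) (b : PSSet.circle.{u}.obj k),
    PSSet.app (app (n + 1)) k (X.σ x b) = Y.σ (PSSet.app (app n) k x) b

instance : Category.{u} SymSpectrum.{u} where
  Hom := Hom
  id X := ⟨fun n => 𝟙 (X.level n), fun _ _ _ _ => rfl, fun _ _ _ _ => rfl⟩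
  comp f g := ⟨fun n => f.app n ≫ g.app n,
    fun n ρ k x => by simp only [PSSet.app_comp, f.app_perm, g.app_perm],
    fun n k x b => by simp only [PSSet.app_comp, f.app_σ, g.app_σ]⟩

lemma hom_ext {X Y : SymSpectrum.{u}} {f g : X ⟶ Y} (h : ∀ n, f.app n = g.app n) : f = g :=
  Hom.ext (funext h)

@[simp] lemma id_app (X : SymSpectrum.{u}) (n) : (𝟙 X : X ⟶ X).app n = 𝟙 (X.level n) := rfl

@[simp] lemma comp_app {X Y Z : SymSpectrum.{u}} (f : X ⟶ Y) (g : Y ⟶ Z) (n) :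
    (f ≫ g).app n = f.app n ≫ g.app n := rfl

lemma perm_pt (X : SpectrumData.{u}) {n : ℕ} (ρ : Equiv.Perm (Fin n)) (k) :
    X.perm ρ ((X.level n).pt k) = (X.level n).pt k := PSSet.app_pt _ _

lemma perm_one (X : SpectrumData.{u}) {n : ℕ} (k) (x : (X.level n).obj k) :
    X.perm 1 x = x := by
  simp only [SpectrumData.perm, _root_.map_one]; rfl

lemma perm_mul (X : SpectrumData.{u}) {n : ℕ} (ρ ρ' : Equiv.Perm (Fin n)) (k)
    (x : (X.level n).obj k) : X.perm (ρ * ρ') x = X.perm ρ (X.perm ρ' x) := by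
  simp only [SpectrumData.perm, _root_.map_mul]; rfl

lemma map_perm (X : SpectrumData.{u}) {n : ℕ} (ρ : Equiv.Perm (Fin n)) {k l} (θ : k ⟶ l)
    (x : (X.level n).obj k) :
    X.perm ρ ((X.level n).map θ x) = (X.level n).map θ (X.perm ρ x) := PSSet.app_map _ _ _

lemma σ_pt_left (X : SpectrumData.{u}) {n : ℕ} {k} (b : PSSet.circle.{u}.obj k) :
    X.σ ((X.level n).pt k) b = (X.level (n + 1)).pt k := by
  rw [SpectrumData.σ, PSSet.smashMk_pt_left, PSSet.app_pt]

lemma σ_pt_right (X : SpectrumData.{u}) {n : ℕ} {k} (x : (X.level n).obj k) :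
    X.σ x (PSSet.circle.pt k) = (X.level (n + 1)).pt k := by
  rw [SpectrumData.σ, PSSet.smashMk_pt_right, PSSet.app_pt]

lemma map_σ (X : SpectrumData.{u}) {n : ℕ} {k l} (θ : k ⟶ l) (x : (X.level n).obj k)
    (b : PSSet.circle.{u}.obj k) :
    X.σ ((X.level n).map θ x) (PSSet.circle.map θ b) = (X.level (n + 1)).map θ (X.σ x b) :=
  PSSet.app_map (X.str n) θ (PSSet.smashMk x b)

/-- Helper for the constructions below: if `F` sends simplices of the levels of `X` to those of
`Y` and commutes with `σ`, it commutes with the iterated structure maps. -/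
lemma iter_comm {X Y : SpectrumData.{u}} {k : SimplexCategoryᵒᵖ}
    (F : ∀ n, (X.level n).obj k → (Y.level n).obj k)
    (hF : ∀ n (x : (X.level n).obj k) b, F (n + 1) (X.σ x b) = Y.σ (F n x) b)
    {n : ℕ} (x : (X.level n).obj k) : ∀ (m : ℕ) (b : Fin m → PSSet.circle.{u}.obj k),
    F (n + m) (X.iter x m b) = Y.iter (F n x) m b
  | 0, _ => rfl
  | m + 1, b => by
    change F (n + m + 1) (X.σ _ _) = Y.σ _ _
    rw [hF, iter_comm F hF x m]

/-! #### Constructions on symmetric spectra, all performed levelwise -/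

/-- Data of the smash product of a symmetric spectrum with a pointed simplicial set. -/
def smashData (X : SymSpectrum.{u}) (K : PSSet.{u}) : SpectrumData.{u} where
  level n := PSSet.smash (X.level n) K
  act n :=
    { toFun := fun ρ => PSSet.smashMap (X.act n ρ) K
      map_one' := PSSet.hom_ext fun k => PSSet.smash_ind fun x a => by
        rw [PSSet.smashMap_mk]
        exact congrArg (PSSet.smashMk · a) (perm_one _ k x)
      map_mul' := fun ρ ρ' => PSSet.hom_ext fun k => PSSet.smash_ind fun x a => by
        rw [PSSet.smashMap_mk]
        exact congrArg (PSSet.smashMk · a) (perm_mul _ ρ ρ' k x) }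
  str n := PSSet.smashDesc
    (fun k z b => PSSet.smashMapAt K (fun x => X.σ x b) (σ_pt_left _ b) z)
    (fun θ z b => by
      induction z using PSSet.smash_ind with
      | h x a => exact congrArg (PSSet.smashMk · _) (map_σ _ θ x b))
    (fun k b => congrArg (PSSet.smashMk · _) (σ_pt_left _ b))
    (fun k z => by
      induction z using PSSet.smash_ind with
      | h x a =>
        rw [PSSet.smashMapAt_mk, σ_pt_right, PSSet.smashMk_pt_left])

/-- The smash product `X ∧ K` of a symmetric spectrum with a pointed simplicial set. -/
def smash (X : SymSpectrum.{u}) (K : PSSet.{u}) : SymSpectrum.{u} where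
  toSpectrumData := X.smashData K
  equivariant n m ρ τ k z b := by
    induction z using PSSet.smash_ind with
    | h x a =>
      have key : ∀ (x : (X.level n).obj k) (b : Fin m → PSSet.circle.{u}.obj k),
          (X.smashData K).iter (PSSet.smashMk x a) m b = PSSet.smashMk (X.iter x m b) a :=
        fun x b => (iter_comm (X := X.toSpectrumData) (Y := X.smashData K)
          (fun _ x => PSSet.smashMk x a) (fun _ _ _ => rfl) x m b).symm
      change (X.smashData K).iter (PSSet.smashMk (X.perm ρ x) a) m _ = _
      rw [key, key, X.equivariant]
      rfl

/-- The suspension `ΣX = X ∧ S¹`. -/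
def susp (X : SymSpectrum.{u}) : SymSpectrum.{u} := X.smash PSSet.circle

/-- Data of the product of symmetric spectra. -/
def prodData (X Y : SymSpectrum.{u}) : SpectrumData.{u} where
  level n := PSSet.prod (X.level n) (Y.level n)
  act _ :=
    { toFun := fun ρ => PSSet.homMk (fun _ p => (X.perm ρ p.1, Y.perm ρ p.2))
        (fun θ p => Prod.ext (map_perm _ ρ θ p.1) (map_perm _ ρ θ p.2))
        (fun k => Prod.ext (perm_pt _ ρ k) (perm_pt _ ρ k))
      map_one' := PSSet.hom_ext fun k p => Prod.ext (perm_one _ k p.1) (perm_one _ k p.2)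
      map_mul' := fun ρ ρ' => PSSet.hom_ext fun k p =>
        Prod.ext (perm_mul _ ρ ρ' k p.1) (perm_mul _ ρ ρ' k p.2) }
  str _ := PSSet.smashDesc (fun _ p b => (X.σ p.1 b, Y.σ p.2 b))
    (fun θ p b => Prod.ext (map_σ _ θ p.1 b) (map_σ _ θ p.2 b))
    (fun _ b => Prod.ext (σ_pt_left _ b) (σ_pt_left _ b))
    (fun _ p => Prod.ext (σ_pt_right _ p.1) (σ_pt_right _ p.2))

/-- The product `X × Y` of symmetric spectra. -/
def prod (X Y : SymSpectrum.{u}) : SymSpectrum.{u} where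
  toSpectrumData := prodData X Y
  equivariant n m ρ τ k p b := by
    have key : ∀ (p : ((prodData X Y).level n).obj k) (b : Fin m → PSSet.circle.{u}.obj k),
        (prodData X Y).iter p m b = (X.iter p.1 m b, Y.iter p.2 m b) := fun p b =>
      Prod.ext
        (iter_comm (X := prodData X Y) (Y := X.toSpectrumData) (fun _ q => q.1)
          (fun _ _ _ => rfl) p m b)
        (iter_comm (X := prodData X Y) (Y := Y.toSpectrumData) (fun _ q => q.2)
          (fun _ _ _ => rfl) p m b)
    rw [key, key]
    exact Prod.ext (X.equivariant n m ρ τ k p.1 b) (Y.equivariant n m ρ τ k p.2 b)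

/-- The map `f Π g : Z ⟶ X × Y` with components `f` and `g`. -/
def prodLift {X Y Z : SymSpectrum.{u}} (f : Z ⟶ X) (g : Z ⟶ Y) : Z ⟶ prod X Y where
  app n := PSSet.homMk (fun k z => (PSSet.app (f.app n) k z, PSSet.app (g.app n) k z))
    (fun θ z => Prod.ext (PSSet.app_map _ θ z) (PSSet.app_map _ θ z))
    (fun k => Prod.ext (PSSet.app_pt _ k) (PSSet.app_pt _ k))
  app_perm n ρ k z := Prod.ext (f.app_perm n ρ k z) (g.app_perm n ρ k z)
  app_σ n k z b := Prod.ext (f.app_σ n k z b) (g.app_σ n k z b)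

lemma comp_prodLift {X Y Z W : SymSpectrum.{u}} (h : W ⟶ Z) (f : Z ⟶ X) (g : Z ⟶ Y) :
    h ≫ prodLift f g = prodLift (h ≫ f) (h ≫ g) := rfl

/-- Data of the wedge of symmetric spectra. -/
def wedgeData (X Y : SymSpectrum.{u}) : SpectrumData.{u} where
  level n := PSSet.wedge (X.level n) (Y.level n)
  act n :=
    { toFun := fun ρ => PSSet.wedgeMap (X.act n ρ) (Y.act n ρ)
      map_one' := PSSet.hom_ext fun k => PSSet.wedge_ind
        (fun x => congrArg PSSet.wedgeInl (perm_one _ k x))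
        (fun y => congrArg PSSet.wedgeInr (perm_one _ k y))
      map_mul' := fun ρ ρ' => PSSet.hom_ext fun k => PSSet.wedge_ind
        (fun x => congrArg PSSet.wedgeInl (perm_mul _ ρ ρ' k x))
        (fun y => congrArg PSSet.wedgeInr (perm_mul _ ρ ρ' k y)) }
  str n := PSSet.smashDesc
    (fun k z b => PSSet.wedgeMapAt (fun x => X.σ x b) (fun y => Y.σ y b) (σ_pt_left _ b)
      (σ_pt_left _ b) z)
    (fun θ z b => by
      induction z using PSSet.wedge_ind with
      | hl x => exact congrArg PSSet.wedgeInl (map_σ _ θ x b)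
      | hr y => exact congrArg PSSet.wedgeInr (map_σ _ θ y b))
    (fun k b => congrArg PSSet.wedgeInl (σ_pt_left _ b))
    (fun k z => by
      induction z using PSSet.wedge_ind with
      | hl x => exact congrArg PSSet.wedgeInl (σ_pt_right _ x)
      | hr y => exact (congrArg PSSet.wedgeInr (σ_pt_right _ y)).trans PSSet.wedgeInr_pt)

/-- The wedge `X ∨ Y` of symmetric spectra. -/
def wedge (X Y : SymSpectrum.{u}) : SymSpectrum.{u} where
  toSpectrumData := wedgeData X Y
  equivariant n m ρ τ k z b := by
    induction z using PSSet.wedge_ind with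
    | hl x =>
      have key : ∀ (x : (X.level n).obj k) (b : Fin m → PSSet.circle.{u}.obj k),
          (wedgeData X Y).iter (PSSet.wedgeInl x) m b = PSSet.wedgeInl (X.iter x m b) :=
        fun x b => (iter_comm (X := X.toSpectrumData) (Y := wedgeData X Y)
          (fun _ x => PSSet.wedgeInl x) (fun _ _ _ => rfl) x m b).symm
      change (wedgeData X Y).iter (PSSet.wedgeInl (X.perm ρ x)) m _ = _
      rw [key, key, X.equivariant]
      rfl
    | hr y =>
      have key : ∀ (y : (Y.level n).obj k) (b : Fin m → PSSet.circle.{u}.obj k),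
          (wedgeData X Y).iter (PSSet.wedgeInr y) m b = PSSet.wedgeInr (Y.iter y m b) :=
        fun y b => (iter_comm (X := Y.toSpectrumData) (Y := wedgeData X Y)
          (fun _ y => PSSet.wedgeInr y) (fun _ _ _ => rfl) y m b).symm
      change (wedgeData X Y).iter (PSSet.wedgeInr (Y.perm ρ y)) m _ = _
      rw [key, key, Y.equivariant]
      rfl

/-- The map `f ∨ g : X ∨ Y ⟶ Z` restricting to `f` on `X` and to `g` on `Y`. -/
def wedgeDesc {X Y Z : SymSpectrum.{u}} (f : X ⟶ Z) (g : Y ⟶ Z) : wedge X Y ⟶ Z where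
  app n := PSSet.wedgeDesc (f.app n) (g.app n)
  app_perm n ρ k := PSSet.wedge_ind (f.app_perm n ρ k) (g.app_perm n ρ k)
  app_σ n k := PSSet.wedge_ind (f.app_σ n k) (g.app_σ n k)

/-- Data of the mapping cone of a map of symmetric spectra. -/
def coneData {X Y : SymSpectrum.{u}} (f : X ⟶ Y) : SpectrumData.{u} where
  level n := PSSet.cone (f.app n)
  act n :=
    { toFun := fun ρ => PSSet.coneMap (X.act n ρ) (Y.act n ρ)
        (PSSet.hom_ext fun k x => f.app_perm n ρ k x)
      map_one' := PSSet.hom_ext fun k => PSSet.cone_ind _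
        (fun x a => congrArg (PSSet.coneInl (f.app n) · a) (perm_one _ k x))
        (fun y => congrArg (PSSet.coneInr (f.app n)) (perm_one _ k y))
      map_mul' := fun ρ ρ' => PSSet.hom_ext fun k => PSSet.cone_ind _
        (fun x a => congrArg (PSSet.coneInl (f.app n) · a) (perm_mul _ ρ ρ' k x))
        (fun y => congrArg (PSSet.coneInr (f.app n)) (perm_mul _ ρ ρ' k y)) }
  str n := PSSet.smashDesc
    (fun k z b => PSSet.coneMapAt (f.app n) (f.app (n + 1)) (fun x => X.σ x b)
      (fun y => Y.σ y b) (σ_pt_left _ b) (fun x => f.app_σ n k x b) z)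
    (fun θ z b => by
      induction z using PSSet.cone_ind with
      | hl x a => exact congrArg (PSSet.coneInl (f.app (n + 1)) · _) (map_σ _ θ x b)
      | hr y => exact congrArg (PSSet.coneInr (f.app (n + 1))) (map_σ _ θ y b))
    (fun k b => congrArg (PSSet.coneInr (f.app (n + 1))) (σ_pt_left _ b))
    (fun k z => by
      induction z using PSSet.cone_ind with
      | hl x a =>
        exact (congrArg (PSSet.coneInl (f.app (n + 1)) · a) (σ_pt_right _ x)).trans
          (PSSet.coneInl_pt_left _ a)
      | hr y => exact congrArg (PSSet.coneInr (f.app (n + 1))) (σ_pt_right _ y))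

/-- The homotopy cofiber of a map of symmetric spectra: its (reduced) mapping cone. -/
def cone {X Y : SymSpectrum.{u}} (f : X ⟶ Y) : SymSpectrum.{u} where
  toSpectrumData := coneData f
  equivariant n m ρ τ k z b := by
    induction z using PSSet.cone_ind with
    | hl x a =>
      have key : ∀ (x : (X.level n).obj k) (b : Fin m → PSSet.circle.{u}.obj k),
          (coneData f).iter (PSSet.coneInl (f.app n) x a) m b =
            PSSet.coneInl (f.app (n + m)) (X.iter x m b) a :=
        fun x b => (iter_comm (X := X.toSpectrumData) (Y := coneData f)
          (fun i x => PSSet.coneInl (f.app i) x a) (fun _ _ _ => rfl) x m b).symm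
      change (coneData f).iter (PSSet.coneInl (f.app n) (X.perm ρ x) a) m _ = _
      rw [key, key, X.equivariant]
      rfl
    | hr y =>
      have key : ∀ (y : (Y.level n).obj k) (b : Fin m → PSSet.circle.{u}.obj k),
          (coneData f).iter (PSSet.coneInr (f.app n) y) m b =
            PSSet.coneInr (f.app (n + m)) (Y.iter y m b) :=
        fun y b => (iter_comm (X := Y.toSpectrumData) (Y := coneData f)
          (fun i y => PSSet.coneInr (f.app i) y) (fun _ _ _ => rfl) y m b).symm
      change (coneData f).iter (PSSet.coneInr (f.app n) (Y.perm ρ y)) m _ = _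
      rw [key, key, Y.equivariant]
      rfl

/-- The map of homotopy cofibers induced by a commutative square. -/
def coneMap {X Y X' Y' : SymSpectrum.{u}} {f : X ⟶ Y} {f' : X' ⟶ Y'} (p : X ⟶ X') (q : Y ⟶ Y')
    (w : p ≫ f' = f ≫ q) : cone f ⟶ cone f' where
  app n := PSSet.coneMap (p.app n) (q.app n) (congrArg (fun h => Hom.app h n) w)
  app_perm n ρ k := PSSet.cone_ind _
    (fun x a => congrArg (PSSet.coneInl (f'.app n) · a) (p.app_perm n ρ k x))
    (fun y => congrArg (PSSet.coneInr (f'.app n)) (q.app_perm n ρ k y))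
  app_σ n k z b := by
    induction z using PSSet.cone_ind with
    | hl x a => exact congrArg (PSSet.coneInl (f'.app (n + 1)) · a) (p.app_σ n k x b)
    | hr y => exact congrArg (PSSet.coneInr (f'.app (n + 1))) (q.app_σ n k y b)

/-- The homotopy cofiber as a functor on arrows. -/
def coneFunctor : Arrow SymSpectrum.{u} ⥤ SymSpectrum.{u} where
  obj f := cone f.hom
  map φ := coneMap φ.left φ.right φ.w
  map_id _ := hom_ext fun _ => PSSet.hom_ext fun _ => PSSet.cone_ind _ (fun _ _ => rfl)
    (fun _ => rfl)
  map_comp _ _ := hom_ext fun _ => PSSet.hom_ext fun _ => PSSet.cone_ind _ (fun _ _ => rfl)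
    (fun _ => rfl)

/-! #### Stable equivalences -/

/-- A level equivalence: a weak equivalence of simplicial sets in every level. -/
def IsLevelEquiv {X Y : SymSpectrum.{u}} (f : X ⟶ Y) : Prop :=
  ∀ n, IsWeakEquiv (f.app n).toHom

/-- A monomorphism: injective in every level and every simplicial degree. -/
def IsMono {X Y : SymSpectrum.{u}} (f : X ⟶ Y) : Prop :=
  ∀ n k, Function.Injective (PSSet.app (f.app n) k)

/-- Injective symmetric spectra: maps to `E` extend along every monomorphism that is a level
equivalence. -/
def IsInjective (E : SymSpectrum.{u}) : Prop :=
  ∀ (A B : SymSpectrum.{u}) (i : A ⟶ B), IsMono i → IsLevelEquiv i →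
    ∀ f : A ⟶ E, ∃ g : B ⟶ E, i ≫ g = f

/-- `Ω`-spectra: every level is a Kan complex, and the adjoint structure maps
`E n ⟶ Ω E (n + 1)` are weak equivalences. -/
def IsOmegaSpectrum (E : SymSpectrum.{u}) : Prop :=
  ∀ n, SSet.KanComplex (E.level n).toSSet ∧ IsWeakEquiv (PSSet.toLoop (E.str n))

/-- A homotopy between maps of symmetric spectra, i.e. a map `X ∧ Δ[1]₊ ⟶ Y`, given by maps
`X n × Δ[1] ⟶ Y n` that are compatible with all the structure in the first variable. -/
structure Homotopy {X Y : SymSpectrum.{u}} (f g : X ⟶ Y) : Type u where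
  h : ∀ n, (X.level n).toSSet ⊗ PSSet.delta1.{u} ⟶ (Y.level n).toSSet
  h_pt : ∀ n k (a : PSSet.delta1.{u}.obj k), (h n).app k ((X.level n).pt k, a) = (Y.level n).pt k
  h_perm : ∀ n (ρ : Equiv.Perm (Fin n)) k (x : (X.level n).obj k) (a : PSSet.delta1.{u}.obj k),
    (h n).app k (X.perm ρ x, a) = Y.perm ρ ((h n).app k (x, a))
  h_σ : ∀ n k (x : (X.level n).obj k) (b : PSSet.circle.{u}.obj k) (a : PSSet.delta1.{u}.obj k),
    (h (n + 1)).app k (X.σ x b, a) = Y.σ ((h n).app k (x, a)) b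
  h_zero : ∀ n, SSet.ι₀ ≫ h n = (f.app n).toHom
  h_one : ∀ n, SSet.ι₁ ≫ h n = (g.app n).toHom

/-- Precomposition preserves homotopies. -/
def Homotopy.precomp {X Y Z : SymSpectrum.{u}} (f : X ⟶ Y) {g g' : Y ⟶ Z} (H : Homotopy g g') :
    Homotopy (f ≫ g) (f ≫ g') where
  h n := (f.app n).toHom ▷ _ ≫ H.h n
  h_pt n k a := by
    change (H.h n).app k (PSSet.app (f.app n) k ((X.level n).pt k), a) = _
    rw [PSSet.app_pt, H.h_pt]
  h_perm n ρ k x a := by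
    change (H.h n).app k (PSSet.app (f.app n) k (X.perm ρ x), a) = _
    rw [f.app_perm, H.h_perm]
    rfl
  h_σ n k x b a := by
    change (H.h (n + 1)).app k (PSSet.app (f.app (n + 1)) k (X.σ x b), a) = _
    rw [f.app_σ, H.h_σ]
    rfl
  h_zero n := by rw [SSet.ι₀_comp_assoc, H.h_zero]; rfl
  h_one n := by rw [SSet.ι₁_comp_assoc, H.h_one]; rfl

/-- The set `E⁰(X) = [X, E]`: maps modulo the equivalence relation generated by homotopy, i.e.
the components of the mapping space. -/
def HomotopyClasses (X E : SymSpectrum.{u}) : Type u :=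
  Quot (fun f g : X ⟶ E => Nonempty (Homotopy f g))

/-- The map `E⁰(f) : E⁰(Y) → E⁰(X)` induced by `f : X ⟶ Y`. -/
def HomotopyClasses.precomp {X Y : SymSpectrum.{u}} (f : X ⟶ Y) (E : SymSpectrum.{u}) :
    HomotopyClasses Y E → HomotopyClasses X E :=
  Quot.map (fun g => f ≫ g) (fun _ _ ⟨H⟩ => ⟨H.precomp f⟩)

/-- Stable equivalences: `E⁰(f)` is bijective for every injective `Ω`-spectrum `E`. -/
def IsStableEquiv {X Y : SymSpectrum.{u}} (f : X ⟶ Y) : Prop :=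
  ∀ E : SymSpectrum.{u}, IsInjective E → IsOmegaSpectrum E →
    Function.Bijective (HomotopyClasses.precomp f E)

/-- `X ≃ Y`: the symmetric spectra `X` and `Y` are connected by a zigzag of stable
equivalences. -/
def Equivalent (X Y : SymSpectrum.{u}) : Prop :=
  Relation.EqvGen (fun A B : SymSpectrum.{u} => ∃ f : A ⟶ B, IsStableEquiv f) X Y

/-! #### Cubes and higher cofibers -/

/-- The category of `n`-cubes of symmetric spectra, i.e. of functors `{0 → 1}ⁿ ⥤ SymSpectrum`,
as iterated arrow category: an `(n + 1)`-cube `Γ` is the arrow `Γ(?, …, ?, 0) ⟶ Γ(?, …, ?, 1)`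
of `n`-cubes. -/
def Cube : ℕ → Cat.{u, u + 1}
  | 0 => Cat.of SymSpectrum.{u}
  | n + 1 => Cat.of (Arrow (Cube n))

/-- The higher cofiber `C_n`: `C_0` is the identity, and `C_{n+1} Γ` is the homotopy cofiber of
`C_n Γ(?, …, ?, 0) ⟶ C_n Γ(?, …, ?, 1)`. -/
def higherCofiber : ∀ n : ℕ, Cube.{u} n ⥤ SymSpectrum.{u}
  | 0 => 𝟭 SymSpectrum.{u}
  | n + 1 => (higherCofiber n).mapArrow ⋙ coneFunctor

/-- The `2`-cube `X` with maps `a`, `b` in the first and `c`, `d` in the second coordinate. -/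
def square {X₀₀ X₁₀ X₀₁ X₁₁ : SymSpectrum.{u}} (a : X₀₀ ⟶ X₁₀) (b : X₀₁ ⟶ X₁₁)
    (c : X₀₀ ⟶ X₀₁) (d : X₁₀ ⟶ X₁₁) (w : a ≫ d = c ≫ b) : Cube.{u} 2 :=
  Arrow.mk (Arrow.homMk c d w.symm : Arrow.mk a ⟶ Arrow.mk b)

/-- A strictly commutative cube of symmetric spectra
```
          N₁₀₁ ---γ---> N₁₁₁
    β ↗  |        δ ↗   |            vertical maps (upwards):
  N₀₀₁ ---α---> N₀₁₁    |            ζ : N₀₀₀ ⟶ N₀₀₁,  ε : N₁₀₀ ⟶ N₁₀₁,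
   |    N₁₀₀ -μ- | ---> N₁₁₀         κ : N₀₁₀ ⟶ N₀₁₁,  π : N₁₁₀ ⟶ N₁₁₁.
   | η ↗         |  lam ↗
  N₀₀₀ ---ν---> N₀₁₀
```
-/
structure CubeDiagram : Type (u + 1) where
  (N₀₀₀ N₀₀₁ N₀₁₀ N₀₁₁ N₁₀₀ N₁₀₁ N₁₁₀ N₁₁₁ : SymSpectrum.{u})
  α : N₀₀₁ ⟶ N₀₁₁
  β : N₀₀₁ ⟶ N₁₀₁
  γ : N₁₀₁ ⟶ N₁₁₁
  δ : N₀₁₁ ⟶ N₁₁₁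
  ε : N₁₀₀ ⟶ N₁₀₁
  ζ : N₀₀₀ ⟶ N₀₀₁
  η : N₀₀₀ ⟶ N₁₀₀
  κ : N₀₁₀ ⟶ N₀₁₁
  lam : N₀₁₀ ⟶ N₁₁₀
  μ : N₁₀₀ ⟶ N₁₁₀
  ν : N₀₀₀ ⟶ N₀₁₀
  π : N₁₁₀ ⟶ N₁₁₁
  top : β ≫ γ = α ≫ δ
  bottom : η ≫ μ = ν ≫ lam
  left : η ≫ ε = ζ ≫ β
  right : lam ≫ π = κ ≫ δ
  front : ν ≫ κ = ζ ≫ α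
  back : μ ≫ π = ε ≫ γ

/-- The `3`-cube given by a cube diagram: an arrow (third coordinate) from the square `N₀₀₀`,
`N₁₀₀`, `N₀₁₀`, `N₁₁₀` to the square `N₀₀₁`, `N₁₀₁`, `N₀₁₁`, `N₁₁₁`. -/
def CubeDiagram.toCube (N : CubeDiagram.{u}) : Cube.{u} 3 :=
  Arrow.mk (Y := (square N.β N.δ N.α N.γ N.top : Arrow (Arrow SymSpectrum.{u})))
    (X := (square N.η N.lam N.ν N.μ N.bottom : Arrow (Arrow SymSpectrum.{u})))
    (Arrow.homMk
      (Arrow.homMk N.ζ N.ε N.left.symm : Arrow.mk N.η ⟶ Arrow.mk N.β)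
      (Arrow.homMk N.κ N.π N.right.symm : Arrow.mk N.lam ⟶ Arrow.mk N.δ)
      (Arrow.hom_ext _ _ N.front.symm N.back.symm))

/-- For a cube `N` and a map `t : N₁₀₀ ⟶ N₀₀₁` with `ζ = t ∘ η`, the square
```
  N₁₀₀ --(μ, α ∘ t)--> N₁₁₀ × N₀₁₁
   ↑ η                    ↑ (lam, κ)
  N₀₀₀ -------ν--------> N₀₁₀
```
-/
def CubeDiagram.foldedSquare (N : CubeDiagram.{u}) (t : N.N₁₀₀ ⟶ N.N₀₀₁) (ht : N.η ≫ t = N.ζ) :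
    Cube.{u} 2 :=
  square (X₀₀ := N.N₀₀₀) (X₁₀ := N.N₁₀₀) (X₀₁ := N.N₀₁₀) (X₁₁ := prod N.N₁₁₀ N.N₀₁₁)
    N.η (prodLift N.lam N.κ) N.ν (prodLift N.μ (t ≫ N.α))
    (by rw [comp_prodLift, comp_prodLift, N.bottom, N.front, ← ht, Category.assoc])

end SymSpectrum

namespace SSet

/-- A morphism of simplicial sets from functions commuting with the operators. -/
def ofFun {X Y : SSet.{u}} (φ : ∀ k, X.obj k → Y.obj k)
    (nat : ∀ {k l} (θ : k ⟶ l) (x : X.obj k), φ l (X.map θ x) = Y.map θ (φ k x)) : X ⟶ Y where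
  app k := ↾(φ k)
  naturality k l θ := by ext x; exact nat θ x

lemma app_map {X Y : SSet.{u}} (f : X ⟶ Y) {k l} (θ : k ⟶ l) (x : X.obj k) :
    f.app l (X.map θ x) = Y.map θ (f.app k x) :=
  ConcreteCategory.congr_hom (f.naturality θ) x

lemma hom_ext_app {X Y : SSet.{u}} {f g : X ⟶ Y} (h : ∀ k x, f.app k x = g.app k x) : f = g := by
  ext k x
  exact h k x

lemma congr_app {X Y : SSet.{u}} {f g : X ⟶ Y} (h : f = g) (k) (x : X.obj k) :
    f.app k x = g.app k x := by rw [h]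

lemma map_id_app (X : SSet.{u}) {k} (x : X.obj k) : X.map (𝟙 k) x = x := by simp

lemma map_comp_app (X : SSet.{u}) {k l m} (θ : k ⟶ l) (θ' : l ⟶ m) (x : X.obj k) :
    X.map (θ ≫ θ') x = X.map θ' (X.map θ x) := by simp

lemma app_map₂ {X Y Z : SSet.{u}} (f : X ⊗ Y ⟶ Z) {k l} (θ : k ⟶ l) (x : X.obj k)
    (y : Y.obj k) : f.app l (X.map θ x, Y.map θ y) = Z.map θ (f.app k (x, y)) :=
  app_map f θ (x, y)

end SSet

namespace PSSet

/-- The maximum of two simplices of `Δ[1]`, regarded as monotone maps to `{0, 1}`. -/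
def sup1 {k : SimplexCategoryᵒᵖ} (a b : delta1.{u}.obj k) : delta1.{u}.obj k :=
  SSet.stdSimplex.objEquiv.symm (SimplexCategory.Hom.mk
    ((SSet.stdSimplex.objEquiv a).toOrderHom ⊔ (SSet.stdSimplex.objEquiv b).toOrderHom))

/-- The minimum of two simplices of `Δ[1]`, regarded as monotone maps to `{0, 1}`. -/
def inf1 {k : SimplexCategoryᵒᵖ} (a b : delta1.{u}.obj k) : delta1.{u}.obj k :=
  SSet.stdSimplex.objEquiv.symm (SimplexCategory.Hom.mk
    ((SSet.stdSimplex.objEquiv a).toOrderHom ⊓ (SSet.stdSimplex.objEquiv b).toOrderHom))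

lemma delta1_ext {k} {a b : delta1.{u}.obj k}
    (h : ∀ i, (SSet.stdSimplex.objEquiv a).toOrderHom i =
      (SSet.stdSimplex.objEquiv b).toOrderHom i) : a = b := by
  apply SSet.stdSimplex.objEquiv.injective
  ext i
  exact congrArg Fin.val (h i)

lemma sup1_zero {k} (a : delta1.{u}.obj k) : sup1 a (vertex 0 k) = a :=
  delta1_ext fun _ => max_eq_left (Fin.zero_le _)

lemma sup1_one {k} (a : delta1.{u}.obj k) : sup1 a (vertex 1 k) = vertex 1 k :=
  delta1_ext fun _ => max_eq_right (Fin.le_last _)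

lemma one_sup1 {k} (a : delta1.{u}.obj k) : sup1 (vertex 1 k) a = vertex 1 k :=
  delta1_ext fun _ => max_eq_left (Fin.le_last _)

lemma inf1_zero {k} (a : delta1.{u}.obj k) : inf1 a (vertex 0 k) = vertex 0 k :=
  delta1_ext fun _ => min_eq_right (Fin.zero_le _)

lemma zero_inf1 {k} (a : delta1.{u}.obj k) : inf1 (vertex 0 k) a = vertex 0 k :=
  delta1_ext fun _ => min_eq_left (Fin.zero_le _)

lemma inf1_one {k} (a : delta1.{u}.obj k) : inf1 a (vertex 1 k) = a :=
  delta1_ext fun _ => min_eq_left (Fin.le_last _)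

lemma one_inf1 {k} (a : delta1.{u}.obj k) : inf1 (vertex 1 k) a = a :=
  delta1_ext fun _ => min_eq_right (Fin.le_last _)

lemma vertex_ne {k} : vertex.{u} 0 k ≠ vertex 1 k := by
  intro h
  have := congrArg (fun a : delta1.{u}.obj k => (SSet.stdSimplex.objEquiv a).toOrderHom 0) h
  exact absurd this (by simp [vertex])

lemma mem_boundary_iff {k} (a : delta1.{u}.obj k) :
    a ∈ (SSet.boundary.{u} 1).obj k ↔ a = vertex 0 k ∨ a = vertex 1 k := by
  obtain ⟨k⟩ := k
  induction k using SimplexCategory.rec with | _ n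
  constructor
  · intro h
    rw [SSet.mem_boundary_iff_notMem_range] at h
    obtain ⟨i, hi⟩ := h
    have key : ∀ j : Fin (n + 1), a j ≠ i := fun j e => hi ⟨j, e⟩
    fin_cases i
    · right
      refine delta1_ext fun j => ?_
      have := key j
      exact (by decide : ∀ y : Fin 2, y ≠ 0 → y = 1) _ this
    · left
      refine delta1_ext fun j => ?_
      have := key j
      exact (by decide : ∀ y : Fin 2, y ≠ 1 → y = 0) _ this
  · rintro (rfl | rfl) <;> rw [SSet.mem_boundary_iff_notMem_range]
    · refine ⟨1, ?_⟩
      rintro ⟨j, hj⟩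
      exact absurd hj (by change (0 : Fin 2) ≠ 1; decide)
    · refine ⟨0, ?_⟩
      rintro ⟨j, hj⟩
      exact absurd hj (by change (1 : Fin 2) ≠ 0; decide)

end PSSet

namespace SSet

/-- A homotopy of maps of simplicial sets from its values on simplices. -/
def Homotopy.ofFun {X Y : SSet.{u}} {f g : X ⟶ Y} (h : X ⊗ PSSet.delta1 ⟶ Y)
    (h0 : ∀ k x, h.app k (x, PSSet.vertex 0 k) = f.app k x)
    (h1 : ∀ k x, h.app k (x, PSSet.vertex 1 k) = g.app k x) : Homotopy f g where
  h := h
  h₀ := hom_ext_app h0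
  h₁ := hom_ext_app h1
  rel := by
    ext k ⟨⟨_, hx⟩, _⟩
    exact hx.elim

lemma Homotopy.app_zero {X Y : SSet.{u}} {f g : X ⟶ Y} (H : Homotopy f g) {k} (x : X.obj k) :
    (RelativeMorphism.Homotopy.h H).app k (x, PSSet.vertex 0 k) = f.app k x :=
  congr_app (SSet.Homotopy.h₀ H) k x

lemma Homotopy.app_one {X Y : SSet.{u}} {f g : X ⟶ Y} (H : Homotopy f g) {k} (x : X.obj k) :
    (RelativeMorphism.Homotopy.h H).app k (x, PSSet.vertex 1 k) = g.app k x :=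
  congr_app (SSet.Homotopy.h₁ H) k x

/-- Two maps of simplicial sets are homotopic if there is a simplicial homotopy between them. -/
def Homotopic {X Y : SSet.{u}} (f g : X ⟶ Y) : Prop := Nonempty (Homotopy f g)

lemma Homotopic.of {X Y : SSet.{u}} {f g : X ⟶ Y} (h : X ⊗ PSSet.delta1 ⟶ Y)
    (h0 : ∀ k x, h.app k (x, PSSet.vertex 0 k) = f.app k x)
    (h1 : ∀ k x, h.app k (x, PSSet.vertex 1 k) = g.app k x) : Homotopic f g :=
  ⟨Homotopy.ofFun h h0 h1⟩

lemma Homotopic.of_comp {X Y : SSet.{u}} {f g : X ⟶ Y} (h : X ⊗ PSSet.delta1 ⟶ Y)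
    (h0 : ι₀ ≫ h = f) (h1 : ι₁ ≫ h = g) : Homotopic f g :=
  .of h (congr_app h0) (congr_app h1)

lemma Homotopic.exists_map {X Y : SSet.{u}} {f g : X ⟶ Y} (H : Homotopic f g) :
    ∃ h : X ⊗ PSSet.delta1 ⟶ Y, (∀ k x, h.app k (x, PSSet.vertex 0 k) = f.app k x) ∧
      ∀ k x, h.app k (x, PSSet.vertex 1 k) = g.app k x :=
  ⟨RelativeMorphism.Homotopy.h H.some, fun _ x => Homotopy.app_zero _ x,
    fun _ x => Homotopy.app_one _ x⟩

lemma Homotopic.postcomp {X Y Z : SSet.{u}} {f g : X ⟶ Y} (H : Homotopic f g) (p : Y ⟶ Z) :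
    Homotopic (f ≫ p) (g ≫ p) := by
  obtain ⟨h, h0, h1⟩ := H.exists_map
  exact .of (h ≫ p) (fun k x => congrArg (p.app k) (h0 k x))
    (fun k x => congrArg (p.app k) (h1 k x))

lemma Homotopic.precomp {X Y Z : SSet.{u}} {f g : Y ⟶ Z} (H : Homotopic f g) (p : X ⟶ Y) :
    Homotopic (p ≫ f) (p ≫ g) := sset_homotopy_precomp p f g H

lemma homotopic_refl {X Y : SSet.{u}} (f : X ⟶ Y) : Homotopic f f :=
  .of (ofFun (fun k p => f.app k p.1) (fun θ p => app_map f θ p.1)) (fun _ _ => rfl)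
    (fun _ _ => rfl)

/-- The equivalence relation generated by simplicial homotopy. -/
abbrev HomotopicGen {X Y : SSet.{u}} (f g : X ⟶ Y) : Prop :=
  Relation.EqvGen Homotopic f g

lemma HomotopicGen.postcomp {X Y Z : SSet.{u}} {f g : X ⟶ Y} (H : HomotopicGen f g) (p : Y ⟶ Z) :
    HomotopicGen (f ≫ p) (g ≫ p) := by
  induction H with
  | rel f g h => exact .rel _ _ (h.postcomp p)
  | refl => exact .refl _
  | symm _ _ _ ih => exact .symm _ _ ih
  | trans _ _ _ _ _ ih ih' => exact .trans _ _ _ ih ih'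

lemma HomotopicGen.precomp {X Y Z : SSet.{u}} {f g : Y ⟶ Z} (H : HomotopicGen f g) (p : X ⟶ Y) :
    HomotopicGen (p ≫ f) (p ≫ g) := by
  induction H with
  | rel f g h => exact .rel _ _ (h.precomp p)
  | refl => exact .refl _
  | symm _ _ _ ih => exact .symm _ _ ih
  | trans _ _ _ _ _ ih ih' => exact .trans _ _ _ ih ih'

end SSet

open SSet

lemma isWeakEquiv_iff {X Y : SSet.{u}} (f : X ⟶ Y) : IsWeakEquiv f ↔
    ∀ K : SSet.{u}, KanComplex K → (∀ g g' : Y ⟶ K, HomotopicGen (f ≫ g) (f ≫ g') →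
      HomotopicGen g g') ∧ ∀ h : X ⟶ K, ∃ g : Y ⟶ K, HomotopicGen (f ≫ g) h := by
  refine forall₂_congr fun K _ => and_congr ⟨fun h g g' e => ?_, fun h => ?_⟩
    ⟨fun h k => ?_, fun h => ?_⟩
  · exact Quot.eqvGen_exact (@h (Quot.mk _ g) (Quot.mk _ g') (Quot.eqvGen_sound e))
  · rintro ⟨g⟩ ⟨g'⟩ e
    exact Quot.eqvGen_sound (h g g' (Quot.eqvGen_exact e))
  · obtain ⟨⟨g⟩, hg⟩ := h (Quot.mk _ k)
    exact ⟨g, Quot.eqvGen_exact hg⟩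
  · rintro ⟨k⟩
    obtain ⟨g, hg⟩ := h k
    exact ⟨Quot.mk _ g, Quot.eqvGen_sound hg⟩

lemma isWeakEquiv_of_homotopyInverse {X Y : SSet.{u}} (f : X ⟶ Y) (r : Y ⟶ X)
    (h : HomotopicGen (f ≫ r) (𝟙 X)) (h' : HomotopicGen (r ≫ f) (𝟙 Y)) : IsWeakEquiv f := by
  rw [isWeakEquiv_iff]
  intro K _
  refine ⟨fun g g' e => ?_, fun k => ⟨r ≫ k, ?_⟩⟩
  · have := e.precomp r
    have e1 : HomotopicGen (r ≫ f ≫ g) g := by simpa using h'.postcomp g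
    have e2 : HomotopicGen (r ≫ f ≫ g') g' := by simpa using h'.postcomp g'
    exact .trans _ _ _ (.symm _ _ e1) (.trans _ _ _ this e2)
  · simpa using h.postcomp k

lemma IsWeakEquiv.comp {X Y Z : SSet.{u}} {f : X ⟶ Y} {g : Y ⟶ Z} (hf : IsWeakEquiv f)
    (hg : IsWeakEquiv g) : IsWeakEquiv (f ≫ g) := by
  rw [isWeakEquiv_iff] at *
  intro K hK
  refine ⟨fun a b e => (hg K hK).1 _ _ ((hf K hK).1 _ _ (by simpa using e)), fun h => ?_⟩
  obtain ⟨a, ha⟩ := (hf K hK).2 h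
  obtain ⟨b, hb⟩ := (hg K hK).2 a
  exact ⟨b, .trans _ _ _ (by simpa using hb.precomp f) ha⟩

lemma IsWeakEquiv.of_comp_right {X Y Z : SSet.{u}} {f : X ⟶ Y} {g : Y ⟶ Z}
    (hg : IsWeakEquiv g) (hfg : IsWeakEquiv (f ≫ g)) : IsWeakEquiv f := by
  rw [isWeakEquiv_iff] at *
  intro K hK
  refine ⟨fun a b e => ?_, fun h => ?_⟩
  · obtain ⟨a', ha⟩ := (hg K hK).2 a
    obtain ⟨b', hb⟩ := (hg K hK).2 b
    have := (hfg K hK).1 a' b' (by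
      simpa using Relation.EqvGen.trans _ _ _ (ha.precomp f)
        (.trans _ _ _ e (.symm _ _ (hb.precomp f))))
    exact .trans _ _ _ (.symm _ _ ha) (.trans _ _ _ (this.precomp g) hb)
  · obtain ⟨a, ha⟩ := (hfg K hK).2 h
    exact ⟨g ≫ a, by simpa using ha⟩

open SSet PSSet

namespace SSet

/-- A map `φ` of simplicial sets has the homotopy lifting extension property if it has the right
lifting property against the inclusions `A × Δ[1] ∪ Q × {1} ⟶ Q × Δ[1]`. The simplicial subset `A`
of `Q` and the given map on it are described by a family of maps `j i : A i ⟶ Q` covering it. -/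
def HepLift {V' V : SSet.{u}} (φ : V' ⟶ V) : Prop :=
  ∀ (ι : Type) (Q : SSet.{u}) (A : ι → SSet.{u}) (j : ∀ i, A i ⟶ Q)
    (H : ∀ i, A i ⊗ delta1 ⟶ V') (g : Q ⟶ V') (G : Q ⊗ delta1 ⟶ V),
    (∀ i i' k a a', (j i).app k a = (j i').app k a' →
      ∀ t : delta1.obj k, (H i).app k (a, t) = (H i').app k (a', t)) →
    (∀ i k a (t : delta1.obj k), φ.app k ((H i).app k (a, t)) = G.app k ((j i).app k a, t)) →
    (∀ i k a, (H i).app k (a, vertex 1 k) = g.app k ((j i).app k a)) →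
    (∀ k q, φ.app k (g.app k q) = G.app k (q, vertex 1 k)) →
    ∃ F : Q ⊗ delta1 ⟶ V', (∀ k q (t : delta1.obj k), φ.app k (F.app k (q, t)) = G.app k (q, t)) ∧
      (∀ i k a (t : delta1.obj k), F.app k ((j i).app k a, t) = (H i).app k (a, t)) ∧
      ∀ k q, F.app k (q, vertex 1 k) = g.app k q

/-- A map `φ` of simplicial sets has the right lifting property against all monomorphisms,
where the given map on a simplicial subset is described by a covering family. -/
def MonoLift {V' V : SSet.{u}} (φ : V' ⟶ V) : Prop :=
  ∀ (ι : Type) (Q : SSet.{u}) (A : ι → SSet.{u}) (j : ∀ i, A i ⟶ Q)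
    (b : ∀ i, A i ⟶ V') (c : Q ⟶ V),
    (∀ i i' k a a', (j i).app k a = (j i').app k a' → (b i).app k a = (b i').app k a') →
    (∀ i k a, φ.app k ((b i).app k a) = c.app k ((j i).app k a)) →
    ∃ F : Q ⟶ V', (∀ k q, φ.app k (F.app k q) = c.app k q) ∧
      ∀ i k a, F.app k ((j i).app k a) = (b i).app k a

/-- The map to the point. -/
def toPoint (V : SSet.{u}) : V ⟶ 𝟙_ SSet.{u} := ofFun (fun _ _ => PUnit.unit) (fun _ _ => rfl)

/-- Simplicial sets whose map to the point has the homotopy lifting extension property. -/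
def HepFibrant (V : SSet.{u}) : Prop := HepLift (toPoint V)

lemma HepLift.box {V' V : SSet.{u}} {φ : V' ⟶ V} (hφ : HepLift φ) {P : SSet.{u}}
    (L T R : P ⊗ delta1 ⟶ V') (G : (P ⊗ delta1) ⊗ delta1 ⟶ V)
    (hLT : ∀ k p, L.app k (p, vertex 1 k) = T.app k (p, vertex 0 k))
    (hTR : ∀ k p, R.app k (p, vertex 1 k) = T.app k (p, vertex 1 k))
    (hL : ∀ k p (t : delta1.obj k), φ.app k (L.app k (p, t)) = G.app k ((p, vertex 0 k), t))
    (hR : ∀ k p (t : delta1.obj k), φ.app k (R.app k (p, t)) = G.app k ((p, vertex 1 k), t))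
    (hT : ∀ k p (t : delta1.obj k), φ.app k (T.app k (p, t)) = G.app k ((p, t), vertex 1 k)) :
    ∃ B : P ⊗ delta1 ⟶ V', (∀ k p, B.app k (p, vertex 0 k) = L.app k (p, vertex 0 k)) ∧
      (∀ k p, B.app k (p, vertex 1 k) = R.app k (p, vertex 0 k)) ∧
      ∀ k p (t : delta1.obj k), φ.app k (B.app k (p, t)) = G.app k ((p, t), vertex 0 k) := by
  obtain ⟨F, hF, hF', -⟩ := hφ Bool (P ⊗ delta1) (fun _ => P) (fun b => bif b then ι₁ else ι₀)
    (fun b => bif b then R else L) T G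
    (by
      rintro (_ | _) (_ | _) k a a' h t
      · obtain rfl : a = a' := congrArg Prod.fst h
        rfl
      · exact absurd (congrArg Prod.snd h) vertex_ne
      · exact absurd (congrArg Prod.snd h).symm vertex_ne
      · obtain rfl : a = a' := congrArg Prod.fst h
        rfl)
    (by
      rintro (_ | _) k a t
      · exact hL k a t
      · exact hR k a t)
    (by
      rintro (_ | _) k a
      · exact hLT k a
      · exact hTR k a)
    (fun k q => hT k q.1 q.2)
  refine ⟨ι₀ ≫ F, fun k p => hF' false k p (vertex 0 k), fun k p => hF' true k p (vertex 0 k),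
    fun k p t => hF k (p, t) (vertex 0 k)⟩

lemma HepFibrant.box {V : SSet.{u}} (hV : HepFibrant V) {P : SSet.{u}}
    (L T R : P ⊗ delta1 ⟶ V)
    (hLT : ∀ k p, L.app k (p, vertex 1 k) = T.app k (p, vertex 0 k))
    (hTR : ∀ k p, R.app k (p, vertex 1 k) = T.app k (p, vertex 1 k)) :
    ∃ B : P ⊗ delta1 ⟶ V, (∀ k p, B.app k (p, vertex 0 k) = L.app k (p, vertex 0 k)) ∧
      (∀ k p, B.app k (p, vertex 1 k) = R.app k (p, vertex 0 k)) := by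
  obtain ⟨B, h₀, h₁, -⟩ := HepLift.box hV L T R (toPoint _) hLT hTR (fun _ _ _ => rfl)
    (fun _ _ _ => rfl) (fun _ _ _ => rfl)
  exact ⟨B, h₀, h₁⟩

/-- The constant homotopy. -/
def constHomotopy {X Y : SSet.{u}} (f : X ⟶ Y) : X ⊗ delta1 ⟶ Y :=
  ofFun (fun k p => f.app k p.1) (fun θ p => app_map f θ p.1)

lemma HepFibrant.homotopic_symm {V : SSet.{u}} (hV : HepFibrant V) {P : SSet.{u}} {f g : P ⟶ V}
    (h : Homotopic f g) : Homotopic g f := by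
  obtain ⟨h, h0, h1⟩ := h.exists_map
  obtain ⟨B, hB, hB'⟩ := hV.box (constHomotopy g) (constHomotopy g) h (fun _ _ => rfl)
    (fun k p => h1 k p)
  exact .of B hB (fun k p => (hB' k p).trans (h0 k p))

lemma HepFibrant.homotopic_trans {V : SSet.{u}} (hV : HepFibrant V) {P : SSet.{u}}
    {f g e : P ⟶ V} (h : Homotopic f g) (h' : Homotopic g e) : Homotopic f e := by
  obtain ⟨h, h0, h1⟩ := h.exists_map
  obtain ⟨h', h0', h1'⟩ := h'.exists_map
  obtain ⟨B, hB, hB'⟩ := hV.box h h' (constHomotopy e) (fun k p => (h1 k p).trans (h0' k p).symm)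
    (fun k p => (h1' k p).symm)
  exact .of B (fun k p => (hB k p).trans (h0 k p)) hB'

lemma HepFibrant.homotopic_of_gen {V : SSet.{u}} (hV : HepFibrant V) {P : SSet.{u}}
    {f g : P ⟶ V} (h : HomotopicGen f g) : Homotopic f g := by
  induction h with
  | rel _ _ h => exact h
  | refl => exact homotopic_refl _
  | symm _ _ _ ih => exact hV.homotopic_symm ih
  | trans _ _ _ _ _ ih ih' => exact hV.homotopic_trans ih ih'

/-- A map with the homotopy lifting extension property that induces bijections on homotopy classes
of maps from all simplicial sets has the right lifting property against monomorphisms. -/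
lemma HepLift.monoLift {V' V : SSet.{u}} {φ : V' ⟶ V} (hφ : HepLift φ)
    (surj : ∀ (P : SSet.{u}) (f : P ⟶ V), ∃ f' : P ⟶ V', Homotopic f (f' ≫ φ))
    (inj : ∀ (P : SSet.{u}) (f f' : P ⟶ V'), Homotopic (f ≫ φ) (f' ≫ φ) → Homotopic f f') :
    MonoLift φ := by
  obtain ⟨σ, hσ⟩ : ∃ σ : V ⟶ V', ∀ k v, φ.app k (σ.app k v) = v := by
    obtain ⟨σ₀, h⟩ := surj V (𝟙 V)
    obtain ⟨h, h0, h1⟩ := h.exists_map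
    obtain ⟨F, hF, -⟩ := hφ Empty V (fun _ => V) (fun e => e.elim) (fun e => e.elim) σ₀ h
      (fun e => e.elim) (fun e => e.elim) (fun e => e.elim) (fun k q => (h1 k q).symm)
    exact ⟨ι₀ ≫ F, fun k v => (hF k v (vertex 0 k)).trans (h0 k v)⟩
  obtain ⟨B, hB0, hB1, hB⟩ : ∃ B : V' ⊗ delta1 ⟶ V', (∀ k v, B.app k (v, vertex 0 k) = v) ∧
      (∀ k v, B.app k (v, vertex 1 k) = σ.app k (φ.app k v)) ∧
      ∀ k v (t : delta1.obj k), φ.app k (B.app k (v, t)) = φ.app k v := by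
    have e : (𝟙 V') ≫ φ = (φ ≫ σ) ≫ φ :=
      hom_ext_app fun k v => (hσ k (φ.app k v)).symm
    obtain ⟨h, h0, h1⟩ := (inj V' (𝟙 V') (φ ≫ σ) (e ▸ homotopic_refl _)).exists_map
    have h0' : ∀ k v, h.app k (v, vertex 0 k) = v := h0
    have h1' : ∀ k v, h.app k (v, vertex 1 k) = σ.app k (φ.app k v) := h1
    obtain ⟨B, hB0, hB1, hB⟩ := hφ.box h (constHomotopy (φ ≫ σ)) (h ≫ φ ≫ σ)
      (ofFun (fun k p => φ.app k (h.app k (p.1.1, p.2)))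
        (fun θ p => (congrArg (φ.app _) (app_map h θ (p.1.1, p.2))).trans (app_map φ θ _)))
      h1
      (fun k p => by
        change σ.app k (φ.app k (h.app k (p, vertex 1 k))) = σ.app k (φ.app k p)
        rw [h1', hσ])
      (fun _ _ _ => rfl)
      (fun k p t => hσ k _)
      (fun k p t => by
        change φ.app k (σ.app k (φ.app k p)) = φ.app k (h.app k (p, vertex 1 k))
        rw [h1'])
    refine ⟨B, fun k v => (hB0 k v).trans (h0' k v), fun k v => (hB1 k v).trans ?_,
      fun k v t => (hB k v t).trans ?_⟩
    · change σ.app k (φ.app k (h.app k (v, vertex 0 k))) = _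
      rw [h0']
    · change φ.app k (h.app k (v, vertex 0 k)) = _
      rw [h0']
  intro ι Q A j b c hb hc
  obtain ⟨F, hF, hF', -⟩ := hφ ι Q A j (fun i => (b i ▷ delta1) ≫ B) (c ≫ σ) (constHomotopy c)
    (fun i i' k a a' h t => congrArg (fun v => B.app k (v, t)) (hb i i' k a a' h))
    (fun i k a t => (hB k _ t).trans (hc i k a))
    (fun i k a => (hB1 k _).trans (congrArg (σ.app k) (hc i k a)))
    (fun k q => hσ k _)
  exact ⟨ι₀ ≫ F, fun k q => hF k q (vertex 0 k), fun i k a => (hF' i k a (vertex 0 k)).trans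
    (hB0 k _)⟩

/-! ### Extension of maps to Kan complexes -/

/-- A map on a simplicial subset covered by maps `j i`, from compatible maps on their sources. -/
lemma exists_map_of_family {ι : Type*} {Q Z : SSet.{u}} (S : Q.Subcomplex) (A : ι → SSet.{u})
    (j : ∀ i, A i ⟶ Q) (H : ∀ i, A i ⟶ Z)
    (hS : ∀ k, ∀ q ∈ S.obj k, ∃ i, ∃ a, (j i).app k a = q)
    (hH : ∀ i i' k a a', (j i).app k a = (j i').app k a' → (H i).app k a = (H i').app k a') :
    ∃ F : (S : SSet.{u}) ⟶ Z, ∀ i k (a : (A i).obj k) (hq : (j i).app k a ∈ S.obj k),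
      F.app k ⟨(j i).app k a, hq⟩ = (H i).app k a := by
  choose I a ha using hS
  refine ⟨ofFun (fun k p => (H (I k p.1 p.2)).app k (a k p.1 p.2)) ?_, ?_⟩
  · rintro k l θ ⟨p, hp⟩
    refine (hH _ _ _ _ ((A _).map θ (a k p hp)) ?_).trans (app_map _ θ _)
    exact (ha _ _ _).trans ((congrArg (Q.map θ) (ha k p hp)).symm.trans (app_map _ θ _).symm)
  · intro i k x hq
    exact hH _ _ _ _ _ (ha _ _ _)

/-- The vertex `1` of `Δ[1]` is a horn. -/
lemma mem_horn_one_iff {k} (a : delta1.{u}.obj k) :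
    a ∈ (horn.{u} 1 1).obj k ↔ a = vertex 1 k := by
  obtain ⟨k⟩ := k
  induction k using SimplexCategory.rec with | _ n
  rw [mem_horn_iff_notMem_range]
  constructor
  · rintro ⟨i, hi, hi'⟩
    have key : ∀ j : Fin (n + 1), a j ≠ i := fun j e => hi' ⟨j, e⟩
    refine delta1_ext fun j => ?_
    exact (by decide : ∀ y i : Fin 2, i ≠ 1 → y ≠ i → y = 1) _ _ hi (key j)
  · rintro rfl
    refine ⟨0, by decide, ?_⟩
    rintro ⟨j, hj⟩
    exact absurd hj (by change (1 : Fin 2) ≠ 0; decide)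

lemma KanComplex.exists_extension {Z : SSet.{u}} (hZ : KanComplex Z) {A B : SSet.{u}}
    (i : A ⟶ B) (hi : anodyneExtensions i) (f : A ⟶ Z) : ∃ g : B ⟶ Z, i ≫ g = f := by
  have := hi (Limits.terminal.from Z) (by
    rw [← HomotopicalAlgebra.fibration_iff]; infer_instance)
  have sq : CommSq f i (Limits.terminal.from Z) (Limits.terminal.from _) := ⟨by simp⟩
  exact ⟨sq.lift, by simp⟩

lemma KanComplex.hep {Z : SSet.{u}} (hZ : KanComplex Z) {ι : Type*} {Q : SSet.{u}}
    (A : ι → SSet.{u}) (j : ∀ i, A i ⟶ Q) (H : ∀ i, A i ⊗ delta1 ⟶ Z) (g : Q ⟶ Z)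
    (hH : ∀ i i' k a a', (j i).app k a = (j i').app k a' →
      ∀ t : delta1.obj k, (H i).app k (a, t) = (H i').app k (a', t))
    (hg : ∀ i k a, (H i).app k (a, vertex 1 k) = g.app k ((j i).app k a)) :
    ∃ F : Q ⊗ delta1 ⟶ Z, (∀ i k a (t : delta1.obj k),
      F.app k ((j i).app k a, t) = (H i).app k (a, t)) ∧
      ∀ k q, F.app k (q, vertex 1 k) = g.app k q := by
  set S : Q.Subcomplex := ⨆ i, Subcomplex.range (j i) with hS
  have mem : ∀ k (q : Q.obj k), q ∈ S.obj k ↔ ∃ i a, (j i).app k a = q := fun k q => by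
    simp [hS, Subfunctor.iSup_obj, Set.mem_iUnion]
  obtain ⟨f, hf⟩ := exists_map_of_family (S.unionProd (horn.{u} 1 1))
    (fun o : Option ι => o.elim Q (fun i => A i ⊗ delta1))
    (fun o => match o with
      | none => ι₁
      | some i => j i ▷ delta1)
    (fun o => match o with
      | none => g
      | some i => H i)
    (by
      rintro k ⟨q, t⟩ h
      obtain h | h := (S.mem_unionProd_iff _ _).1 h
      · obtain rfl : t = vertex 1 k := (mem_horn_one_iff t).1 h
        exact ⟨none, q, rfl⟩
      · obtain ⟨i, a, rfl⟩ := (mem k q).1 h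
        exact ⟨some i, (a, t), rfl⟩)
    (by
      rintro (_ | i) (_ | i') k a a' h
      · exact congrArg (g.app k) (congrArg Prod.fst h)
      · obtain ⟨a', t⟩ := a'
        obtain rfl : vertex 1 k = t := congrArg Prod.snd h
        exact (congrArg (g.app k) (congrArg Prod.fst h)).trans (hg i' k a').symm
      · obtain ⟨a, t⟩ := a
        obtain rfl : t = vertex 1 k := congrArg Prod.snd h
        exact (hg i k a).trans (congrArg (g.app k) (congrArg Prod.fst h))
      · obtain ⟨a, t⟩ := a
        obtain ⟨a', t'⟩ := a'
        obtain rfl : t = t' := congrArg Prod.snd h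
        exact hH i i' k a a' (congrArg Prod.fst h) t)
  obtain ⟨F, hF⟩ := hZ.exists_extension _ (anodyneExtensions_unionProd_ι S _
    (anodyneExtensions.horn_ι 1)) f
  refine ⟨F, fun i k a t => ?_, fun k q => ?_⟩
  · exact (congr_app hF k ⟨((j i).app k a, t), (S.mem_unionProd_iff _ _).2
      (Or.inr ((mem _ _).2 ⟨i, a, rfl⟩))⟩).trans (hf (some i) k (a, t) _)
  · exact (congr_app hF k ⟨(q, vertex 1 k), (S.mem_unionProd_iff _ _).2
      (Or.inl ((mem_horn_one_iff _).2 rfl))⟩).trans (hf none k q _)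

lemma KanComplex.hepFibrant {Z : SSet.{u}} (hZ : KanComplex Z) : HepFibrant Z := by
  intro ι Q A j H g G hH _ hg _
  obtain ⟨F, h, h'⟩ := hZ.hep A j H g hH hg
  exact ⟨F, fun _ _ _ => rfl, h, h'⟩

end SSet

namespace SSet

open modelCategoryQuillen in
lemma kanComplex_of_extension {Z : SSet.{u}}
    (h : ∀ {A B : SSet.{u}} (i : A ⟶ B), anodyneExtensions i → ∀ f : A ⟶ Z,
      ∃ g : B ⟶ Z, i ≫ g = f) : KanComplex Z := by
  rw [KanComplex, HomotopicalAlgebra.isFibrant_iff, modelCategoryQuillen.fibration_iff]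
  intro A B i hi
  have hi' : anodyneExtensions i := by
    rw [anodyneExtensions_eq_llp_rlp]
    exact MorphismProperty.le_llp_rlp _ _ hi
  refine ⟨fun {f g} sq => ?_⟩
  obtain ⟨e, he⟩ := h i hi' f
  exact ⟨⟨{ l := e, fac_left := he, fac_right := Limits.terminalIsTerminal.hom_ext _ _ }⟩⟩

/-! ### Function complexes -/

/-- A simplex of the function complex `Z ^ K`: a map `Δ[k] × K ⟶ Z`. -/
@[ext]
structure FnObj (K Z : SSet.{u}) (k : SimplexCategoryᵒᵖ) : Type u where
  toFun : ∀ (l : SimplexCategoryᵒᵖ) (_ : k ⟶ l), K.obj l → Z.obj l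
  nat : ∀ {l m : SimplexCategoryᵒᵖ} (θ : k ⟶ l) (θ' : l ⟶ m) (x : K.obj l),
    toFun m (θ ≫ θ') (K.map θ' x) = Z.map θ' (toFun l θ x)

/-- The function complex `Z ^ K`. -/
def fn (K Z : SSet.{u}) : SSet.{u} where
  obj k := FnObj K Z k
  map θ := ↾fun v => ⟨fun l θ' x => v.toFun l (θ ≫ θ') x, fun θ' θ'' x => by
    rw [← Category.assoc]; exact v.nat _ _ _⟩
  map_id k := by
    ext v : 3
    exact FnObj.ext (funext₃ fun l θ x => congrArg (v.toFun l · x) (Category.id_comp θ))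
  map_comp θ θ' := by
    ext v : 3
    exact FnObj.ext (funext₃ fun l θ'' x => congrArg (v.toFun l · x) (Category.assoc _ _ _))

/-- Evaluation of simplices of the function complex. -/
def fnEval {K Z : SSet.{u}} {k} (v : (fn K Z).obj k) (x : K.obj k) : Z.obj k :=
  FnObj.toFun v k (𝟙 k) x

lemma fnEval_map {K Z : SSet.{u}} {k l} (θ : k ⟶ l) (v : (fn K Z).obj k) (x : K.obj l) :
    fnEval ((fn K Z).map θ v) x = FnObj.toFun v l θ x :=
  congrArg (FnObj.toFun v l · x) (Category.comp_id θ)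

lemma map_fnEval {K Z : SSet.{u}} {k l} (θ : k ⟶ l) (v : (fn K Z).obj k) (x : K.obj k) :
    fnEval ((fn K Z).map θ v) (K.map θ x) = Z.map θ (fnEval v x) := by
  rw [fnEval_map]
  refine Eq.trans ?_ (FnObj.nat v (𝟙 k) θ x)
  exact congrArg (FnObj.toFun v l · (K.map θ x)) (Category.id_comp θ).symm

lemma fn_ext {K Z : SSet.{u}} {k} {v w : (fn K Z).obj k}
    (h : ∀ l (θ : k ⟶ l) x, fnEval ((fn K Z).map θ v) x = fnEval ((fn K Z).map θ w) x) :
    v = w :=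
  FnObj.ext (funext₃ fun l θ x => by simpa only [fnEval_map] using h l θ x)

/-- The map `P ⟶ Z ^ K` adjoint to a map `P × K ⟶ Z`. -/
def fnCurry {P K Z : SSet.{u}} (f : P ⊗ K ⟶ Z) : P ⟶ fn K Z :=
  ofFun (fun k p => ⟨fun l θ x => f.app l (P.map θ p, x), fun {l m} θ θ' x =>
      (congrArg (fun z => f.app m (z, K.map θ' x)) (map_comp_app P θ θ' p)).trans
        (app_map₂ f θ' _ _)⟩)
    (fun θ p => FnObj.ext (funext₃ fun l θ' x => by
      change f.app l (P.map θ' (P.map θ p), x) = f.app l (P.map (θ ≫ θ') p, x)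
      rw [map_comp_app]))

@[simp] lemma fnEval_fnCurry {P K Z : SSet.{u}} (f : P ⊗ K ⟶ Z) {k} (p : P.obj k) (x : K.obj k) :
    fnEval ((fnCurry f).app k p) x = f.app k (p, x) := by
  change f.app k (P.map (𝟙 k) p, x) = _
  rw [map_id_app]

/-- The map `P × K ⟶ Z` adjoint to a map `P ⟶ Z ^ K`. -/
def fnUncurry {P K Z : SSet.{u}} (f : P ⟶ fn K Z) : P ⊗ K ⟶ Z :=
  ofFun (fun k p => fnEval (f.app k p.1) p.2) (fun {k l} θ p => by
    rw [← map_fnEval, ← app_map]; rfl)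

/-- The map `(P × K) × D ⟶ Z` adjoint to a map `P × D ⟶ Z ^ K`. -/
def fnUncurryMid {P D K Z : SSet.{u}} (f : P ⊗ D ⟶ fn K Z) : (P ⊗ K) ⊗ D ⟶ Z :=
  ofFun (fun k p => fnEval (f.app k (p.1.1, p.2)) p.1.2) (fun θ p =>
    (congrArg (fnEval · (K.map θ p.1.2)) (app_map₂ f θ p.1.1 p.2)).trans
      (map_fnEval θ _ _))

/-- The map `P × D ⟶ Z ^ K` adjoint to a map `(P × K) × D ⟶ Z`. -/
def fnCurryMid {P D K Z : SSet.{u}} (f : (P ⊗ K) ⊗ D ⟶ Z) : P ⊗ D ⟶ fn K Z :=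
  fnCurry (ofFun (fun k p => f.app k ((p.1.1, p.2), p.1.2))
    (fun θ p => app_map f θ ((p.1.1, p.2), p.1.2)))

@[simp] lemma fnEval_fnCurryMid {P D K Z : SSet.{u}} (f : (P ⊗ K) ⊗ D ⟶ Z) {k} (p : P.obj k)
    (t : D.obj k) (x : K.obj k) :
    fnEval ((fnCurryMid f).app k (p, t)) x = f.app k ((p, x), t) :=
  fnEval_fnCurry _ _ _

lemma fn_hom_ext {P K Z : SSet.{u}} {f g : P ⟶ fn K Z}
    (h : ∀ k p x, fnEval (f.app k p) x = fnEval (g.app k p) x) : f = g :=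
  hom_ext_app fun k p => fn_ext fun l θ x => by
    rw [← app_map, ← app_map]
    exact h _ _ _

lemma kanComplex_fn (K : SSet.{u}) {Z : SSet.{u}} (hZ : KanComplex Z) : KanComplex (fn K Z) := by
  refine kanComplex_of_extension fun {A B} i hi f => ?_
  obtain ⟨g, hg⟩ := hZ.exists_extension _ (hi.whiskerRight K) (fnUncurry f)
  refine ⟨fnCurry g, fn_hom_ext fun k p x => ?_⟩
  change fnEval ((fnCurry g).app k (i.app k p)) x = _
  rw [fnEval_fnCurry]
  exact congr_app hg k (p, x)

/-- Functoriality of the function complex in the target. -/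
def fnMap (K : SSet.{u}) {Z Z' : SSet.{u}} (f : Z ⟶ Z') : fn K Z ⟶ fn K Z' :=
  fnCurry (fnUncurry (𝟙 _) ≫ f)

@[simp] lemma fnEval_fnMap (K : SSet.{u}) {Z Z' : SSet.{u}} (f : Z ⟶ Z') {k}
    (v : (fn K Z).obj k) (x : K.obj k) : fnEval ((fnMap K f).app k v) x = f.app k (fnEval v x) :=
  fnEval_fnCurry _ _ _

lemma Homotopic.fnMap (K : SSet.{u}) {Z Z' : SSet.{u}} {f g : Z ⟶ Z'} (h : Homotopic f g) :
    Homotopic (fnMap K f) (fnMap K g) := by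
  obtain ⟨h, h0, h1⟩ := h.exists_map
  let F : (fn K Z ⊗ delta1) ⊗ K ⟶ Z' :=
    ofFun (fun k p => h.app k (fnEval p.1.1 p.2, p.1.2)) (fun {k l} θ p => by
      refine (congrArg (fun z => h.app l (z, delta1.map θ p.1.2)) (map_fnEval θ p.1.1 p.2)).trans ?_
      exact app_map₂ h θ _ _)
  refine .of_comp (fnCurry F) (fn_hom_ext fun k v x => ?_) (fn_hom_ext fun k v x => ?_)
  · exact (fnEval_fnCurry F _ x).trans ((h0 _ _).trans (fnEval_fnMap K f v x).symm)
  · exact (fnEval_fnCurry F _ x).trans ((h1 _ _).trans (fnEval_fnMap K g v x).symm)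

lemma HomotopicGen.fnMap (K : SSet.{u}) {Z Z' : SSet.{u}} {f g : Z ⟶ Z'} (h : HomotopicGen f g) :
    HomotopicGen (fnMap K f) (fnMap K g) := by
  induction h with
  | rel f g h => exact .rel _ _ (h.fnMap K)
  | refl => exact .refl _
  | symm _ _ _ ih => exact .symm _ _ ih
  | trans _ _ _ _ _ ih ih' => exact .trans _ _ _ ih ih'

lemma fnMap_comp (K : SSet.{u}) {Z Z' Z'' : SSet.{u}} (f : Z ⟶ Z') (g : Z' ⟶ Z'') :
    fnMap K f ≫ fnMap K g = fnMap K (f ≫ g) :=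
  fn_hom_ext fun k v x => by
    rw [fnEval_fnMap]
    change fnEval ((fnMap K g).app k ((fnMap K f).app k v)) x = _
    rw [fnEval_fnMap, fnEval_fnMap]
    rfl

lemma fnMap_id (K : SSet.{u}) (Z : SSet.{u}) : fnMap K (𝟙 Z) = 𝟙 (fn K Z) :=
  fn_hom_ext fun k v x => by
    rw [fnEval_fnMap]
    rfl

/-- Functoriality of the function complex in the source. -/
def fnPre {A B : SSet.{u}} (i : A ⟶ B) (Z : SSet.{u}) : fn B Z ⟶ fn A Z :=
  fnCurry ((fn B Z ◁ i) ≫ fnUncurry (𝟙 _))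

@[simp] lemma fnEval_fnPre {A B : SSet.{u}} (i : A ⟶ B) (Z : SSet.{u}) {k}
    (v : (fn B Z).obj k) (x : A.obj k) :
    fnEval ((fnPre i Z).app k v) x = fnEval v (i.app k x) :=
  fnEval_fnCurry _ _ _

lemma hepLift_fnPre {A B : SSet.{u}} (i : A ⟶ B) (hi : ∀ k, Function.Injective (i.app k))
    {Z : SSet.{u}} (hZ : KanComplex Z) : HepLift (fnPre i Z) := by
  intro ι Q C j H g G hH hHG hHg hgG
  obtain ⟨F, hF, hF'⟩ := hZ.hep (Q := Q ⊗ B) (ι := Option ι)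
    (fun o => o.elim (Q ⊗ A) (fun c => C c ⊗ B))
    (fun o => match o with
      | none => Q ◁ i
      | some c => j c ▷ B)
    (fun o => match o with
      | none => fnUncurryMid G
      | some c => fnUncurryMid (H c))
    (fnUncurry g)
    (by
      rintro (_ | c) (_ | c') k ⟨a, b⟩ ⟨a', b'⟩ h t
      · obtain rfl : a = a' := congrArg Prod.fst h
        obtain rfl : b = b' := hi k (congrArg Prod.snd h)
        rfl
      · obtain rfl : a = (j c').app k a' := congrArg Prod.fst h
        obtain rfl : i.app k b = b' := congrArg Prod.snd h
        exact (congrArg (fnEval · b) (hHG c' k a' t)).symm.trans (fnEval_fnPre i Z _ b)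
      · obtain rfl : (j c).app k a = a' := congrArg Prod.fst h
        obtain rfl : b = i.app k b' := congrArg Prod.snd h
        exact (fnEval_fnPre i Z _ b').symm.trans (congrArg (fnEval · b') (hHG c k a t))
      · obtain rfl : b = b' := congrArg Prod.snd h
        exact congrArg (fnEval · b) (hH c c' k a a' (congrArg Prod.fst h) t))
    (by
      rintro (_ | c) k ⟨a, b⟩
      · exact (congrArg (fnEval · b) (hgG k a)).symm.trans (fnEval_fnPre i Z _ b)
      · exact congrArg (fnEval · b) (hHg c k a))
  have e1 : fnCurryMid F ≫ fnPre i Z = G := fn_hom_ext fun k p x =>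
    (fnEval_fnPre i Z _ x).trans ((fnEval_fnCurryMid F p.1 p.2 _).trans (hF none k (p.1, x) p.2))
  have e2 (c : ι) : (j c ▷ delta1) ≫ fnCurryMid F = H c := fn_hom_ext fun k p x =>
    (fnEval_fnCurryMid F _ p.2 x).trans (hF (some c) k (p.1, x) p.2)
  have e3 : ι₁ ≫ fnCurryMid F = g := fn_hom_ext fun k q x =>
    (fnEval_fnCurryMid F q _ x).trans (hF' k (q, x))
  exact ⟨fnCurryMid F, fun k q t => congr_app e1 k (q, t), fun c k a t => congr_app (e2 c) k (a, t),
    fun k q => congr_app e3 k q⟩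

/-- Simplicial homotopies of maps to function complexes are homotopies of adjoint maps. -/
lemma homotopic_fnCurry {P K Z : SSet.{u}} {f g : P ⊗ K ⟶ Z} (h : Homotopic f g) :
    Homotopic (fnCurry f) (fnCurry g) := by
  obtain ⟨h, h0, h1⟩ := h.exists_map
  refine .of_comp (fnCurryMid h) (fn_hom_ext fun k p x => ?_) (fn_hom_ext fun k p x => ?_)
  · exact (fnEval_fnCurryMid h p _ x).trans ((h0 _ _).trans (fnEval_fnCurry f p x).symm)
  · exact (fnEval_fnCurryMid h p _ x).trans ((h1 _ _).trans (fnEval_fnCurry g p x).symm)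

lemma homotopic_fnUncurry {P K Z : SSet.{u}} {f g : P ⟶ fn K Z} (h : Homotopic f g) :
    Homotopic (fnUncurry f) (fnUncurry g) := by
  obtain ⟨h, h0, h1⟩ := h.exists_map
  let F : (P ⊗ K) ⊗ delta1 ⟶ Z := fnUncurryMid h
  exact .of F (fun k p => congrArg (fnEval · p.2) (h0 k p.1))
    (fun k p => congrArg (fnEval · p.2) (h1 k p.1))

/-- The map exchanging the arguments of a map of two variables. -/
def swapMap {P K Z : SSet.{u}} (f : P ⊗ K ⟶ Z) : K ⊗ P ⟶ Z :=
  ofFun (fun k p => f.app k (p.2, p.1)) (fun θ p => app_map f θ (p.2, p.1))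

lemma homotopic_swapMap {P K Z : SSet.{u}} {f g : P ⊗ K ⟶ Z} (h : Homotopic f g) :
    Homotopic (swapMap f) (swapMap g) := by
  obtain ⟨h, h0, h1⟩ := h.exists_map
  exact .of (ofFun (fun k p => h.app k ((p.1.2, p.1.1), p.2))
    (fun θ p => app_map h θ ((p.1.2, p.1.1), p.2))) (fun k p => h0 k (p.2, p.1))
    (fun k p => h1 k (p.2, p.1))

/-- For an injective weak equivalence `i` and a Kan complex `Z`, the restriction map of function
complexes has the right lifting property against monomorphisms. -/
lemma monoLift_fnPre {A B : SSet.{u}} (i : A ⟶ B) (hi : ∀ k, Function.Injective (i.app k))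
    (hw : IsWeakEquiv i) {Z : SSet.{u}} (hZ : KanComplex Z) : MonoLift (fnPre i Z) := by
  have swap (P : SSet.{u}) (X : SSet.{u}) (f : P ⟶ fn X Z) :
      fnCurry (swapMap (fnUncurry (fnCurry (swapMap (fnUncurry f))))) = f :=
    fn_hom_ext fun k p x =>
      (fnEval_fnCurry _ p x).trans (fnEval_fnCurry (swapMap (fnUncurry f)) x p)
  have pre (P : SSet.{u}) (f : P ⟶ fn B Z) : fnCurry (swapMap (fnUncurry (f ≫ fnPre i Z))) =
      i ≫ fnCurry (swapMap (fnUncurry f)) :=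
    fn_hom_ext fun k p x => by
      rw [fnEval_fnCurry]
      refine Eq.trans ?_ (fnEval_fnCurry (swapMap (fnUncurry f)) (i.app k p) x).symm
      exact fnEval_fnPre i Z (f.app k x) p
  have back {P X : SSet.{u}} {f g : P ⟶ fn X Z} (h : Homotopic f g) :
      Homotopic (fnCurry (swapMap (fnUncurry f))) (fnCurry (swapMap (fnUncurry g))) :=
    homotopic_fnCurry (homotopic_swapMap (homotopic_fnUncurry h))
  refine (hepLift_fnPre i hi hZ).monoLift (fun P f => ?_) (fun P f f' h => ?_)
  · obtain ⟨g, hg⟩ := ((isWeakEquiv_iff i).1 hw _ (kanComplex_fn P hZ)).2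
      (fnCurry (swapMap (fnUncurry f)))
    refine ⟨fnCurry (swapMap (fnUncurry g)), ?_⟩
    have hF := (kanComplex_fn P hZ).hepFibrant
    have := back (hF.homotopic_symm (hF.homotopic_of_gen hg))
    rw [swap] at this
    rwa [← swap _ _ (_ ≫ fnPre i Z), pre, swap]
  · have hF := (kanComplex_fn P hZ).hepFibrant
    have := back h
    rw [pre, pre] at this
    have := back (hF.homotopic_of_gen (((isWeakEquiv_iff i).1 hw _ (kanComplex_fn P hZ)).1 _ _
      (.rel _ _ this)))
    rwa [swap, swap] at this

end SSet

lemma quot_mk_eq_iff_of_collapse {α : Type*} (S : α → Prop) {r : α → α → Prop}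
    (hr : ∀ a b, r a b ↔ S a ∧ S b) (a b : α) :
    Quot.mk r a = Quot.mk r b ↔ a = b ∨ (S a ∧ S b) := by
  constructor
  · intro h
    have : (Quot.lift (fun c => a = c ∨ (S a ∧ S c)) (fun c d hcd => by
        rw [hr] at hcd
        apply propext
        constructor
        · rintro (rfl | h)
          · exact Or.inr hcd
          · exact Or.inr ⟨h.1, hcd.2⟩
        · rintro (rfl | h)
          · exact Or.inr ⟨hcd.2, hcd.1⟩
          · exact Or.inr ⟨h.1, hcd.1⟩) : Quot r → Prop) (Quot.mk r b) := h ▸ Or.inl rfl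
    exact this
  · rintro (rfl | h)
    · rfl
    · exact Quot.sound ((hr a b).2 h)

namespace PSSet

lemma smashMk_eq_iff {X Y : PSSet.{u}} {k} (x x' : X.obj k) (y y' : Y.obj k) :
    smashMk x y = smashMk x' y' ↔ (x = x' ∧ y = y') ∨
      ((x = X.pt k ∨ y = Y.pt k) ∧ (x' = X.pt k ∨ y' = Y.pt k)) :=
  (quot_mk_eq_iff_of_collapse (fun p : X.obj k × Y.obj k => p.1 = X.pt k ∨ p.2 = Y.pt k)
    (r := smashRel X Y k) (fun _ _ => Iff.rfl) (x, y) (x', y')).trans (by rw [Prod.mk.injEq])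

lemma smashMk_eq_pt_iff {X Y : PSSet.{u}} {k} (x : X.obj k) (y : Y.obj k) :
    smashMk x y = (smash X Y).pt k ↔ x = X.pt k ∨ y = Y.pt k := by
  change smashMk x y = smashMk (X.pt k) (Y.pt k) ↔ _
  rw [smashMk_eq_iff]
  tauto

/-- A simplicial set with a disjoint base point. -/
def plus (K : SSet.{u}) : PSSet.{u} :=
  ofData (fun k => Option (K.obj k)) (fun θ => Option.map (K.map θ))
    (by
      rintro k (_ | x)
      · rfl
      · exact congrArg some (map_id_app K x))
    (by
      rintro k l m θ θ' (_ | x)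
      · rfl
      · exact congrArg some (map_comp_app K θ θ' x))
    (fun _ => none) (fun _ => rfl)

/-- The simplex `x ∧ a` of `X ∧ K₊`. -/
def halfMk {X : PSSet.{u}} {K : SSet.{u}} {k} (x : X.obj k) (a : K.obj k) :
    (smash X (plus K)).obj k :=
  smashMk x (show (plus K).obj k from (some a : Option (K.obj k)))

lemma halfMk_pt {X : PSSet.{u}} {K : SSet.{u}} {k} (a : K.obj k) :
    halfMk (X.pt k) a = (smash X (plus K)).pt k := smashMk_pt_left _

lemma half_ind {X : PSSet.{u}} {K : SSet.{u}} {k} {P : (smash X (plus K)).obj k → Prop}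
    (hpt : P ((smash X (plus K)).pt k)) (h : ∀ x a, P (halfMk x a)) (z) : P z := by
  induction z using smash_ind with | _ x y
  obtain _ | a := y
  · have : smashMk x (none : Option (K.obj k)) = (smash X (plus K)).pt k :=
      smashMk_pt_right (Y := plus K) x
    rw [this]
    exact hpt
  · exact h x a

lemma halfMk_eq_iff {X : PSSet.{u}} {K : SSet.{u}} {k} (x x' : X.obj k) (a a' : K.obj k) :
    halfMk x a = halfMk x' a' ↔ (x = x' ∧ a = a') ∨ (x = X.pt k ∧ x' = X.pt k) := by
  have h (b : K.obj k) : ¬ (show (plus K).obj k from (some b : Option (K.obj k))) =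
      (plus K).pt k := fun h => Option.some_ne_none b h
  rw [halfMk, halfMk, smashMk_eq_iff]
  have e : (show (plus K).obj k from (some a : Option (K.obj k))) =
    (show (plus K).obj k from (some a' : Option (K.obj k))) ↔ a = a' := Option.some_inj
  rw [e]
  have := h a
  have := h a'
  tauto

lemma halfMk_eq_pt_iff {X : PSSet.{u}} {K : SSet.{u}} {k} (x : X.obj k) (a : K.obj k) :
    halfMk x a = (smash X (plus K)).pt k ↔ x = X.pt k := by
  rw [← halfMk_pt a, halfMk_eq_iff]
  tauto

/-- The function on `X ∧ K₊` given by a function of two variables, in a fixed degree. -/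
def halfDescAt {X : PSSet.{u}} {K : SSet.{u}} {k} {α : Type*} (φ : X.obj k → K.obj k → α) (p : α)
    (hφ : ∀ a, φ (X.pt k) a = p) : (smash X (plus K)).obj k → α :=
  Quot.lift (fun z : X.obj k × Option (K.obj k) => z.2.elim p (φ z.1)) (by
    have key : ∀ z : X.obj k × Option (K.obj k), (z.1 = X.pt k ∨ z.2 = none) →
        z.2.elim p (φ z.1) = p := by
      rintro ⟨x, _ | a⟩ (h | h)
      · rfl
      · rfl
      · exact (congrArg (φ · a) h).trans (hφ a)
      · exact absurd h (Option.some_ne_none a)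
    rintro z z' ⟨hz, hw⟩
    rw [key z hz, key z' hw])

/-- An unpointed map out of `X ∧ K₊` from a map on `X × K` that is constant on `* × K`. -/
def halfDescSSet {X : PSSet.{u}} {K Z : SSet.{u}} (f : X.toSSet ⊗ K ⟶ Z) (p : ∀ k, Z.obj k)
    (hp : ∀ {k l} (θ : k ⟶ l), Z.map θ (p k) = p l)
    (hf : ∀ k (a : K.obj k), f.app k (X.pt k, a) = p k) : (smash X (plus K)).toSSet ⟶ Z :=
  ofFun (fun k => halfDescAt (fun x a => f.app k (x, a)) (p k) (hf k)) (fun {k l} θ z => by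
    induction z using half_ind with
    | hpt => exact (hp θ).symm
    | h x a => exact app_map₂ f θ x a)

end PSSet

open PSSet

/-- The map `X × K ⟶ X ∧ K₊`. -/
def toHalf (X : PSSet.{u}) (K : SSet.{u}) : X.toSSet ⊗ K ⟶ (smash X (plus K)).toSSet :=
  ofFun (fun _ p => halfMk p.1 p.2) (fun _ _ => rfl)

/-- Smashing with `K₊` preserves injective weak equivalences. -/
lemma isWeakEquiv_smashMap_plus {A B : PSSet.{u}} (i : A ⟶ B)
    (hi : ∀ k, Function.Injective (PSSet.app i k)) (hw : IsWeakEquiv i.toHom) (K : SSet.{u}) :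
    IsWeakEquiv (smashMap i (plus K)).toHom := by
  rw [isWeakEquiv_iff]
  intro Z hZ
  have lift := monoLift_fnPre i.toHom hi hw hZ
  refine ⟨fun g g' h => ?_, fun f => ?_⟩
  · obtain ⟨h, h0, h1⟩ := (hZ.hepFibrant.homotopic_of_gen h).exists_map
    let c : K ⊗ delta1 ⟶ fn A.toSSet Z := fnCurry (ofFun
      (fun k p => h.app k (halfMk p.2 p.1.1, p.1.2))
      (fun θ p => app_map₂ h θ (halfMk p.2 p.1.1) p.1.2))
    have hc : ∀ k (a : K.obj k) (t : delta1.obj k) (x : A.obj k),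
      fnEval (c.app k (a, t)) x = h.app k (halfMk x a, t) := fun k a t x => fnEval_fnCurry _ _ _
    obtain ⟨F, hF, hF'⟩ := lift Bool (K ⊗ delta1) (fun _ => K) (fun b => bif b then ι₁ else ι₀)
      (fun b => fnCurry (swapMap (toHalf B K ≫ bif b then g' else g))) c
      (by
        rintro (_ | _) (_ | _) k a a' e
        · obtain rfl : a = a' := congrArg Prod.fst e
          rfl
        · exact absurd (congrArg Prod.snd e) vertex_ne
        · exact absurd (congrArg Prod.snd e).symm vertex_ne
        · obtain rfl : a = a' := congrArg Prod.fst e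
          rfl)
      (by
        have e0 : fnCurry (swapMap (toHalf B K ≫ g)) ≫ fnPre i.toHom Z = ι₀ ≫ c :=
          fn_hom_ext fun k a x => (fnEval_fnPre _ _ _ _).trans ((fnEval_fnCurry _ _ _).trans
            ((h0 k (halfMk x a)).symm.trans (hc k a _ x).symm))
        have e1 : fnCurry (swapMap (toHalf B K ≫ g')) ≫ fnPre i.toHom Z = ι₁ ≫ c :=
          fn_hom_ext fun k a x => (fnEval_fnPre _ _ _ _).trans ((fnEval_fnCurry _ _ _).trans
            ((h1 k (halfMk x a)).symm.trans (hc k a _ x).symm))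
        rintro (_ | _) k a
        · exact congr_app e0 k a
        · exact congr_app e1 k a)
    have hpt : ∀ k (a : K.obj k) (t : delta1.obj k), fnEval (F.app k (a, t)) (B.pt k) =
        h.app k ((smash A (plus K)).pt k, t) := fun k a t => by
      have := congrArg (fun v => fnEval v (A.pt k)) (hF k (a, t))
      simp only [fnEval_fnPre] at this
      rw [show i.toHom.app k (A.pt k) = B.pt k from i.app_pt k] at this
      exact this.trans ((hc k a t _).trans (congrArg (fun z => h.app k (z, t)) (halfMk_pt a)))
    let G : (smash B (plus K)).toSSet ⊗ delta1 ⟶ Z := ofFun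
      (fun k p => halfDescAt (fun x a => fnEval (F.app k (a, p.2)) x)
        (h.app k ((smash A (plus K)).pt k, p.2)) (fun a => hpt k a p.2) p.1)
      (fun {k l} θ p => by
        obtain ⟨z, t⟩ := p
        induction z using half_ind with
        | hpt =>
          exact (congrArg (fun z => h.app l (z, delta1.map θ t))
            ((smash A (plus K)).map_pt θ)).symm.trans (app_map₂ h θ ((smash A (plus K)).pt k) t)
        | h x a =>
          exact (congrArg (fnEval · (B.map θ x)) (app_map₂ F θ a t)).trans (map_fnEval θ _ x))
    refine .rel _ _ (.of G (fun k z => ?_) (fun k z => ?_))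
    · induction z using half_ind with
      | hpt =>
        refine (h0 k ((smash A (plus K)).pt k)).trans (congrArg (g.app k) ?_)
        exact (smashMap i (plus K)).app_pt k
      | h x a =>
        refine (congrArg (fnEval · x) (hF' false k a)).trans ?_
        exact fnEval_fnCurry _ _ _
    · induction z using half_ind with
      | hpt =>
        refine (h1 k ((smash A (plus K)).pt k)).trans (congrArg (g'.app k) ?_)
        exact (smashMap i (plus K)).app_pt k
      | h x a =>
        refine (congrArg (fnEval · x) (hF' true k a)).trans ?_
        exact fnEval_fnCurry _ _ _
  · obtain ⟨F, hF, -⟩ := lift Empty K (fun _ => K) (fun e => e.elim) (fun e => e.elim)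
      (fnCurry (swapMap (toHalf A K ≫ f))) (fun e => e.elim) (fun e => e.elim)
    have hF2 : ∀ k (a : K.obj k) (x : A.obj k),
        fnEval (F.app k a) (i.toHom.app k x) = f.app k (halfMk x a) := fun k a x => by
      have := congrArg (fun v => fnEval v x) (hF k a)
      simp only [fnEval_fnPre] at this
      exact this.trans (fnEval_fnCurry _ _ _)
    refine ⟨halfDescSSet (swapMap (fnUncurry F)) (fun k => f.app k ((smash A (plus K)).pt k))
      (fun θ => (app_map f θ _).symm.trans (congrArg (f.app _) ((smash A (plus K)).map_pt θ)))
      (fun k a => ?_), ?_⟩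
    · refine Eq.trans ?_ ((hF2 k a (A.pt k)).trans (congrArg (f.app k) (halfMk_pt a)))
      exact congrArg (fnEval (F.app k a)) (i.app_pt k).symm
    · refine .rel _ _ ?_
      convert homotopic_refl f
      refine hom_ext_app fun k z => ?_
      induction z using half_ind with
      | hpt =>
        rfl
      | h x a => exact hF2 k a x

namespace SSet

open modelCategoryQuillen in
lemma kanComplex_of_subcomplex_extension {Z : SSet.{u}}
    (h : ∀ {B : SSet.{u}} (A : B.Subcomplex), anodyneExtensions A.ι → ∀ f : (A : SSet.{u}) ⟶ Z,
      ∃ g : B ⟶ Z, A.ι ≫ g = f) : KanComplex Z := by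
  rw [KanComplex, HomotopicalAlgebra.isFibrant_iff, modelCategoryQuillen.fibration_iff]
  intro A B i hi
  have hi' : anodyneExtensions i := by
    rw [anodyneExtensions_eq_llp_rlp]
    exact MorphismProperty.le_llp_rlp _ _ hi
  simp only [J, MorphismProperty.iSup_iff] at hi
  obtain ⟨n, ⟨j⟩⟩ := hi
  refine ⟨fun {f g} sq => ?_⟩
  obtain ⟨e, he⟩ := h _ hi' f
  exact ⟨⟨{ l := e, fac_left := he, fac_right := Limits.terminalIsTerminal.hom_ext _ _ }⟩⟩

end SSet

namespace PSSet

/-- Evaluation of the simplices of a loop space. -/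
def loopEval {Y : PSSet.{u}} {k} (v : (loop Y).obj k) (b : circle.{u}.obj k) : Y.obj k :=
  v.1.app k (stdSimplex.objEquiv.symm (𝟙 k.unop), b)

lemma loopEval_map {Y : PSSet.{u}} {k l} (θ : k ⟶ l) (v : (loop Y).obj k) (b : circle.{u}.obj l) :
    loopEval ((loop Y).map θ v) b = v.1.app l (stdSimplex.objEquiv.symm θ.unop, b) := by
  refine congrArg (fun a : (stdSimplex.{u}.obj k.unop).obj l => v.1.app l (a, b)) ?_
  exact congrArg stdSimplex.objEquiv.symm (Category.id_comp θ.unop)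

lemma map_loopEval {Y : PSSet.{u}} {k l} (θ : k ⟶ l) (v : (loop Y).obj k)
    (b : circle.{u}.obj k) :
    loopEval ((loop Y).map θ v) (circle.map θ b) = Y.map θ (loopEval v b) := by
  rw [loopEval_map]
  refine Eq.trans ?_ (app_map₂ v.1 θ (stdSimplex.objEquiv.symm (𝟙 k.unop)) b)
  refine congrArg (fun a : (stdSimplex.{u}.obj k.unop).obj l => v.1.app l (a, circle.map θ b)) ?_
  exact congrArg stdSimplex.objEquiv.symm (Category.comp_id θ.unop).symm

lemma loopEval_pt {Y : PSSet.{u}} {k} (v : (loop Y).obj k) :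
    loopEval v (circle.pt k) = Y.pt k := v.2 _ _

lemma loop_ext {Y : PSSet.{u}} {k} {v w : (loop Y).obj k}
    (h : ∀ l (θ : k ⟶ l) b, loopEval ((loop Y).map θ v) b = loopEval ((loop Y).map θ w) b) :
    v = w := by
  refine Subtype.ext (hom_ext_app fun l p => ?_)
  have := h l (stdSimplex.objEquiv p.1).op p.2
  rw [loopEval_map, loopEval_map] at this
  exact this

lemma loop_hom_ext {P : SSet.{u}} {Y : PSSet.{u}} {f g : P ⟶ loop Y}
    (h : ∀ k p b, loopEval (f.app k p) b = loopEval (g.app k p) b) : f = g :=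
  hom_ext_app fun k p => loop_ext fun l θ b => by
    rw [← SSet.app_map, ← SSet.app_map]
    exact h _ _ _

lemma yonedaEquiv_symm_app {P : SSet.{u}} {k l} (p : P.obj k) (θ : k ⟶ l) :
    (SSet.yonedaEquiv.symm p).app l (stdSimplex.objEquiv.symm θ.unop) = P.map θ p := rfl

lemma yonedaEquiv_symm_app_id {P : SSet.{u}} {k} (p : P.obj k) :
    (SSet.yonedaEquiv.symm p).app k (stdSimplex.objEquiv.symm (𝟙 k.unop)) = p :=
  SSet.yonedaEquiv.apply_symm_apply p

/-- The simplex of `ΩY` given by a map `P × S¹ ⟶ Y` and a simplex of `P`. -/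
def loopMk {P : SSet.{u}} {Y : PSSet.{u}} (f : P ⊗ circle.toSSet ⟶ Y.toSSet)
    (hf : ∀ k p, f.app k (p, circle.pt k) = Y.pt k) {k} (p : P.obj k) : (loop Y).obj k :=
  ⟨SSet.yonedaEquiv.symm p ▷ circle.toSSet ≫ f,
    fun l a => hf l ((SSet.yonedaEquiv.symm p).app l a)⟩

lemma loopEval_map_loopMk {P : SSet.{u}} {Y : PSSet.{u}} (f : P ⊗ circle.toSSet ⟶ Y.toSSet)
    (hf) {k l} (p : P.obj k) (θ : k ⟶ l) (b : circle.{u}.obj l) :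
    loopEval ((loop Y).map θ (loopMk f hf p)) b = f.app l (P.map θ p, b) := by
  rw [loopEval_map]
  exact congrArg (fun a => f.app l (a, b)) (yonedaEquiv_symm_app p θ)

/-- The map `P ⟶ ΩY` adjoint to a map `P × S¹ ⟶ Y`. -/
def loopCurry {P : SSet.{u}} {Y : PSSet.{u}} (f : P ⊗ circle.toSSet ⟶ Y.toSSet)
    (hf : ∀ k p, f.app k (p, circle.pt k) = Y.pt k) : P ⟶ loop Y :=
  ofFun (fun _ p => loopMk f hf p) (fun {k l} θ p => loop_ext fun m θ' b => by
    rw [← map_comp_app, loopEval_map_loopMk, loopEval_map_loopMk, map_comp_app])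

@[simp] lemma loopEval_loopCurry {P : SSet.{u}} {Y : PSSet.{u}}
    (f : P ⊗ circle.toSSet ⟶ Y.toSSet) (hf) {k} (p : P.obj k) (b : circle.{u}.obj k) :
    loopEval ((loopCurry f hf).app k p) b = f.app k (p, b) :=
  congrArg (fun a => f.app k (a, b)) (yonedaEquiv_symm_app_id p)

@[simp] lemma loopEval_toLoop {X Y : PSSet.{u}} (σ : smash X circle ⟶ Y) {k} (x : X.obj k)
    (b : circle.{u}.obj k) :
    loopEval ((toLoop σ).app k x) b = PSSet.app σ k (smashMk x b) :=
  congrArg (fun a => PSSet.app σ k (smashMk a b)) (yonedaEquiv_symm_app_id x)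

/-- The map `P × S¹ ⟶ Y` adjoint to a map `P ⟶ ΩY`. -/
def loopUncurry {P : SSet.{u}} {Y : PSSet.{u}} (f : P ⟶ loop Y) :
    P ⊗ circle.toSSet ⟶ Y.toSSet :=
  ofFun (fun k p => loopEval (f.app k p.1) p.2) (fun {k l} θ p => by
    refine Eq.trans ?_ (map_loopEval θ (f.app k p.1) p.2)
    exact congrArg (loopEval · _) (SSet.app_map f θ p.1))

/-- The base point of `S¹` as a simplicial subset. -/
def circleBase : circle.{u}.toSSet.Subcomplex where
  obj k := {circle.pt k}
  map θ := by
    rintro _ rfl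
    exact circle.map_pt θ

lemma kanComplex_loop {Y : PSSet.{u}} (hY : KanComplex Y.toSSet) : KanComplex (loop Y) := by
  refine kanComplex_of_subcomplex_extension fun {B} A hA f => ?_
  obtain ⟨F, hF⟩ := exists_map_of_family (A.unionProd circleBase)
    (fun b : Bool => bif b then B else (A : SSet.{u}) ⊗ circle.toSSet)
    (fun b => match b with
      | true => ofFun (X := B) (Y := B ⊗ circle.toSSet) (fun k x => (x, circle.pt k))
        (fun θ x => Prod.ext rfl (circle.map_pt θ).symm)
      | false => A.ι ▷ circle.toSSet)
    (fun b => match b with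
      | true => ofFun (X := B) (Y := Y.toSSet) (fun k _ => Y.pt k) (fun θ _ => (Y.map_pt θ).symm)
      | false => loopUncurry f)
    (by
      rintro k ⟨q, t⟩ h
      obtain h | h := (A.mem_unionProd_iff _ _).1 h
      · obtain rfl : t = circle.pt k := h
        exact ⟨true, q, rfl⟩
      · exact ⟨false, (⟨q, h⟩, t), rfl⟩)
    (by
      rintro (_ | _) (_ | _) k a a' h
      · obtain ⟨a, t⟩ := a
        obtain ⟨a', t'⟩ := a'
        obtain rfl : t = t' := congrArg Prod.snd h
        obtain rfl : a = a' := Subtype.ext (congrArg Prod.fst h)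
        rfl
      · obtain ⟨a, t⟩ := a
        obtain rfl : t = circle.pt k := congrArg Prod.snd h
        exact loopEval_pt _
      · obtain ⟨a', t'⟩ := a'
        obtain rfl : circle.pt k = t' := congrArg Prod.snd h
        exact (loopEval_pt _).symm
      · rfl)
  obtain ⟨G, hG⟩ := hY.exists_extension _ (anodyneExtensions_unionProd_ι' _ _ hA) F
  have hG' : ∀ k q, G.app k (q, circle.pt k) = Y.pt k := fun k q =>
    (congr_app hG k ⟨(q, circle.pt k), (A.mem_unionProd_iff _ _).2 (Or.inl rfl)⟩).trans
      (hF true k q _)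
  refine ⟨loopCurry G hG', loop_hom_ext fun k p b => ?_⟩
  · refine (loopEval_loopCurry G hG' (A.ι.app k p) b).trans ?_
    exact (congr_app hG k ⟨(p.1, b), (A.mem_unionProd_iff _ _).2 (Or.inr p.2)⟩).trans
      (hF false k (p, b) _)

/-- The function complex with values in a pointed simplicial set. -/
def fnP (K : SSet.{u}) (Y : PSSet.{u}) : PSSet.{u} where
  toSSet := fn K Y.toSSet
  pt _ := ⟨fun l _ _ => Y.pt l, fun _ θ' _ => (Y.map_pt θ').symm⟩
  map_pt _ := rfl

lemma loop_fnP_hom_ext {P K : SSet.{u}} {Y : PSSet.{u}} {f g : P ⟶ loop (fnP K Y)}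
    (h : ∀ k p b (x : K.obj k), fnEval (Z := Y.toSSet) (loopEval (f.app k p) b) x =
      fnEval (Z := Y.toSSet) (loopEval (g.app k p) b) x) : f = g :=
  loop_hom_ext fun k p b => fn_ext (Z := Y.toSSet) fun l θ x => by
    have nat (f : P ⟶ loop (fnP K Y)) : (fn K Y.toSSet).map θ (loopEval (f.app k p) b) =
        loopEval (f.app l (P.map θ p)) (circle.map θ b) :=
      (map_loopEval θ (f.app k p) b).symm.trans
        (congrArg (loopEval · (circle.map θ b)) (SSet.app_map f θ p).symm)
    rw [nat f, nat g]
    exact h _ _ _ _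

lemma fn_loop_hom_ext {P K : SSet.{u}} {Y : PSSet.{u}} {f g : P ⟶ fn K (loop Y)}
    (h : ∀ k p b (x : K.obj k), loopEval (fnEval (f.app k p) x) b =
      loopEval (fnEval (g.app k p) x) b) : f = g :=
  fn_hom_ext fun k p x => loop_ext fun l θ b => by
    have nat (f : P ⟶ fn K (loop Y)) : (loop Y).map θ (fnEval (f.app k p) x) =
        fnEval (f.app l (P.map θ p)) (K.map θ x) :=
      (map_fnEval θ (f.app k p) x).symm.trans
        (congrArg (fnEval · (K.map θ x)) (SSet.app_map f θ p).symm)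
    rw [nat f, nat g]
    exact h _ _ _ _

/-- Evaluation of loops in a function complex. -/
def loopFnEval (K : SSet.{u}) (Y : PSSet.{u}) :
    (loop (fnP K Y) ⊗ K) ⊗ circle.toSSet ⟶ Y.toSSet :=
  ofFun (fun k p => fnEval (Z := Y.toSSet) (loopEval p.1.1 p.2) p.1.2) (fun {k l} θ p => by
    refine Eq.trans ?_ (map_fnEval (Z := Y.toSSet) θ (loopEval p.1.1 p.2) p.1.2)
    exact congrArg (fnEval (Z := Y.toSSet) · (K.map θ p.1.2)) (map_loopEval θ p.1.1 p.2))

/-- Exchanging the arguments of a loop in a function complex. -/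
def loopFnSwap (K : SSet.{u}) (Y : PSSet.{u}) : loop (fnP K Y) ⟶ fn K (loop Y) :=
  fnCurry (loopCurry (loopFnEval K Y)
    (fun _ p => congrArg (fnEval (Z := Y.toSSet) · p.2) (loopEval_pt p.1)))

lemma loopFnSwap_eval (K : SSet.{u}) (Y : PSSet.{u}) {k} (v : (loop (fnP K Y)).obj k)
    (x : K.obj k) (b : circle.{u}.obj k) :
    loopEval (fnEval ((loopFnSwap K Y).app k v) x) b =
      fnEval (Z := Y.toSSet) (loopEval v b) x := by
  rw [loopFnSwap, fnEval_fnCurry]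
  exact loopEval_loopCurry (loopFnEval K Y) _ (v, x) b

/-- Evaluation of functions with values in a loop space. -/
def fnLoopEval (K : SSet.{u}) (Y : PSSet.{u}) :
    (fn K (loop Y) ⊗ circle.toSSet) ⊗ K ⟶ Y.toSSet :=
  ofFun (fun k p => loopEval (fnEval p.1.1 p.2) p.1.2) (fun {k l} θ p => by
    refine Eq.trans ?_ (map_loopEval θ (fnEval p.1.1 p.2) p.1.2)
    exact congrArg (loopEval · (circle.map θ p.1.2)) (map_fnEval θ p.1.1 p.2))

/-- Exchanging the arguments of a function with values in a loop space. -/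
def fnLoopSwap (K : SSet.{u}) (Y : PSSet.{u}) : fn K (loop Y) ⟶ loop (fnP K Y) :=
  loopCurry (Y := fnP K Y) (fnCurry (fnLoopEval K Y))
    (fun k p => FnObj.ext (funext₃ fun l θ x => by
      change loopEval (fnEval _ x) (circle.map θ (circle.pt k)) = Y.pt l
      rw [show circle.map θ (circle.pt k) = circle.pt l from circle.map_pt θ]
      exact loopEval_pt _))

lemma fnLoopSwap_eval (K : SSet.{u}) (Y : PSSet.{u}) {k} (v : (fn K (loop Y)).obj k)
    (x : K.obj k) (b : circle.{u}.obj k) :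
    fnEval (Z := Y.toSSet) (loopEval ((fnLoopSwap K Y).app k v) b) x = loopEval (fnEval v x) b := by
  refine (congrArg (fnEval (Z := Y.toSSet) · x)
    (loopEval_loopCurry (Y := fnP K Y) (fnCurry (fnLoopEval K Y)) _ v b)).trans ?_
  exact fnEval_fnCurry (fnLoopEval K Y) (v, b) x

lemma loopFnSwap_comp (K : SSet.{u}) (Y : PSSet.{u}) :
    loopFnSwap K Y ≫ fnLoopSwap K Y = 𝟙 _ :=
  loop_fnP_hom_ext fun k v b x =>
    (fnLoopSwap_eval K Y ((loopFnSwap K Y).app k v) x b).trans (loopFnSwap_eval K Y v x b)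

lemma fnLoopSwap_comp (K : SSet.{u}) (Y : PSSet.{u}) :
    fnLoopSwap K Y ≫ loopFnSwap K Y = 𝟙 _ :=
  fn_loop_hom_ext fun k v b x =>
    (loopFnSwap_eval K Y ((fnLoopSwap K Y).app k v) x b).trans (fnLoopSwap_eval K Y v x b)

/-- The function complex of a weak equivalence of Kan complexes is a weak equivalence. -/
lemma isWeakEquiv_fnMap (K : SSet.{u}) {Z Z' : SSet.{u}} (f : Z ⟶ Z') (hf : IsWeakEquiv f)
    (hZ : KanComplex Z) (hZ' : KanComplex Z') : IsWeakEquiv (fnMap K f) := by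
  rw [isWeakEquiv_iff] at hf
  obtain ⟨r, hr⟩ := (hf Z hZ).2 (𝟙 Z)
  have hr' : HomotopicGen (r ≫ f) (𝟙 Z') := (hf Z' hZ').1 _ _ (by
    simpa using hr.postcomp f)
  refine isWeakEquiv_of_homotopyInverse _ (fnMap K r) ?_ ?_
  · rw [fnMap_comp, ← fnMap_id]
    exact hr.fnMap K
  · rw [fnMap_comp, ← fnMap_id]
    exact hr'.fnMap K

/-- The structure map of a function complex with values in a structure map. -/
def fnStr (K : SSet.{u}) {X Y : PSSet.{u}} (σ : smash X circle ⟶ Y) :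
    smash (fnP K X) circle ⟶ fnP K Y :=
  smashDesc (fun k v b => (⟨fun l θ x => PSSet.app σ l (smashMk (FnObj.toFun v l θ x)
      (circle.map θ b)), fun {l m} θ θ' x => by
        refine Eq.trans ?_ (PSSet.app_map σ θ' _)
        refine congrArg (PSSet.app σ m) ?_
        refine Eq.trans ?_ (map_smashMk θ' _ _).symm
        rw [PSSet.map_comp circle θ θ' b]
        exact congrArg (smashMk · _) (FnObj.nat v θ θ' x)⟩ : FnObj K Y.toSSet k))
    (fun θ v b => FnObj.ext (funext₃ fun l θ' x => congrArg (fun z => PSSet.app σ l (smashMk _ z))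
      (PSSet.map_comp circle θ θ' b).symm))
    (fun k b => FnObj.ext (funext₃ fun l θ' x => (congrArg (PSSet.app σ l)
      (smashMk_pt_left _)).trans (PSSet.app_pt σ l)))
    (fun k v => FnObj.ext (funext₃ fun l θ' x => by
      change PSSet.app σ l (smashMk _ (circle.map θ' (circle.pt k))) = _
      rw [show circle.map θ' (circle.pt k) = circle.pt l from circle.map_pt θ',
        smashMk_pt_right, PSSet.app_pt]
      rfl))

lemma fnEval_fnStr (K : SSet.{u}) {X Y : PSSet.{u}} (σ : smash X circle ⟶ Y) {k}
    (v : (fn K X.toSSet).obj k) (b : circle.{u}.obj k) (x : K.obj k) :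
    fnEval (Z := Y.toSSet) (PSSet.app (fnStr K σ) k (smashMk (X := fnP K X) v b)) x =
      PSSet.app σ k (smashMk (X := X) (fnEval v x) b) :=
  congrArg (fun z => PSSet.app σ k (smashMk (X := X) (fnEval v x) z)) (PSSet.map_id circle b)

lemma isWeakEquiv_toLoop_fnStr (K : SSet.{u}) {X Y : PSSet.{u}} (σ : smash X circle ⟶ Y)
    (hX : KanComplex X.toSSet) (hY : KanComplex Y.toSSet) (hσ : IsWeakEquiv (toLoop σ)) :
    IsWeakEquiv (toLoop (fnStr K σ)) := by
  have e : toLoop (fnStr K σ) = fnMap K (toLoop σ) ≫ fnLoopSwap K Y :=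
    loop_fnP_hom_ext fun k v b x => by
      rw [loopEval_toLoop]
      refine (fnEval_fnStr K σ v b x).trans ?_
      refine Eq.trans ?_ (fnLoopSwap_eval K Y ((fnMap K (toLoop σ)).app k v) x b).symm
      refine Eq.trans ?_ (congrArg (loopEval · b) (fnEval_fnMap K (toLoop σ) v x)).symm
      exact (loopEval_toLoop σ _ _).symm
  rw [e]
  refine (isWeakEquiv_fnMap K _ hσ hX (kanComplex_loop hY)).comp
    (isWeakEquiv_of_homotopyInverse _ (loopFnSwap K Y) ?_ ?_)
  · rw [fnLoopSwap_comp]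
    exact .refl _
  · rw [loopFnSwap_comp]
    exact .refl _

end PSSet

/-! ### Presentation of symmetric spectra by generators -/

@[simp] lemma blockSum_castAdd {n m : ℕ} (ρ : Equiv.Perm (Fin n)) (τ : Equiv.Perm (Fin m))
    (i : Fin n) : blockSum ρ τ (Fin.castAdd m i) = Fin.castAdd m (ρ i) := by
  simp [blockSum, Equiv.permCongr_apply]

@[simp] lemma blockSum_natAdd {n m : ℕ} (ρ : Equiv.Perm (Fin n)) (τ : Equiv.Perm (Fin m))
    (j : Fin m) : blockSum ρ τ (Fin.natAdd n j) = Fin.natAdd n (τ j) := by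
  simp [blockSum, Equiv.permCongr_apply]

lemma blockSum_one_one (n m : ℕ) :
    blockSum (1 : Equiv.Perm (Fin n)) (1 : Equiv.Perm (Fin m)) = 1 := by
  ext i
  induction i using Fin.addCases <;> simp

lemma blockSum_mul {n m : ℕ} (ρ ρ' : Equiv.Perm (Fin n)) (τ τ' : Equiv.Perm (Fin m)) :
    blockSum (ρ * ρ') (τ * τ') = blockSum ρ τ * blockSum ρ' τ' := by
  ext i
  induction i using Fin.addCases <;> simp

/-- The permutation of `n + 1` elements that fixes the last one and acts on the others by `ρ`. -/
def liftPerm {n : ℕ} (ρ : Equiv.Perm (Fin n)) : Equiv.Perm (Fin (n + 1)) :=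
  blockSum ρ (1 : Equiv.Perm (Fin 1))

@[simp] lemma liftPerm_castSucc {n : ℕ} (ρ : Equiv.Perm (Fin n)) (i : Fin n) :
    liftPerm ρ i.castSucc = (ρ i).castSucc := blockSum_castAdd _ _ _

@[simp] lemma liftPerm_last {n : ℕ} (ρ : Equiv.Perm (Fin n)) :
    liftPerm ρ (Fin.last n) = Fin.last n := blockSum_natAdd ρ 1 0

lemma liftPerm_one (n : ℕ) : liftPerm (1 : Equiv.Perm (Fin n)) = 1 := blockSum_one_one _ _

lemma liftPerm_mul {n : ℕ} (ρ ρ' : Equiv.Perm (Fin n)) :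
    liftPerm (ρ * ρ') = liftPerm ρ * liftPerm ρ' := blockSum_mul ρ ρ' 1 1

lemma liftPerm_swap {n : ℕ} (i j : Fin n) :
    liftPerm (Equiv.swap i j) = Equiv.swap i.castSucc j.castSucc := by
  ext l
  induction l using Fin.lastCases with
  | last =>
    rw [liftPerm_last, Equiv.swap_apply_of_ne_of_ne (Fin.castSucc_ne_last i).symm
      (Fin.castSucc_ne_last j).symm]
  | cast l =>
    rw [liftPerm_castSucc, (Fin.castSucc_injective n).swap_apply]

lemma blockSum_one_succ {n m : ℕ} (ρ : Equiv.Perm (Fin n)) :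
    blockSum ρ (1 : Equiv.Perm (Fin (m + 1))) = liftPerm (blockSum ρ (1 : Equiv.Perm (Fin m))) := by
  ext l
  induction l using Fin.lastCases with
  | last => exact congrArg Fin.val ((blockSum_natAdd ρ 1 (Fin.last m)).trans (liftPerm_last _).symm)
  | cast l =>
    rw [liftPerm_castSucc]
    induction l using Fin.addCases with
    | left i =>
      rw [blockSum_castAdd]
      exact congrArg Fin.val (blockSum_castAdd ρ 1 i)
    | right j =>
      rw [blockSum_natAdd]
      exact congrArg Fin.val (blockSum_natAdd ρ 1 j.castSucc)

lemma blockSum_one_swap {n m : ℕ} (i j : Fin m) :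
    blockSum (1 : Equiv.Perm (Fin n)) (Equiv.swap i j) =
      Equiv.swap (Fin.natAdd n i) (Fin.natAdd n j) := by
  ext l
  induction l using Fin.addCases with
  | left l =>
    rw [blockSum_castAdd, Equiv.swap_apply_of_ne_of_ne]
    · rfl
    · intro h; have := congrArg Fin.val h; simp at this; omega
    · intro h; have := congrArg Fin.val h; simp at this; omega
  | right l =>
    rw [blockSum_natAdd, (Fin.natAdd_injective m n).swap_apply]

/-- The transposition of the last two elements. -/
def lastSwap (n : ℕ) : Equiv.Perm (Fin (n + 2)) :=
  Equiv.swap (Fin.last n).castSucc (Fin.last (n + 1))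

lemma liftPerm_liftPerm_mul_lastSwap {n : ℕ} (ρ : Equiv.Perm (Fin n)) :
    liftPerm (liftPerm ρ) * lastSwap n = lastSwap n * liftPerm (liftPerm ρ) := by
  have h1 : liftPerm (liftPerm ρ) (Fin.last n).castSucc = (Fin.last n).castSucc := by simp
  have h2 : liftPerm (liftPerm ρ) (Fin.last (n + 1)) = Fin.last (n + 1) := by simp
  rw [lastSwap]
  nth_rw 2 [← h1, ← h2]
  rw [Equiv.mul_swap_eq_swap_mul, h1, h2]

lemma lastSwap_braid (n : ℕ) : liftPerm (lastSwap n) * lastSwap (n + 1) * liftPerm (lastSwap n) =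
    lastSwap (n + 1) * liftPerm (lastSwap n) * lastSwap (n + 1) := by
  have e : liftPerm (lastSwap n) = Equiv.swap (Fin.last n).castSucc.castSucc
      (Fin.last (n + 1)).castSucc := liftPerm_swap _ _
  rw [e, lastSwap]
  have h1 : (Fin.last n).castSucc.castSucc ≠ (Fin.last (n + 1)).castSucc := by
    simp [Fin.ext_iff]
  have h2 : (Fin.last n).castSucc.castSucc ≠ Fin.last (n + 2) := by simp [Fin.ext_iff]
  have h3 : (Fin.last (n + 1)).castSucc ≠ Fin.last (n + 2) := by simp [Fin.ext_iff]
  have e1 := Equiv.swap_mul_swap_mul_swap h3.symm h2.symm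
  have e2 := Equiv.swap_mul_swap_mul_swap h1 h2
  rw [Equiv.swap_comm (Fin.last (n + 1)).castSucc (Fin.last n).castSucc.castSucc,
    Equiv.swap_comm (Fin.last (n + 2))] at e1
  rw [Equiv.swap_comm (Fin.last (n + 2))] at e2
  exact e1.trans e2.symm

namespace SymSpectrum

lemma perm_σ (X : SymSpectrum.{u}) {n : ℕ} {k} (ρ : Equiv.Perm (Fin n)) (x : (X.level n).obj k)
    (b : PSSet.circle.{u}.obj k) : X.σ (X.perm ρ x) b = X.perm (liftPerm ρ) (X.σ x b) :=
  X.equivariant n 1 ρ 1 k x (fun _ => b)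

lemma σ_σ (X : SymSpectrum.{u}) {n : ℕ} {k} (x : (X.level n).obj k)
    (a b : PSSet.circle.{u}.obj k) :
    X.σ (X.σ x b) a = X.perm (lastSwap n) (X.σ (X.σ x a) b) := by
  have := X.equivariant n 2 1 (Equiv.swap 0 1) k x ![a, b]
  rw [perm_one, blockSum_one_swap] at this
  exact this

/-- The equivariance of iterated structure maps follows from the equivariance of structure maps
and of their compositions with respect to the transposition. -/
lemma equivariant_of_generators (X : SpectrumData.{u})
    (h1 : ∀ {n : ℕ} {k} (ρ : Equiv.Perm (Fin n)) (x : (X.level n).obj k)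
      (b : PSSet.circle.{u}.obj k), X.σ (X.perm ρ x) b = X.perm (liftPerm ρ) (X.σ x b))
    (h2 : ∀ {n : ℕ} {k} (x : (X.level n).obj k) (a b : PSSet.circle.{u}.obj k),
      X.σ (X.σ x b) a = X.perm (lastSwap n) (X.σ (X.σ x a) b))
    (n m : ℕ) (ρ : Equiv.Perm (Fin n)) (τ : Equiv.Perm (Fin m)) (k : SimplexCategoryᵒᵖ)
    (x : (X.level n).obj k) (b : Fin m → PSSet.circle.{u}.obj k) :
    X.iter (X.perm ρ x) m (fun i => b (τ.symm i)) = X.perm (blockSum ρ τ) (X.iter x m b) := by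
  have left : ∀ (m : ℕ) (x : (X.level n).obj k) (b : Fin m → PSSet.circle.{u}.obj k),
      X.iter (X.perm ρ x) m b = X.perm (blockSum ρ 1) (X.iter x m b) := by
    intro m
    induction m with
    | zero =>
      intro x b
      have : blockSum ρ (1 : Equiv.Perm (Fin 0)) = ρ := by
        ext i
        exact congrArg Fin.val (blockSum_castAdd ρ 1 i)
      rw [this]
      rfl
    | succ m ih =>
      intro x b
      change X.σ (X.iter (X.perm ρ x) m _) _ = _
      rw [ih, h1, blockSum_one_succ]
      rfl
  have swap : ∀ (m : ℕ) (i : Fin m) (x : (X.level n).obj k)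
      (b : Fin (m + 1) → PSSet.circle.{u}.obj k),
      X.iter x (m + 1) (fun j => b (Equiv.swap i.castSucc i.succ j)) =
        X.perm (blockSum 1 (Equiv.swap i.castSucc i.succ)) (X.iter x (m + 1) b) := by
    intro m
    induction m with
    | zero => exact fun i => i.elim0
    | succ m ih =>
      intro i x b
      induction i using Fin.lastCases with
      | last =>
        have e : blockSum (1 : Equiv.Perm (Fin n)) (Equiv.swap (Fin.last m).castSucc
            (Fin.last m).succ) = lastSwap (n + m) := blockSum_one_swap _ _
        rw [e]
        refine Eq.trans ?_ (h2 (X.iter x m (Fin.init (Fin.init b))) (b (Fin.last m).castSucc)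
          (b (Fin.last (m + 1))))
        change X.σ (X.σ (X.iter x m _) _) _ = _
        congr 1
        · congr 1
          · congr 1
            funext j
            refine congrArg b (Equiv.swap_apply_of_ne_of_ne ?_ ?_)
            · simp [Fin.ext_iff]; omega
            · simp [Fin.ext_iff]; omega
          · exact congrArg b (Equiv.swap_apply_left _ _)
        · exact congrArg b (Equiv.swap_apply_right _ _)
      | cast i =>
        have e : blockSum (1 : Equiv.Perm (Fin n)) (Equiv.swap i.castSucc.castSucc
            i.castSucc.succ) = liftPerm (blockSum (1 : Equiv.Perm (Fin n))
              (Equiv.swap i.castSucc i.succ)) := by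
          rw [blockSum_one_swap, blockSum_one_swap, liftPerm_swap]
          rfl
        rw [e]
        refine Eq.trans ?_ (h1 _ _ _)
        change X.σ (X.iter x (m + 1) _) _ = _
        rw [← ih i]
        congr 1
        · congr 1
          funext j
          refine congrArg b ?_
          rw [Fin.succ_castSucc, ← (Fin.castSucc_injective _).swap_apply]
        · refine congrArg b (Equiv.swap_apply_of_ne_of_ne ?_ ?_)
          · simp [Fin.ext_iff]; omega
          · simp [Fin.ext_iff]; omega
  have right : ∀ (x : (X.level n).obj k) (b : Fin m → PSSet.circle.{u}.obj k),
      X.iter x m (fun i => b (τ.symm i)) = X.perm (blockSum 1 τ) (X.iter x m b) := by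
    obtain _ | m := m
    · intro x b
      obtain rfl : τ = 1 := Subsingleton.elim _ _
      rw [blockSum_one_one, perm_one]
      rfl
    · have hτ : τ ∈ Submonoid.closure (Set.range fun i : Fin m =>
          Equiv.swap i.castSucc i.succ) := by
        rw [Equiv.Perm.mclosure_swap_castSucc_succ]
        trivial
      induction hτ using Submonoid.closure_induction with
      | mem τ h =>
        obtain ⟨i, rfl⟩ := h
        exact swap m i
      | one =>
        intro x b
        rw [blockSum_one_one, perm_one]
        rfl
      | mul τ τ' _ _ ih ih' =>
        intro x b
        rw [← mul_one (1 : Equiv.Perm (Fin n)), blockSum_mul, perm_mul, ← ih', ← ih]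
        rfl
  rw [left, right, ← perm_mul, ← blockSum_mul, mul_one, one_mul]

/-- Constructor for the data of symmetric spectra from functions on simplices. -/
def ofFunData (L : ℕ → PSSet.{u}) (pm : ∀ n (_ : Equiv.Perm (Fin n)) k, (L n).obj k → (L n).obj k)
    (sg : ∀ n k, (L n).obj k → PSSet.circle.{u}.obj k → (L (n + 1)).obj k)
    (pm_map : ∀ n ρ {k l} (θ : k ⟶ l) x, pm n ρ l ((L n).map θ x) = (L n).map θ (pm n ρ k x))
    (pm_pt : ∀ n ρ k, pm n ρ k ((L n).pt k) = (L n).pt k)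
    (pm_one : ∀ n k x, pm n 1 k x = x)
    (pm_mul : ∀ n ρ ρ' k x, pm n (ρ * ρ') k x = pm n ρ k (pm n ρ' k x))
    (sg_map : ∀ n {k l} (θ : k ⟶ l) x b,
      sg n l ((L n).map θ x) (PSSet.circle.map θ b) = (L (n + 1)).map θ (sg n k x b))
    (sg_pt_left : ∀ n k b, sg n k ((L n).pt k) b = (L (n + 1)).pt k)
    (sg_pt_right : ∀ n k x, sg n k x (PSSet.circle.pt k) = (L (n + 1)).pt k) : SpectrumData.{u} where
  level := L
  act n :=
    { toFun := fun ρ => PSSet.homMk (pm n ρ) (pm_map n ρ) (pm_pt n ρ)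
      map_one' := PSSet.hom_ext (pm_one n)
      map_mul' := fun ρ ρ' => PSSet.hom_ext (pm_mul n ρ ρ') }
  str n := PSSet.smashDesc (sg n) (sg_map n) (sg_pt_left n) (sg_pt_right n)

/-- Constructor for symmetric spectra from functions on simplices. -/
def ofFun (L : ℕ → PSSet.{u}) (pm : ∀ n (_ : Equiv.Perm (Fin n)) k, (L n).obj k → (L n).obj k)
    (sg : ∀ n k, (L n).obj k → PSSet.circle.{u}.obj k → (L (n + 1)).obj k)
    (pm_map : ∀ n ρ {k l} (θ : k ⟶ l) x, pm n ρ l ((L n).map θ x) = (L n).map θ (pm n ρ k x))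
    (pm_pt : ∀ n ρ k, pm n ρ k ((L n).pt k) = (L n).pt k)
    (pm_one : ∀ n k x, pm n 1 k x = x)
    (pm_mul : ∀ n ρ ρ' k x, pm n (ρ * ρ') k x = pm n ρ k (pm n ρ' k x))
    (sg_map : ∀ n {k l} (θ : k ⟶ l) x b,
      sg n l ((L n).map θ x) (PSSet.circle.map θ b) = (L (n + 1)).map θ (sg n k x b))
    (sg_pt_left : ∀ n k b, sg n k ((L n).pt k) b = (L (n + 1)).pt k)
    (sg_pt_right : ∀ n k x, sg n k x (PSSet.circle.pt k) = (L (n + 1)).pt k)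
    (h1 : ∀ n ρ k x b, sg n k (pm n ρ k x) b = pm (n + 1) (liftPerm ρ) k (sg n k x b))
    (h2 : ∀ n k x a b, sg (n + 1) k (sg n k x b) a =
      pm (n + 2) (lastSwap n) k (sg (n + 1) k (sg n k x a) b)) : SymSpectrum.{u} where
  toSpectrumData := ofFunData L pm sg pm_map pm_pt pm_one pm_mul sg_map sg_pt_left sg_pt_right
  equivariant := equivariant_of_generators _ (fun ρ x b => h1 _ ρ _ x b) (fun x a b => h2 _ _ x a b)

end SymSpectrum

namespace SymSpectrum

/-! ### Maps of symmetric spectra on simplices -/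

/-- The value of a map of symmetric spectra on a simplex. -/
def ap {X Y : SymSpectrum.{u}} (f : X ⟶ Y) {n k} (x : (X.level n).obj k) : (Y.level n).obj k :=
  PSSet.app (f.app n) k x

section ap

variable {X Y Z : SymSpectrum.{u}} (f : X ⟶ Y) (g : Y ⟶ Z) {n : ℕ} {k : SimplexCategoryᵒᵖ}

lemma ap_map {l} (θ : k ⟶ l) (x : (X.level n).obj k) :
    ap f ((X.level n).map θ x) = (Y.level n).map θ (ap f x) := PSSet.app_map _ _ _

@[simp] lemma ap_pt : ap f ((X.level n).pt k) = (Y.level n).pt k := PSSet.app_pt _ _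

lemma ap_perm (ρ : Equiv.Perm (Fin n)) (x : (X.level n).obj k) :
    ap f (X.perm ρ x) = Y.perm ρ (ap f x) := f.app_perm n ρ k x

lemma ap_σ (x : (X.level n).obj k) (b : PSSet.circle.{u}.obj k) :
    ap f (X.σ x b) = Y.σ (ap f x) b := f.app_σ n k x b

@[simp] lemma ap_comp (x : (X.level n).obj k) : ap (f ≫ g) x = ap g (ap f x) := rfl

variable {f} in
lemma hom_ext_ap {f' : X ⟶ Y} (h : ∀ n k (x : (X.level n).obj k), ap f x = ap f' x) : f = f' :=
  hom_ext fun n => PSSet.hom_ext fun k x => h n k x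

end ap

/-- Constructor for maps of symmetric spectra from functions on simplices. -/
def homOfFun {X Y : SymSpectrum.{u}} (φ : ∀ n k, (X.level n).obj k → (Y.level n).obj k)
    (h_map : ∀ n {k l} (θ : k ⟶ l) x, φ n l ((X.level n).map θ x) = (Y.level n).map θ (φ n k x))
    (h_pt : ∀ n k, φ n k ((X.level n).pt k) = (Y.level n).pt k)
    (h_perm : ∀ n ρ k x, φ n k (X.perm ρ x) = Y.perm ρ (φ n k x))
    (h_σ : ∀ n k x b, φ (n + 1) k (X.σ x b) = Y.σ (φ n k x) b) : X ⟶ Y where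
  app n := PSSet.homMk (φ n) (h_map n) (h_pt n)
  app_perm := h_perm
  app_σ := h_σ

/-- The trivial symmetric spectrum. -/
def zero : SymSpectrum.{u} :=
  ofFun (fun _ => PSSet.ofData (fun _ => PUnit) (fun _ x => x) (fun _ _ => rfl)
    (fun _ _ _ => rfl) (fun _ => PUnit.unit) (fun _ => rfl)) (fun _ _ _ x => x)
    (fun _ _ _ _ => PUnit.unit) (fun _ _ _ _ _ _ => rfl) (fun _ _ _ => rfl) (fun _ _ _ => rfl)
    (fun _ _ _ _ _ => rfl) (fun _ _ _ _ _ _ => rfl) (fun _ _ _ => rfl) (fun _ _ _ => rfl)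
    (fun _ _ _ _ _ => rfl) (fun _ _ _ _ _ => rfl)

lemma zero_ext {n k} (x y : (zero.{u}.level n).obj k) : x = y := Subsingleton.elim (α := PUnit) x y

/-- The trivial map. -/
def zeroHom (X Y : SymSpectrum.{u}) : X ⟶ Y :=
  homOfFun (fun n k _ => (Y.level n).pt k) (fun n _ _ θ _ => ((Y.level n).map_pt θ).symm)
    (fun _ _ => rfl) (fun _ ρ k _ => (perm_pt _ ρ k).symm) (fun _ _ _ b => (σ_pt_left _ b).symm)

/-! ### Parametrised maps -/

/-- A map `X ∧ Q₊ ⟶ E`, given by its values on simplices. -/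
@[ext]
structure ParamHom (X : SymSpectrum.{u}) (Q : SSet.{u}) (E : SymSpectrum.{u}) : Type u where
  ev : ∀ {n : ℕ} {k : SimplexCategoryᵒᵖ}, (X.level n).obj k → Q.obj k → (E.level n).obj k
  ev_map : ∀ {n : ℕ} {k l : SimplexCategoryᵒᵖ} (θ : k ⟶ l) (x : (X.level n).obj k) (q : Q.obj k),
    ev ((X.level n).map θ x) (Q.map θ q) = (E.level n).map θ (ev x q)
  ev_pt : ∀ {n : ℕ} {k : SimplexCategoryᵒᵖ} (q : Q.obj k),
    ev ((X.level n).pt k) q = (E.level n).pt k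
  ev_perm : ∀ {n : ℕ} {k : SimplexCategoryᵒᵖ} (ρ : Equiv.Perm (Fin n)) (x : (X.level n).obj k)
    (q : Q.obj k), ev (X.perm ρ x) q = E.perm ρ (ev x q)
  ev_σ : ∀ {n : ℕ} {k : SimplexCategoryᵒᵖ} (x : (X.level n).obj k) (b : PSSet.circle.{u}.obj k)
    (q : Q.obj k), ev (X.σ x b) q = E.σ (ev x q) b

namespace ParamHom

variable {X X' E E' : SymSpectrum.{u}} {Q Q' : SSet.{u}}

/-- Change of source and of parameters. -/
def pull (F : ParamHom X Q E) (i : X' ⟶ X) (j : Q' ⟶ Q) : ParamHom X' Q' E where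
  ev x q := F.ev (ap i x) (j.app _ q)
  ev_map θ x q := by rw [ap_map, SSet.app_map, F.ev_map]
  ev_pt q := by rw [ap_pt, F.ev_pt]
  ev_perm ρ x q := by rw [ap_perm, F.ev_perm]
  ev_σ x b q := by rw [ap_σ, F.ev_σ]

/-- Composition with a map of symmetric spectra. -/
def post (F : ParamHom X Q E) (e : E ⟶ E') : ParamHom X Q E' where
  ev x q := ap e (F.ev x q)
  ev_map θ x q := by rw [F.ev_map, ap_map]
  ev_pt q := by rw [F.ev_pt, ap_pt]
  ev_perm ρ x q := by rw [F.ev_perm, ap_perm]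
  ev_σ x b q := by rw [F.ev_σ, ap_σ]

/-- The parametrised map that does not depend on the parameter. -/
def const (f : X ⟶ E) (Q : SSet.{u}) : ParamHom X Q E where
  ev x _ := ap f x
  ev_map θ x _ := ap_map f θ x
  ev_pt _ := ap_pt f
  ev_perm ρ x _ := ap_perm f ρ x
  ev_σ x b _ := ap_σ f x b

/-- The parametrised map at a point of the parameter space. -/
def fiber (F : ParamHom X Q E) (q : ∀ k, Q.obj k)
    (hq : ∀ {k l} (θ : k ⟶ l), Q.map θ (q k) = q l) : X ⟶ E :=
  homOfFun (fun _ k x => F.ev x (q k)) (fun _ _ _ θ x => by rw [← hq θ, F.ev_map])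
    (fun _ _ => F.ev_pt _) (fun _ ρ _ x => F.ev_perm ρ x _) (fun _ _ x b => F.ev_σ x b _)

/-- The homotopy given by a map parametrised by the interval. -/
def homotopy (F : ParamHom X delta1 E) {f g : X ⟶ E}
    (h0 : ∀ {n k} (x : (X.level n).obj k), F.ev x (vertex 0 k) = ap f x)
    (h1 : ∀ {n k} (x : (X.level n).obj k), F.ev x (vertex 1 k) = ap g x) : Homotopy f g where
  h _ := SSet.ofFun (fun _ p => F.ev p.1 p.2) (fun θ p => F.ev_map θ p.1 p.2)
  h_pt _ _ a := F.ev_pt a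
  h_perm _ ρ _ x a := F.ev_perm ρ x a
  h_σ _ _ x b a := F.ev_σ x b a
  h_zero _ := hom_ext_app fun _ x => h0 x
  h_one _ := hom_ext_app fun _ x => h1 x

/-- The map parametrised by the interval given by a homotopy. -/
def ofHomotopy {f g : X ⟶ E} (H : Homotopy f g) : ParamHom X delta1 E where
  ev {n k} x q := (H.h n).app k (x, q)
  ev_map θ x q := app_map₂ (H.h _) θ x q
  ev_pt q := H.h_pt _ _ q
  ev_perm ρ x q := H.h_perm _ ρ _ x q
  ev_σ x b q := H.h_σ _ _ x b q

lemma ofHomotopy_zero {f g : X ⟶ E} (H : Homotopy f g) {n k} (x : (X.level n).obj k) :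
    (ofHomotopy H).ev x (vertex 0 k) = ap f x := congr_app (H.h_zero n) k x

lemma ofHomotopy_one {f g : X ⟶ E} (H : Homotopy f g) {n k} (x : (X.level n).obj k) :
    (ofHomotopy H).ev x (vertex 1 k) = ap g x := congr_app (H.h_one n) k x

end ParamHom

/-- Two maps of symmetric spectra are homotopic if there is a homotopy between them. -/
def Htpc {X Y : SymSpectrum.{u}} (f g : X ⟶ Y) : Prop := Nonempty (Homotopy f g)

lemma Htpc.of {X Y : SymSpectrum.{u}} {f g : X ⟶ Y} (F : ParamHom X delta1 Y)
    (h0 : ∀ {n k} (x : (X.level n).obj k), F.ev x (vertex 0 k) = ap f x)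
    (h1 : ∀ {n k} (x : (X.level n).obj k), F.ev x (vertex 1 k) = ap g x) : Htpc f g :=
  ⟨F.homotopy h0 h1⟩

lemma Htpc.exists_param {X Y : SymSpectrum.{u}} {f g : X ⟶ Y} (h : Htpc f g) :
    ∃ F : ParamHom X delta1 Y, (∀ {n k} (x : (X.level n).obj k), F.ev x (vertex 0 k) = ap f x) ∧
      ∀ {n k} (x : (X.level n).obj k), F.ev x (vertex 1 k) = ap g x :=
  ⟨ParamHom.ofHomotopy h.some, fun x => ParamHom.ofHomotopy_zero _ x,
    fun x => ParamHom.ofHomotopy_one _ x⟩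

lemma htpc_refl {X Y : SymSpectrum.{u}} (f : X ⟶ Y) : Htpc f f :=
  .of (ParamHom.const f _) (fun _ => rfl) (fun _ => rfl)

lemma Htpc.precomp {X Y Z : SymSpectrum.{u}} (f : X ⟶ Y) {g g' : Y ⟶ Z} (h : Htpc g g') :
    Htpc (f ≫ g) (f ≫ g') := ⟨h.some.precomp f⟩

lemma Htpc.postcomp {X Y Z : SymSpectrum.{u}} {f f' : X ⟶ Y} (h : Htpc f f') (g : Y ⟶ Z) :
    Htpc (f ≫ g) (f' ≫ g) := by
  obtain ⟨F, h0, h1⟩ := h.exists_param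
  exact .of (F.post g) (fun x => congrArg (ap g) (h0 x)) (fun x => congrArg (ap g) (h1 x))

/-! ### Half smash products -/

/-- The map `X ∧ Q₊ ⟶ E` given by a parametrised map. -/
def ParamHom.toHalf {X E : SymSpectrum.{u}} {Q : SSet.{u}} (F : ParamHom X Q E) :
    X.smash (plus Q) ⟶ E :=
  homOfFun (fun n k => halfDescAt (fun x q => F.ev x q) ((E.level n).pt k) (fun q => F.ev_pt q))
    (fun n _ _ θ z => by
      induction z using half_ind with
      | hpt => exact ((E.level n).map_pt θ).symm
      | h x a => exact F.ev_map θ x a)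
    (fun n k => rfl)
    (fun n ρ k z => by
      induction z using half_ind with
      | hpt =>
        refine (congrArg (halfDescAt (X := X.level n) (fun x q => F.ev x q) _ _)
          (perm_pt (X.smash (plus Q)).toSpectrumData ρ k)).trans ?_
        exact (perm_pt _ ρ k).symm
      | h x a => exact F.ev_perm ρ x a)
    (fun n k z b => by
      induction z using half_ind with
      | hpt =>
        refine (congrArg (halfDescAt (X := X.level (n + 1)) (fun x q => F.ev x q) _ _)
          (σ_pt_left (X.smash (plus Q)).toSpectrumData b)).trans ?_
        exact (σ_pt_left _ b).symm
      | h x a => exact F.ev_σ x b a)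

/-- The simplex `x ∧ q` of `X ∧ Q₊`. -/
def halfSmash {X : SymSpectrum.{u}} {Q : SSet.{u}} {n k} (x : (X.level n).obj k) (q : Q.obj k) :
    ((X.smash (plus Q)).level n).obj k := halfMk x q

/-- The parametrised map given by a map `X ∧ Q₊ ⟶ E`. -/
def ParamHom.ofHalf {X E : SymSpectrum.{u}} {Q : SSet.{u}} (f : X.smash (plus Q) ⟶ E) :
    ParamHom X Q E where
  ev x q := ap f (halfSmash x q)
  ev_map θ x q := ap_map f θ (halfSmash x q)
  ev_pt q := (congrArg (ap f) (halfMk_pt q)).trans (ap_pt f)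
  ev_perm ρ x q := ap_perm f ρ (halfSmash x q)
  ev_σ x b q := ap_σ f (halfSmash x q) b

/-! ### Extension of partially defined maps -/

/-- The symmetric subspectrum given by a predicate on simplices. -/
def sub (T : SymSpectrum.{u}) (P : ∀ {n k}, (T.level n).obj k → Prop)
    (h_map : ∀ {n k l} (θ : k ⟶ l) (x : (T.level n).obj k), P x → P ((T.level n).map θ x))
    (h_pt : ∀ {n k}, P ((T.level n).pt k))
    (h_perm : ∀ {n k} ρ (x : (T.level n).obj k), P x → P (T.perm ρ x))
    (h_σ : ∀ {n k} (x : (T.level n).obj k) b, P x → P (T.σ x b)) : SymSpectrum.{u} :=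
  ofFun (fun n => PSSet.ofData (fun k => {x : (T.level n).obj k // P x})
      (fun θ x => ⟨(T.level n).map θ x.1, h_map θ x.1 x.2⟩)
      (fun _ x => Subtype.ext (PSSet.map_id _ x.1))
      (fun θ θ' x => Subtype.ext (PSSet.map_comp _ θ θ' x.1))
      (fun _ => ⟨_, h_pt⟩) (fun θ => Subtype.ext ((T.level n).map_pt θ)))
    (fun _ ρ _ x => ⟨T.perm ρ x.1, h_perm ρ x.1 x.2⟩)
    (fun _ _ x b => ⟨T.σ x.1 b, h_σ x.1 b x.2⟩)
    (fun _ ρ _ _ θ x => Subtype.ext (map_perm _ ρ θ x.1))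
    (fun _ ρ k => Subtype.ext (perm_pt _ ρ k))
    (fun _ k x => Subtype.ext (perm_one _ k x.1))
    (fun _ ρ ρ' k x => Subtype.ext (perm_mul _ ρ ρ' k x.1))
    (fun _ _ _ θ x b => Subtype.ext (map_σ _ θ x.1 b))
    (fun _ _ b => Subtype.ext (σ_pt_left _ b))
    (fun _ _ x => Subtype.ext (σ_pt_right _ x.1))
    (fun _ ρ _ x b => Subtype.ext (perm_σ T ρ x.1 b))
    (fun _ _ x a b => Subtype.ext (σ_σ T x.1 a b))

/-- A partially defined map to an injective spectrum extends if its domain of definition is a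
deformation retract in every level. -/
lemma IsInjective.exists_extension {T E : SymSpectrum.{u}} (hE : IsInjective E)
    (R : ∀ {n k}, (T.level n).obj k → (E.level n).obj k → Prop)
    (R_map : ∀ {n k l} (θ : k ⟶ l) {x : (T.level n).obj k} {e}, R x e →
      R ((T.level n).map θ x) ((E.level n).map θ e))
    (R_pt : ∀ {n k}, R ((T.level n).pt k) ((E.level n).pt k))
    (R_perm : ∀ {n k} ρ {x : (T.level n).obj k} {e}, R x e → R (T.perm ρ x) (E.perm ρ e))
    (R_σ : ∀ {n k} {x : (T.level n).obj k} {e} b, R x e → R (T.σ x b) (E.σ e b))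
    (R_fun : ∀ {n k} {x : (T.level n).obj k} {e e'}, R x e → R x e' → e = e')
    (D : ∀ n, (T.level n).toSSet ⊗ delta1 ⟶ (T.level n).toSSet)
    (D_zero : ∀ n k (x : (T.level n).obj k), (D n).app k (x, vertex 0 k) = x)
    (D_dom : ∀ n k (x : (T.level n).obj k) (t : delta1.obj k) e, R x e →
      ∃ e', R ((D n).app k (x, t)) e')
    (D_one : ∀ n k (x : (T.level n).obj k), ∃ e, R ((D n).app k (x, vertex 1 k)) e) :
    ∃ F : T ⟶ E, ∀ {n k} {x : (T.level n).obj k} {e}, R x e → ap F x = e := by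
  let S : SymSpectrum.{u} := sub T (fun x => ∃ e, R x e) (fun θ _ h => ⟨_, R_map θ h.choose_spec⟩)
    ⟨_, R_pt⟩ (fun ρ _ h => ⟨_, R_perm ρ h.choose_spec⟩) (fun _ b h => ⟨_, R_σ b h.choose_spec⟩)
  let inc : S ⟶ T := homOfFun (fun _ _ x => x.1) (fun _ _ _ _ _ => rfl) (fun _ _ => rfl)
    (fun _ _ _ _ => rfl) (fun _ _ _ _ => rfl)
  let f : S ⟶ E := homOfFun (fun _ _ x => x.2.choose)
    (fun _ _ _ θ x => R_fun (Exists.choose_spec _) (R_map θ x.2.choose_spec))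
    (fun _ _ => R_fun (Exists.choose_spec _) R_pt)
    (fun _ ρ _ x => R_fun (Exists.choose_spec _) (R_perm ρ x.2.choose_spec))
    (fun _ _ x b => R_fun (Exists.choose_spec _) (R_σ b x.2.choose_spec))
  obtain ⟨F, hF⟩ := hE S T inc (fun _ _ _ _ h => Subtype.ext h) (fun n => by
    let r : (T.level n).toSSet ⟶ (S.level n).toSSet :=
      SSet.ofFun (fun k x => ⟨(D n).app k (x, vertex 1 k), D_one n k x⟩)
        (fun {k l} θ x => Subtype.ext (app_map₂ (D n) θ x (vertex 1 k)))
    have dom : ∀ k (p : (S.level n).obj k) (t : delta1.obj k),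
        ∃ e, R ((D n).app k (p.1, t)) e := fun k p t => by
      obtain ⟨e, he⟩ := p.2
      exact D_dom n k p.1 t e he
    refine isWeakEquiv_of_homotopyInverse _ r (.symm _ _ (.rel _ _ (.of
      (SSet.ofFun (fun k p => ⟨(D n).app k (p.1.1, p.2), dom k p.1 p.2⟩)
        (fun θ p => Subtype.ext (app_map₂ (D n) θ p.1.1 p.2)))
      (fun k x => Subtype.ext (D_zero n k x.1)) (fun k x => rfl))))
      (.symm _ _ (.rel _ _ (.of (D n) (D_zero n) (fun _ _ => rfl))))) f
  refine ⟨F, fun {n k x e} h => ?_⟩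
  have : ap (inc ≫ F) (show (S.level n).obj k from ⟨x, e, h⟩) =
    ap f (show (S.level n).obj k from ⟨x, e, h⟩) := by rw [hF]
  exact this.trans (R_fun (Exists.choose_spec _) h)

/-- The homotopy extension property for maps to injective spectra. The parameter space is `Q`, with
a simplicial subset covered by maps `j c : A c ⟶ Q`. -/
lemma IsInjective.hep {E : SymSpectrum.{u}} (hE : IsInjective E) {X X' : SymSpectrum.{u}}
    {i : X ⟶ X'} (hi : IsMono i) {ι : Type*} {Q : SSet.{u}} (A : ι → SSet.{u}) (j : ∀ c, A c ⟶ Q)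
    (H : ∀ c, ParamHom X' (A c ⊗ delta1) E) (g : ParamHom X' Q E) (G : ParamHom X (Q ⊗ delta1) E)
    (hHH : ∀ {c c' k a a'}, (j c).app k a = (j c').app k a' → ∀ {n} (x : (X'.level n).obj k)
      (t : delta1.obj k), (H c).ev x (a, t) = (H c').ev x (a', t))
    (hHG : ∀ {c n k} a (x : (X.level n).obj k) (t : delta1.obj k),
      (H c).ev (ap i x) (a, t) = G.ev x ((j c).app k a, t))
    (hHg : ∀ {c n k} a (x : (X'.level n).obj k),
      (H c).ev x (a, vertex 1 k) = g.ev x ((j c).app k a))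
    (hgG : ∀ {n k} (x : (X.level n).obj k) q, g.ev (ap i x) q = G.ev x (q, vertex 1 k)) :
    ∃ F : ParamHom X' (Q ⊗ delta1) E,
      (∀ {n k} (x : (X.level n).obj k) q (t : delta1.obj k),
        F.ev (ap i x) (q, t) = G.ev x (q, t)) ∧
      (∀ {c n k} a (x : (X'.level n).obj k) (t : delta1.obj k),
        F.ev x ((j c).app k a, t) = (H c).ev x (a, t)) ∧
      ∀ {n k} (x : (X'.level n).obj k) q, F.ev x (q, vertex 1 k) = g.ev x q := by
  let R {n k} (x : (X'.level n).obj k) (q : Q.obj k) (t : delta1.obj k)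
      (e : (E.level n).obj k) : Prop :=
    (∃ y, ap i y = x ∧ G.ev y (q, t) = e) ∨ (∃ c a, (j c).app k a = q ∧ (H c).ev x (a, t) = e) ∨
      (t = vertex 1 k ∧ g.ev x q = e)
  have R_fun : ∀ {n k} {x : (X'.level n).obj k} {q} {t : delta1.obj k} {e e'}, R x q t e →
      R x q t e' → e = e' := by
    rintro n k x q t e e' (⟨y, rfl, rfl⟩ | ⟨c, a, rfl, rfl⟩ | ⟨rfl, rfl⟩)
      (⟨y', hy, rfl⟩ | ⟨c', a', h', rfl⟩ | ⟨ht, rfl⟩)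
    · obtain rfl := hi n k hy
      rfl
    · subst h'
      exact (hHG a' y t).symm
    · subst ht
      exact (hgG y q).symm
    · subst hy
      exact hHG a y' t
    · exact hHH h'.symm x t
    · subst ht
      exact hHg a x
    · subst hy
      exact hgG y' q
    · subst h'
      exact (hHg a' x).symm
    · rfl
  have R_pt : ∀ {n k q} {t : delta1.obj k} {e}, R ((X'.level n).pt k) q t e →
      e = (E.level n).pt k := by
    rintro n k q t e (⟨y, hy, rfl⟩ | ⟨c, a, -, rfl⟩ | ⟨-, rfl⟩)
    · obtain rfl : y = (X.level n).pt k := hi n k (hy.trans (ap_pt i).symm)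
      exact G.ev_pt _
    · exact (H c).ev_pt _
    · exact g.ev_pt _
  let D (n : ℕ) : ((X'.smash (plus (Q ⊗ delta1))).level n).toSSet ⊗ delta1 ⟶
      ((X'.smash (plus (Q ⊗ delta1))).level n).toSSet :=
    SSet.ofFun (fun k p => halfDescAt (X := X'.level n) (K := Q ⊗ delta1)
        (fun x q => (halfSmash x ((q.1, sup1 q.2 p.2) : Q.obj k × delta1.obj k) :
          ((X'.smash (plus (Q ⊗ delta1))).level n).obj k))
        (((X'.smash (plus (Q ⊗ delta1))).level n).pt k) (fun q => halfMk_pt _) p.1)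
      (fun {k l} θ p => by
        obtain ⟨z, s⟩ := p
        induction z using half_ind with
        | hpt => exact (PSSet.map_pt _ θ).symm
        | h x a => rfl)
  have D_zero : ∀ n k (z : (PSSet.smash (X'.level n) (plus (Q ⊗ delta1))).obj k),
      (D n).app k (z, vertex 0 k) = z := fun n k z => by
    induction z using half_ind with
    | hpt => rfl
    | h x a =>
      exact congrArg (fun t => halfSmash (Q := Q ⊗ delta1) x (a.1, t)) (sup1_zero a.2)
  obtain ⟨F, hF⟩ := hE.exists_extension (T := X'.smash (plus (Q ⊗ delta1)))
    (fun {n k} z e => (z = ((X'.smash (plus (Q ⊗ delta1))).level n).pt k ∧ e = (E.level n).pt k) ∨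
      ∃ x q t, z = halfSmash x ((q, t) : Q.obj k × delta1.obj k) ∧ R x q t e)
    (by
      rintro n k l θ z e (⟨rfl, rfl⟩ | ⟨x, q, t, rfl, h⟩)
      · exact Or.inl ⟨PSSet.map_pt _ θ, PSSet.map_pt _ θ⟩
      · refine Or.inr ⟨_, Q.map θ q, delta1.map θ t, rfl, ?_⟩
        obtain ⟨y, rfl, rfl⟩ | ⟨c, a, rfl, rfl⟩ | ⟨rfl, rfl⟩ := h
        · exact Or.inl ⟨_, ap_map i θ y, G.ev_map θ y (q, t)⟩
        · exact Or.inr (Or.inl ⟨c, _, SSet.app_map _ θ a, (H c).ev_map θ x (a, t)⟩)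
        · exact Or.inr (Or.inr ⟨rfl, g.ev_map θ x q⟩))
    (Or.inl ⟨rfl, rfl⟩)
    (by
      rintro n k ρ z e (⟨rfl, rfl⟩ | ⟨x, q, t, rfl, h⟩)
      · exact Or.inl ⟨perm_pt _ ρ k, perm_pt _ ρ k⟩
      · refine Or.inr ⟨_, q, t, rfl, ?_⟩
        obtain ⟨y, rfl, rfl⟩ | ⟨c, a, rfl, rfl⟩ | ⟨rfl, rfl⟩ := h
        · exact Or.inl ⟨_, ap_perm i ρ y, G.ev_perm ρ y (q, t)⟩
        · exact Or.inr (Or.inl ⟨c, a, rfl, (H c).ev_perm ρ x (a, t)⟩)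
        · exact Or.inr (Or.inr ⟨rfl, g.ev_perm ρ x q⟩))
    (by
      rintro n k z e b (⟨rfl, rfl⟩ | ⟨x, q, t, rfl, h⟩)
      · exact Or.inl ⟨σ_pt_left _ b, σ_pt_left _ b⟩
      · refine Or.inr ⟨_, q, t, rfl, ?_⟩
        obtain ⟨y, rfl, rfl⟩ | ⟨c, a, rfl, rfl⟩ | ⟨rfl, rfl⟩ := h
        · exact Or.inl ⟨_, ap_σ i y b, G.ev_σ y b (q, t)⟩
        · exact Or.inr (Or.inl ⟨c, a, rfl, (H c).ev_σ x b (a, t)⟩)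
        · exact Or.inr (Or.inr ⟨rfl, g.ev_σ x b q⟩))
    (by
      rintro n k z e e' (⟨rfl, rfl⟩ | ⟨x, q, t, rfl, h⟩) (⟨h', rfl⟩ | ⟨x', q', t', h', h''⟩)
      · rfl
      · obtain rfl := (halfMk_eq_pt_iff x' _).1 h'.symm
        exact (R_pt h'').symm
      · obtain rfl := (halfMk_eq_pt_iff x _).1 h'
        exact R_pt h
      · obtain ⟨rfl, hq⟩ | ⟨rfl, rfl⟩ :=
          (halfMk_eq_iff (K := Q ⊗ delta1) x x' (q, t) (q', t')).1 h'
        · obtain ⟨rfl, rfl⟩ := Prod.mk.inj hq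
          exact R_fun h h''
        · exact (R_pt h).trans (R_pt h'').symm)
    D D_zero
    (by
      rintro n k z s e (⟨rfl, rfl⟩ | ⟨x, q, t, rfl, h⟩)
      · exact ⟨_, Or.inl ⟨rfl, rfl⟩⟩
      · obtain ⟨y, rfl, rfl⟩ | ⟨c, a, rfl, rfl⟩ | ⟨rfl, rfl⟩ := h
        · exact ⟨_, Or.inr ⟨_, _, _, rfl, Or.inl ⟨y, rfl, rfl⟩⟩⟩
        · exact ⟨_, Or.inr ⟨_, _, _, rfl, Or.inr (Or.inl ⟨c, a, rfl, rfl⟩)⟩⟩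
        · exact ⟨_, Or.inr ⟨_, _, _, rfl, Or.inr (Or.inr ⟨one_sup1 s, rfl⟩)⟩⟩)
    (fun n k (z : (PSSet.smash (X'.level n) (plus (Q ⊗ delta1))).obj k) => by
      induction z using half_ind with
      | hpt => exact ⟨_, Or.inl ⟨rfl, rfl⟩⟩
      | h x a =>
        exact ⟨_, Or.inr ⟨x, a.1, sup1 a.2 _, rfl, Or.inr (Or.inr ⟨sup1_one a.2, rfl⟩)⟩⟩)
  exact ⟨.ofHalf F, fun x q t => hF (Or.inr ⟨_, _, _, rfl, Or.inl ⟨x, rfl, rfl⟩⟩),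
    fun {c n k} a x t => hF (Or.inr ⟨_, _, _, rfl, Or.inr (Or.inl ⟨c, a, rfl, rfl⟩)⟩),
    fun x q => hF (Or.inr ⟨_, _, _, rfl, Or.inr (Or.inr ⟨rfl, rfl⟩)⟩)⟩

end SymSpectrum

namespace SymSpectrum

/-! ### Mapping spaces -/

/-- A simplex of the mapping space: a map `X ∧ Δ[k]₊ ⟶ E`. -/
@[ext]
structure MapObj (X E : SymSpectrum.{u}) (k : SimplexCategoryᵒᵖ) : Type u where
  toFun : ∀ (n : ℕ) (l : SimplexCategoryᵒᵖ) (_ : k ⟶ l), (X.level n).obj l → (E.level n).obj l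
  nat : ∀ {n : ℕ} {l m : SimplexCategoryᵒᵖ} (θ : k ⟶ l) (θ' : l ⟶ m) (x : (X.level n).obj l),
    toFun n m (θ ≫ θ') ((X.level n).map θ' x) = (E.level n).map θ' (toFun n l θ x)
  pt : ∀ {n : ℕ} {l : SimplexCategoryᵒᵖ} (θ : k ⟶ l),
    toFun n l θ ((X.level n).pt l) = (E.level n).pt l
  perm : ∀ {n : ℕ} {l : SimplexCategoryᵒᵖ} (θ : k ⟶ l) (ρ : Equiv.Perm (Fin n))
    (x : (X.level n).obj l), toFun n l θ (X.perm ρ x) = E.perm ρ (toFun n l θ x)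
  σ : ∀ {n : ℕ} {l : SimplexCategoryᵒᵖ} (θ : k ⟶ l) (x : (X.level n).obj l)
    (b : PSSet.circle.{u}.obj l), toFun (n + 1) l θ (X.σ x b) = E.σ (toFun n l θ x) b

/-- The mapping space of symmetric spectra. -/
def mapSp (X E : SymSpectrum.{u}) : SSet.{u} where
  obj k := MapObj X E k
  map θ := ↾fun v => ⟨fun n l θ' x => v.toFun n l (θ ≫ θ') x, fun θ' θ'' x => by
    rw [← Category.assoc]; exact v.nat _ _ _, fun _ => v.pt _, fun _ => v.perm _, fun _ => v.σ _⟩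
  map_id k := by
    ext v : 3
    exact MapObj.ext (funext fun n => funext₃ fun l θ x =>
      congrArg (v.toFun n l · x) (Category.id_comp θ))
  map_comp θ θ' := by
    ext v : 3
    exact MapObj.ext (funext fun n => funext₃ fun l θ'' x =>
      congrArg (v.toFun n l · x) (Category.assoc _ _ _))

/-- Evaluation of simplices of the mapping space. -/
def mapEval {X E : SymSpectrum.{u}} {k} (v : (mapSp X E).obj k) {n} (x : (X.level n).obj k) :
    (E.level n).obj k :=
  MapObj.toFun v n k (𝟙 k) x

lemma mapEval_map {X E : SymSpectrum.{u}} {k l} (θ : k ⟶ l) (v : (mapSp X E).obj k) {n}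
    (x : (X.level n).obj l) : mapEval ((mapSp X E).map θ v) x = MapObj.toFun v n l θ x :=
  congrArg (MapObj.toFun v n l · x) (Category.comp_id θ)

lemma map_mapEval {X E : SymSpectrum.{u}} {k l} (θ : k ⟶ l) (v : (mapSp X E).obj k) {n}
    (x : (X.level n).obj k) :
    mapEval ((mapSp X E).map θ v) ((X.level n).map θ x) = (E.level n).map θ (mapEval v x) := by
  rw [mapEval_map]
  refine Eq.trans ?_ (MapObj.nat v (𝟙 k) θ x)
  exact congrArg (MapObj.toFun v n l · ((X.level n).map θ x)) (Category.id_comp θ).symm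

lemma map_hom_ext {X E : SymSpectrum.{u}} {Q : SSet.{u}} {f g : Q ⟶ mapSp X E}
    (h : ∀ n k (q : Q.obj k) (x : (X.level n).obj k), mapEval (f.app k q) x =
      mapEval (g.app k q) x) : f = g :=
  hom_ext_app fun k q => MapObj.ext (funext fun n => funext₃ fun l θ x => by
    refine (mapEval_map θ (f.app k q) x).symm.trans (Eq.trans ?_ (mapEval_map θ (g.app k q) x))
    rw [← SSet.app_map, ← SSet.app_map]
    exact h _ _ _ _)

/-- The parametrised map adjoint to a map to the mapping space. -/
def uncurry {X E : SymSpectrum.{u}} {Q : SSet.{u}} (f : Q ⟶ mapSp X E) : ParamHom X Q E where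
  ev x q := mapEval (f.app _ q) x
  ev_map θ x q := by rw [SSet.app_map, map_mapEval]
  ev_pt q := MapObj.pt (f.app _ q) _
  ev_perm ρ x q := MapObj.perm (f.app _ q) _ ρ x
  ev_σ x b q := MapObj.σ (f.app _ q) _ x b

/-- The map to the mapping space adjoint to a parametrised map. -/
def ParamHom.curry {X E : SymSpectrum.{u}} {Q : SSet.{u}} (F : ParamHom X Q E) :
    Q ⟶ mapSp X E :=
  SSet.ofFun (fun k q => (⟨fun n l θ x => F.ev x (Q.map θ q), fun θ θ' x => by
      rw [map_comp_app, F.ev_map], fun _ => F.ev_pt _, fun _ ρ x => F.ev_perm ρ x _,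
      fun _ x b => F.ev_σ x b _⟩ : MapObj X E k))
    (fun θ q => MapObj.ext (funext fun n => funext₃ fun l θ' x =>
      congrArg (F.ev x) (map_comp_app Q θ θ' q).symm))

@[simp] lemma ParamHom.mapEval_curry {X E : SymSpectrum.{u}} {Q : SSet.{u}} (F : ParamHom X Q E)
    {n k} (q : Q.obj k) (x : (X.level n).obj k) : mapEval (F.curry.app k q) x = F.ev x q :=
  congrArg (F.ev x) (map_id_app Q q)

/-- The restriction map of mapping spaces. -/
def mapPre {X X' : SymSpectrum.{u}} (i : X ⟶ X') (E : SymSpectrum.{u}) :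
    mapSp X' E ⟶ mapSp X E := ((uncurry (𝟙 _)).pull i (𝟙 _)).curry

@[simp] lemma mapEval_mapPre {X X' : SymSpectrum.{u}} (i : X ⟶ X') (E : SymSpectrum.{u}) {n k}
    (v : (mapSp X' E).obj k) (x : (X.level n).obj k) :
    mapEval ((mapPre i E).app k v) x = mapEval v (ap i x) := ParamHom.mapEval_curry _ _ _

lemma IsInjective.hepLift {E : SymSpectrum.{u}} (hE : IsInjective E) {X X' : SymSpectrum.{u}}
    {i : X ⟶ X'} (hi : IsMono i) : HepLift (mapPre i E) := by
  intro ι Q A j H g G hHH hHG hHg hgG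
  obtain ⟨F, hF, hF', hF''⟩ := hE.hep hi A j (fun c => uncurry (H c)) (uncurry g) (uncurry G)
    (fun {_ _ _ _ _} h {_} x t => congrArg (mapEval · x) (hHH _ _ _ _ _ h t))
    (fun {c n k} a x t => (mapEval_mapPre i E _ x).symm.trans
      (congrArg (mapEval · x) (hHG c k a t)))
    (fun {c n k} a x => congrArg (mapEval · x) (hHg c k a))
    (fun {n k} x q => (mapEval_mapPre i E _ x).symm.trans (congrArg (mapEval · x) (hgG k q)))
  have e1 : F.curry ≫ mapPre i E = G := map_hom_ext fun n k q x =>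
    (mapEval_mapPre i E _ x).trans ((F.mapEval_curry q _).trans (hF x q.1 q.2))
  have e2 (c : ι) : (j c ▷ delta1) ≫ F.curry = H c := map_hom_ext fun n k q x =>
    (F.mapEval_curry _ x).trans (hF' q.1 x q.2)
  have e3 : ι₁ ≫ F.curry = g := map_hom_ext fun n k q x => (F.mapEval_curry _ x).trans (hF'' x q)
  exact ⟨F.curry, fun k q t => congr_app e1 k (q, t), fun c k a t => congr_app (e2 c) k (a, t),
    fun k q => congr_app e3 k q⟩

lemma isMono_zeroHom (X : SymSpectrum.{u}) : IsMono (zeroHom zero X) :=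
  fun _ _ _ _ _ => zero_ext _ _

lemma IsInjective.hepFibrant {E : SymSpectrum.{u}} (hE : IsInjective E) (X : SymSpectrum.{u}) :
    HepFibrant (mapSp X E) := by
  intro ι Q A j H g G hHH _ hHg _
  have eqz {k} (v w : (mapSp zero E).obj k) : v = w :=
    MapObj.ext (funext fun n => funext₃ fun l θ x => by
      obtain rfl := zero_ext x (PSSet.pt _ l)
      exact (MapObj.pt v θ).trans (MapObj.pt w θ).symm)
  obtain ⟨F, -, hF, hF'⟩ := hE.hepLift (isMono_zeroHom X) ι Q A j H g
    (ParamHom.curry (ParamHom.const (zeroHom zero E) _)) hHH (fun _ _ _ _ => eqz _ _) hHg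
    (fun _ _ => eqz _ _)
  exact ⟨F, fun _ _ _ => rfl, hF, hF'⟩

/-- A homotopy of maps to the mapping space as a parametrised map. -/
lemma homotopic_curry {X E : SymSpectrum.{u}} {P : SSet.{u}} {f g : ParamHom X P E}
    (F : ParamHom X (P ⊗ delta1) E)
    (h0 : ∀ {n k} (x : (X.level n).obj k) p, F.ev x (p, vertex 0 k) = f.ev x p)
    (h1 : ∀ {n k} (x : (X.level n).obj k) p, F.ev x (p, vertex 1 k) = g.ev x p) :
    Homotopic f.curry g.curry :=
  .of_comp F.curry
    (map_hom_ext fun _ _ p x => (F.mapEval_curry _ x).trans ((h0 x p).trans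
      (f.mapEval_curry p x).symm))
    (map_hom_ext fun _ _ p x => (F.mapEval_curry _ x).trans ((h1 x p).trans
      (g.mapEval_curry p x).symm))

lemma exists_param_of_homotopic_curry {X E : SymSpectrum.{u}} {P : SSet.{u}} {f g : ParamHom X P E}
    (h : Homotopic f.curry g.curry) : ∃ F : ParamHom X (P ⊗ delta1) E,
      (∀ {n k} (x : (X.level n).obj k) p, F.ev x (p, vertex 0 k) = f.ev x p) ∧
      ∀ {n k} (x : (X.level n).obj k) p, F.ev x (p, vertex 1 k) = g.ev x p := by
  obtain ⟨h, h0, h1⟩ := h.exists_map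
  exact ⟨uncurry h, fun x p => (congrArg (mapEval · x) (h0 _ p)).trans (f.mapEval_curry p x),
    fun x p => (congrArg (mapEval · x) (h1 _ p)).trans (g.mapEval_curry p x)⟩

lemma htpc_iff {X E : SymSpectrum.{u}} (f g : X ⟶ E) :
    Htpc f g ↔ Homotopic (ParamHom.const f (𝟙_ SSet.{u})).curry
      (ParamHom.const g (𝟙_ SSet.{u})).curry := by
  constructor
  · intro h
    obtain ⟨F, h0, h1⟩ := h.exists_param
    exact homotopic_curry (F.pull (𝟙 X) (SSet.ofFun (fun _ p => p.2) (fun _ _ => rfl)))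
      (fun x _ => h0 x) (fun x _ => h1 x)
  · intro h
    obtain ⟨F, h0, h1⟩ := exists_param_of_homotopic_curry h
    exact .of (F.pull (𝟙 X) (SSet.ofFun (X := delta1) (Y := 𝟙_ SSet.{u} ⊗ delta1)
      (fun _ p => (PUnit.unit, p)) (fun _ _ => rfl))) (fun x => h0 x PUnit.unit)
      (fun x => h1 x PUnit.unit)

lemma IsInjective.htpc_symm {X E : SymSpectrum.{u}} (hE : IsInjective E) {f g : X ⟶ E}
    (h : Htpc f g) : Htpc g f := by
  rw [htpc_iff] at *
  exact (hE.hepFibrant X).homotopic_symm h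

lemma IsInjective.htpc_trans {X E : SymSpectrum.{u}} (hE : IsInjective E) {f g e : X ⟶ E}
    (h : Htpc f g) (h' : Htpc g e) : Htpc f e := by
  rw [htpc_iff] at *
  exact (hE.hepFibrant X).homotopic_trans h h'

lemma IsInjective.quot_mk_eq_iff {X E : SymSpectrum.{u}} (hE : IsInjective E) (f g : X ⟶ E) :
    (Quot.mk _ f : HomotopyClasses X E) = Quot.mk _ g ↔ Htpc f g := by
  refine ⟨fun h => ?_, fun h => Quot.sound h⟩
  have := Quot.eqvGen_exact h
  clear h
  induction this with
  | rel _ _ h => exact h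
  | refl => exact htpc_refl _
  | symm _ _ _ ih => exact hE.htpc_symm ih
  | trans _ _ _ _ _ ih ih' => exact hE.htpc_trans ih ih'

lemma isStableEquiv_iff {X Y : SymSpectrum.{u}} (f : X ⟶ Y) : IsStableEquiv f ↔
    ∀ E : SymSpectrum.{u}, IsInjective E → IsOmegaSpectrum E →
      (∀ g g' : Y ⟶ E, Htpc (f ≫ g) (f ≫ g') → Htpc g g') ∧
        ∀ h : X ⟶ E, ∃ g : Y ⟶ E, Htpc (f ≫ g) h := by
  refine forall₃_congr fun E hE _ => and_congr ⟨fun h g g' e => ?_, fun h => ?_⟩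
    ⟨fun h k => ?_, fun h => ?_⟩
  · exact (hE.quot_mk_eq_iff _ _).1 (@h (Quot.mk _ g) (Quot.mk _ g')
      ((hE.quot_mk_eq_iff _ _).2 e))
  · rintro ⟨g⟩ ⟨g'⟩ e
    exact (hE.quot_mk_eq_iff _ _).2 (h g g' ((hE.quot_mk_eq_iff _ _).1 e))
  · obtain ⟨⟨g⟩, hg⟩ := h (Quot.mk _ k)
    exact ⟨g, (hE.quot_mk_eq_iff _ _).1 hg⟩
  · rintro ⟨k⟩
    obtain ⟨g, hg⟩ := h k
    exact ⟨Quot.mk _ g, (hE.quot_mk_eq_iff _ _).2 hg⟩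

/-! ### Cotensors -/

/-- The cotensor `E ^ K` of a symmetric spectrum with a simplicial set. -/
def cotensor (K : SSet.{u}) (E : SymSpectrum.{u}) : SymSpectrum.{u} :=
  ofFun (fun n => fnP K (E.level n))
    (fun _ ρ k v => (⟨fun l θ x => E.perm ρ (FnObj.toFun v l θ x), fun θ θ' x =>
      (congrArg (E.perm ρ) (FnObj.nat v θ θ' x)).trans (map_perm _ ρ θ' _)⟩ : FnObj K _ k))
    (fun n k v b => PSSet.app (fnStr K (E.str n)) k (smashMk v b))
    (fun _ _ _ _ _ _ => rfl)
    (fun _ ρ k => FnObj.ext (funext₃ fun l _ _ => perm_pt _ ρ l))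
    (fun _ k v => FnObj.ext (funext₃ fun l θ x => perm_one _ l _))
    (fun _ ρ ρ' k v => FnObj.ext (funext₃ fun l θ x => perm_mul _ ρ ρ' l _))
    (fun n _ _ θ v b => PSSet.app_map (fnStr K (E.str n)) θ (smashMk v b))
    (fun n k b => by rw [smashMk_pt_left, PSSet.app_pt])
    (fun n k v => by rw [smashMk_pt_right, PSSet.app_pt])
    (fun _ ρ k v b => FnObj.ext (funext₃ fun l θ x => perm_σ E ρ _ _))
    (fun _ k v a b => FnObj.ext (funext₃ fun l θ x => σ_σ E _ _ _))

lemma IsOmegaSpectrum.cotensor (K : SSet.{u}) {E : SymSpectrum.{u}} (hE : IsOmegaSpectrum E) :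
    IsOmegaSpectrum (cotensor K E) := fun n => by
  refine ⟨kanComplex_fn K (hE n).1, ?_⟩
  have e : (SymSpectrum.cotensor K E).str n = fnStr K (E.str n) :=
    PSSet.hom_ext fun k => smash_ind fun v b => rfl
  rw [e]
  exact isWeakEquiv_toLoop_fnStr K (E.str n) (hE n).1 (hE (n + 1)).1 (hE n).2

/-- The map `X ∧ Q₊ ⟶ E ^ K` adjoint to a parametrised map. -/
def ParamHom.toCotensorParam {X E : SymSpectrum.{u}} {K Q : SSet.{u}}
    (F : ParamHom X (K ⊗ Q) E) : ParamHom X Q (cotensor K E) where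
  ev {n k} x q := (⟨fun _ θ a => F.ev ((X.level n).map θ x) (a, Q.map θ q), fun {_ m} θ θ' a =>
      (congrArg₂ (fun y r => F.ev (k := m) y ((K.map θ' a, r) : K.obj m × Q.obj m))
        (PSSet.map_comp _ θ θ' x) (map_comp_app Q θ θ' q)).trans
        (F.ev_map θ' ((X.level n).map θ x) (a, Q.map θ q))⟩ : FnObj K _ k)
  ev_map θ x q := FnObj.ext (funext₃ fun m θ' a =>
    congrArg₂ (fun y r => F.ev (k := m) y ((a, r) : K.obj m × Q.obj m))
      (PSSet.map_comp _ θ θ' x).symm (map_comp_app Q θ θ' q).symm)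
  ev_pt q := FnObj.ext (funext₃ fun m θ a =>
    (congrArg (fun y => F.ev (k := m) y ((a, Q.map θ q) : K.obj m × Q.obj m))
      (PSSet.map_pt _ θ)).trans (F.ev_pt _))
  ev_perm ρ x q := FnObj.ext (funext₃ fun m θ a =>
    (congrArg (fun y => F.ev (k := m) y ((a, Q.map θ q) : K.obj m × Q.obj m))
      (map_perm _ ρ θ x).symm).trans (F.ev_perm ρ _ _))
  ev_σ x b q := FnObj.ext (funext₃ fun m θ a =>
    (congrArg (fun y => F.ev (k := m) y ((a, Q.map θ q) : K.obj m × Q.obj m))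
      (map_σ _ θ x b).symm).trans (F.ev_σ _ _ _))

lemma ParamHom.fnEval_toCotensorParam {X E : SymSpectrum.{u}} {K Q : SSet.{u}}
    (F : ParamHom X (K ⊗ Q) E) {n k} (x : (X.level n).obj k) (q : Q.obj k) (a : K.obj k) :
    fnEval (Z := (E.level n).toSSet) (F.toCotensorParam.ev x q) a = F.ev x (a, q) :=
  congrArg₂ (fun y r => F.ev (k := k) y ((a, r) : K.obj k × Q.obj k))
    (PSSet.map_id _ x) (map_id_app Q q)

/-- The map `X ⟶ E ^ K` adjoint to a parametrised map. -/
def ParamHom.toCotensor {X E : SymSpectrum.{u}} {K : SSet.{u}} (F : ParamHom X K E) :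
    X ⟶ cotensor K E :=
  (F.pull (𝟙 X) (SSet.ofFun (X := K ⊗ 𝟙_ SSet.{u}) (Y := K) (fun _ p => p.1)
    (fun _ _ => rfl))).toCotensorParam.fiber (fun _ => PUnit.unit) (fun _ => rfl)

/-- The parametrised map adjoint to a map to a cotensor, with further parameters. -/
def ParamHom.ofCotensor {X E : SymSpectrum.{u}} {K Q : SSet.{u}} (F : ParamHom X Q (cotensor K E)) :
    ParamHom X (K ⊗ Q) E where
  ev {n k} x q := fnEval (Z := (E.level n).toSSet) (F.ev x q.2) q.1
  ev_map {n k l} θ x q := by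
    refine Eq.trans ?_ (map_fnEval (Z := (E.level n).toSSet) θ (F.ev x q.2) q.1)
    exact congrArg (fnEval (Z := (E.level n).toSSet) · (K.map θ q.1)) (F.ev_map θ x q.2)
  ev_pt {n k} q := congrArg (fnEval (Z := (E.level n).toSSet) · q.1) (F.ev_pt q.2)
  ev_perm {n k} ρ x q := congrArg (fnEval (Z := (E.level n).toSSet) · q.1) (F.ev_perm ρ x q.2)
  ev_σ {n k} x b q := (congrArg (fnEval (Z := (E.level (n + 1)).toSSet) · q.1)
    (F.ev_σ x b q.2)).trans (fnEval_fnStr K (E.str n) (F.ev x q.2) b q.1)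

/-- The parametrised map adjoint to a map to a cotensor. -/
def ofCotensor {X E : SymSpectrum.{u}} {K : SSet.{u}} (f : X ⟶ cotensor K E) : ParamHom X K E :=
  ((ParamHom.const f (𝟙_ SSet.{u})).ofCotensor).pull (𝟙 X)
    (SSet.ofFun (X := K) (Y := K ⊗ 𝟙_ SSet.{u}) (fun _ a => (a, PUnit.unit)) (fun _ _ => rfl))

lemma ParamHom.fnEval_toCotensor {X E : SymSpectrum.{u}} {K : SSet.{u}} (F : ParamHom X K E) {n k}
    (x : (X.level n).obj k) (a : K.obj k) :
    fnEval (Z := (E.level n).toSSet) (ap F.toCotensor x) a = F.ev x a :=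
  ParamHom.fnEval_toCotensorParam (Q := 𝟙_ SSet.{u})
    (F.pull (𝟙 X) (SSet.ofFun (X := K ⊗ 𝟙_ SSet.{u}) (Y := K) (fun _ p => p.1)
      (fun _ _ => rfl))) x PUnit.unit a

lemma cotensor_hom_ext {X E : SymSpectrum.{u}} {K : SSet.{u}} {f g : X ⟶ cotensor K E}
    (h : ∀ n k (x : (X.level n).obj k) a, fnEval (Z := (E.level n).toSSet) (ap f x) a =
      fnEval (Z := (E.level n).toSSet) (ap g x) a) : f = g :=
  hom_ext_ap fun n k x => fn_ext (Z := (E.level n).toSSet) fun l θ a => by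
    have nat (f : X ⟶ cotensor K E) : (fn K (E.level n).toSSet).map θ (ap f x) =
      ap f ((X.level n).map θ x) := (ap_map f θ x).symm
    rw [nat f, nat g]
    exact h _ _ _ _

/-- Functoriality of `X ∧ K` in `X`. -/
def smashHom {X Y : SymSpectrum.{u}} (i : X ⟶ Y) (K : PSSet.{u}) : X.smash K ⟶ Y.smash K where
  app n := PSSet.smashMap (i.app n) K
  app_perm _ ρ _ := smash_ind fun x a => congrArg (smashMk · a) (ap_perm i ρ x)
  app_σ _ _ z b := by
    induction z using smash_ind with
    | h x a => exact congrArg (smashMk · a) (ap_σ i x b)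

lemma IsInjective.cotensor (K : SSet.{u}) {E : SymSpectrum.{u}} (hE : IsInjective E) :
    IsInjective (cotensor K E) := by
  intro A B i hi hw f
  obtain ⟨g, hg⟩ := hE _ _ (smashHom i (plus K))
    (fun n k z z' => by
      intro h
      induction z using half_ind with
      | hpt =>
        induction z' using half_ind with
        | hpt => rfl
        | h x a =>
          have h' : halfMk (PSSet.app (i.app n) k x) a = PSSet.pt _ k :=
            h.symm.trans (PSSet.app_pt (PSSet.smashMap (i.app n) (plus K)) k)
          have := (halfMk_eq_pt_iff _ _).1 h'
          obtain rfl : x = PSSet.pt _ k := hi n k (this.trans (PSSet.app_pt (i.app n) k).symm)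
          exact (halfMk_pt a).symm
      | h x a =>
        induction z' using half_ind with
        | hpt =>
          have h' : halfMk (PSSet.app (i.app n) k x) a = PSSet.pt _ k :=
            h.trans (PSSet.app_pt (PSSet.smashMap (i.app n) (plus K)) k)
          have := (halfMk_eq_pt_iff _ _).1 h'
          obtain rfl : x = PSSet.pt _ k := hi n k (this.trans (PSSet.app_pt (i.app n) k).symm)
          exact halfMk_pt a
        | h x' a' =>
          refine (halfMk_eq_iff _ _ _ _).2 (((halfMk_eq_iff _ _ _ _).1 h).imp
            (And.imp_left fun e => hi n k e) (And.imp (fun e => hi n k ?_) fun e => hi n k ?_))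
          · exact e.trans (PSSet.app_pt (i.app n) k).symm
          · exact e.trans (PSSet.app_pt (i.app n) k).symm)
    (fun n => isWeakEquiv_smashMap_plus (i.app n) (hi n) (hw n) K) (ofCotensor f).toHalf
  refine ⟨(ParamHom.ofHalf g).toCotensor, cotensor_hom_ext fun n k x a => ?_⟩
  refine (ParamHom.fnEval_toCotensor _ (ap i x) a).trans ?_
  exact congrArg (fun e => ap e (halfSmash x a)) hg

/-! ### Trivial fibrations of mapping spaces -/

lemma IsStableEquiv.monoLift {X X' : SymSpectrum.{u}} {i : X ⟶ X'} (hs : IsStableEquiv i)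
    (hi : IsMono i) {E : SymSpectrum.{u}} (hE : IsInjective E) (hE' : IsOmegaSpectrum E) :
    MonoLift (mapPre i E) := by
  rw [isStableEquiv_iff] at hs
  have cur {Y : SymSpectrum.{u}} {P : SSet.{u}} {f g : Y ⟶ cotensor P E} (h : Htpc f g) :
      Homotopic (ofCotensor f).curry (ofCotensor g).curry := by
    obtain ⟨F, h0, h1⟩ := h.exists_param
    exact homotopic_curry F.ofCotensor
      (fun {n k} x p => congrArg (fnEval (Z := (E.level n).toSSet) · p) (h0 x))
      (fun {n k} x p => congrArg (fnEval (Z := (E.level n).toSSet) · p) (h1 x))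
  have cot {Y : SymSpectrum.{u}} {P : SSet.{u}} (f : P ⟶ mapSp Y E) :
      (ofCotensor (uncurry f).toCotensor).curry = f := map_hom_ext fun n k p x =>
    (ParamHom.mapEval_curry _ _ _).trans (ParamHom.fnEval_toCotensor (uncurry f) x p)
  have pre {P : SSet.{u}} (f : P ⟶ mapSp X' E) :
      (uncurry (f ≫ mapPre i E)).toCotensor = i ≫ (uncurry f).toCotensor :=
    cotensor_hom_ext fun n k x a =>
      (ParamHom.fnEval_toCotensor (uncurry (f ≫ mapPre i E)) x a).trans
      ((mapEval_mapPre i E _ x).trans (ParamHom.fnEval_toCotensor (uncurry f) (ap i x) a).symm)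
  refine (hE.hepLift hi).monoLift (fun P f => ?_) (fun P f f' h => ?_)
  · obtain ⟨g, hg⟩ := (hs _ (hE.cotensor P) (hE'.cotensor P)).2 (uncurry f).toCotensor
    refine ⟨(ofCotensor g).curry, (hE.hepFibrant X).homotopic_symm ?_⟩
    have := cur hg
    rw [cot] at this
    have e : (ofCotensor (i ≫ g)).curry = (ofCotensor g).curry ≫ mapPre i E :=
      map_hom_ext fun n k p x => (ParamHom.mapEval_curry _ _ _).trans
        ((mapEval_mapPre i E _ x).trans ((ofCotensor g).mapEval_curry p (ap i x))).symm
    rwa [e] at this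
  · have hh : Htpc (i ≫ (uncurry f).toCotensor) (i ≫ (uncurry f').toCotensor) := by
      obtain ⟨h, h0, h1⟩ := h.exists_map
      rw [← pre, ← pre]
      have key (v : ∀ k, delta1.{u}.obj k) (hv : ∀ {k l} (θ : k ⟶ l), delta1.map θ (v k) = v l)
          (g : P ⟶ mapSp X E) (e : ∀ k p, h.app k (p, v k) = g.app k p) :
          (uncurry h).toCotensorParam.fiber v hv = (uncurry g).toCotensor :=
        cotensor_hom_ext fun n k x a =>
          (ParamHom.fnEval_toCotensorParam (uncurry h) x (v k) a).trans
            ((congrArg (mapEval · x) (e k a)).trans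
              (ParamHom.fnEval_toCotensor (uncurry g) x a).symm)
      exact .of (uncurry h).toCotensorParam
        (fun x => congrArg (ap · x) (key (vertex 0) (fun _ => rfl) _ h0))
        (fun x => congrArg (ap · x) (key (vertex 1) (fun _ => rfl) _ h1))
    have := cur ((hs _ (hE.cotensor P) (hE'.cotensor P)).1 _ _ hh)
    rwa [cot, cot] at this

end SymSpectrum

namespace PSSet

section cone

variable {X Y : PSSet.{u}} (f : X ⟶ Y) {k : SimplexCategoryᵒᵖ} {α : Type*}

/-- A function on the simplices of the mapping cone, in a fixed degree. -/
def coneLiftAt (φ : X.obj k → delta1.{u}.obj k → α) (ψ : Y.obj k → α)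
    (hpt : ∀ a, φ (X.pt k) a = ψ (Y.pt k)) (h0 : ∀ x, φ x (vertex 0 k) = ψ (Y.pt k))
    (h1 : ∀ x, φ x (vertex 1 k) = ψ (PSSet.app f k x)) : (cone f).obj k → α :=
  Quot.lift (Sum.elim (Quot.lift (fun p : X.obj k × interval.{u}.obj k => φ p.1 p.2) (by
      have key : ∀ p : X.obj k × interval.{u}.obj k, (p.1 = X.pt k ∨ p.2 = interval.pt k) →
          φ p.1 p.2 = ψ (Y.pt k) := by
        rintro p (h | h)
        · rw [h]
          exact hpt _
        · rw [h]
          exact h0 _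
      rintro p q ⟨h, h'⟩
      rw [key p h, key q h'])) ψ) (by
    rintro _ _ ⟨x, rfl, rfl⟩
    exact h1 x)

open Classical in
/-- Normal form of the simplices of the mapping cone. -/
noncomputable def coneNormal : (cone f).obj k → Y.obj k ⊕ (X.obj k × delta1.{u}.obj k) :=
  coneLiftAt f (fun x a => if x = X.pt k ∨ a = vertex 0 k then Sum.inl (Y.pt k) else
      if a = vertex 1 k then Sum.inl (PSSet.app f k x) else Sum.inr (x, a)) Sum.inl
    (fun a => if_pos (Or.inl rfl)) (fun x => if_pos (Or.inr rfl))
    (fun x => by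
      split_ifs with h h'
      · obtain rfl := h.resolve_right (fun e => vertex_ne e.symm)
        rw [PSSet.app_pt]
      · rfl
      · exact absurd rfl h')

lemma coneNormal_inl {x : X.obj k} {a : delta1.{u}.obj k} (hx : x ≠ X.pt k)
    (h0 : a ≠ vertex 0 k) (h1 : a ≠ vertex 1 k) : coneNormal f (coneInl f x a) = Sum.inr (x, a) := by
  refine (if_neg ?_).trans (if_neg h1)
  tauto

/-- Every simplex of the mapping cone is either in the image of the target or in the interior of
the cone. -/
lemma cone_cases {P : (cone f).obj k → Prop}
    (hl : ∀ x a, x ≠ X.pt k → a ≠ vertex 0 k → a ≠ vertex 1 k → P (coneInl f x a))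
    (hr : ∀ y, P (coneInr f y)) (z) : P z := by
  induction z using cone_ind with
  | hl x a =>
    by_cases hx : x = X.pt k
    · subst hx
      rw [coneInl_pt_left]
      exact hr _
    · by_cases h0 : a = vertex 0 k
      · subst h0
        have : coneInl f x (vertex 0 k) = (cone f).pt k := PSSet.coneInl_zero f x
        rw [this]
        exact hr _
      · by_cases h1 : a = vertex 1 k
        · subst h1
          have : coneInl f x (vertex 1 k) = coneInr f (PSSet.app f k x) := PSSet.coneInl_one f x
          rw [this]
          exact hr _
        · exact hl x a hx h0 h1
  | hr y => exact hr y

lemma coneInr_injective : Function.Injective (coneInr f (k := k)) := fun _ _ h =>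
  Sum.inl_injective (congrArg (coneNormal f) h)

lemma coneInl_ne_coneInr {x : X.obj k} {a : delta1.{u}.obj k} (hx : x ≠ X.pt k)
    (h0 : a ≠ vertex 0 k) (h1 : a ≠ vertex 1 k) (y : Y.obj k) : coneInl f x a ≠ coneInr f y := by
  intro h
  have := congrArg (coneNormal f) h
  rw [coneNormal_inl f hx h0 h1] at this
  exact Sum.inr_ne_inl this

lemma coneInl_inj {x x' : X.obj k} {a a' : delta1.{u}.obj k} (hx : x ≠ X.pt k)
    (h0 : a ≠ vertex 0 k) (h1 : a ≠ vertex 1 k) (hx' : x' ≠ X.pt k)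
    (h0' : a' ≠ vertex 0 k) (h1' : a' ≠ vertex 1 k) (h : coneInl f x a = coneInl f x' a') :
    x = x' ∧ a = a' := by
  have := congrArg (coneNormal f) h
  rw [coneNormal_inl f hx h0 h1, coneNormal_inl f hx' h0' h1'] at this
  exact Prod.mk.inj (Sum.inr_injective this)

end cone

end PSSet

namespace SymSpectrum

section cone

variable {X Y X' Y' E : SymSpectrum.{u}} {Q : SSet.{u}}

/-- The simplex of the mapping cone at height `a` over `x`. -/
def coneL (f : X ⟶ Y) {n k} (x : (X.level n).obj k) (a : delta1.{u}.obj k) :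
    ((cone f).level n).obj k := PSSet.coneInl (f.app n) x a

/-- The inclusion of the target in the mapping cone, on simplices. -/
def coneR (f : X ⟶ Y) {n k} (y : (Y.level n).obj k) : ((cone f).level n).obj k :=
  PSSet.coneInr (f.app n) y

lemma coneL_pt (f : X ⟶ Y) {n k} (a : delta1.{u}.obj k) :
    coneL f ((X.level n).pt k) a = ((cone f).level n).pt k := coneInl_pt_left _ a

lemma coneL_zero (f : X ⟶ Y) {n k} (x : (X.level n).obj k) :
    coneL f x (vertex 0 k) = ((cone f).level n).pt k := PSSet.coneInl_zero _ x

lemma coneL_one (f : X ⟶ Y) {n k} (x : (X.level n).obj k) :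
    coneL f x (vertex 1 k) = coneR f (ap f x) := PSSet.coneInl_one _ x

/-- The inclusion of the target in the mapping cone. -/
def inR (f : X ⟶ Y) : Y ⟶ cone f :=
  homOfFun (fun _ _ y => coneR f y) (fun _ _ _ _ _ => rfl) (fun _ _ => rfl)
    (fun _ _ _ _ => rfl) (fun _ _ _ _ => rfl)

/-- The homotopy of the composition `X ⟶ Y ⟶ cone f` to the trivial map. -/
def inL (f : X ⟶ Y) : ParamHom X delta1 (cone f) where
  ev x a := coneL f x a
  ev_map _ _ _ := rfl
  ev_pt a := coneL_pt f a
  ev_perm _ _ _ := rfl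
  ev_σ _ _ _ := rfl

/-- A parametrised map out of a mapping cone. -/
def coneDesc (f : X ⟶ Y) (F : ParamHom X (Q ⊗ delta1) E) (G : ParamHom Y Q E)
    (h0 : ∀ {n k} (x : (X.level n).obj k) q, F.ev x (q, vertex 0 k) = (E.level n).pt k)
    (h1 : ∀ {n k} (x : (X.level n).obj k) q, F.ev x (q, vertex 1 k) = G.ev (ap f x) q) :
    ParamHom (cone f) Q E where
  ev {n k} z q := coneLiftAt (f.app n) (fun x a => F.ev x (q, a)) (fun y => G.ev y q)
    (fun a => (F.ev_pt _).trans (G.ev_pt q).symm) (fun x => (h0 x q).trans (G.ev_pt q).symm)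
    (fun x => h1 x q) z
  ev_map θ z q := by
    induction z using cone_ind with
    | hl x a => exact F.ev_map θ x (q, a)
    | hr y => exact G.ev_map θ y q
  ev_pt q := G.ev_pt q
  ev_perm ρ z q := by
    induction z using cone_ind with
    | hl x a => exact F.ev_perm ρ x (q, a)
    | hr y => exact G.ev_perm ρ y q
  ev_σ z b q := by
    induction z using cone_ind with
    | hl x a => exact F.ev_σ x b (q, a)
    | hr y => exact G.ev_σ y b q

/-- The restriction of a parametrised map to the cone over the source. -/
def ParamHom.coneRes {f : X ⟶ Y} (F : ParamHom (cone f) Q E) : ParamHom X (Q ⊗ delta1) E where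
  ev x q := F.ev (coneL f x q.2) q.1
  ev_map θ x q := F.ev_map θ (coneL f x q.2) q.1
  ev_pt q := (congrArg (F.ev · q.1) (coneL_pt f q.2)).trans (F.ev_pt q.1)
  ev_perm ρ x q := F.ev_perm ρ (coneL f x q.2) q.1
  ev_σ x b q := F.ev_σ (coneL f x q.2) b q.1

/-- The parametrised map of mapping cones given by compatible parametrised maps. -/
def ParamHom.coneMap {f : X ⟶ Y} {f' : X' ⟶ Y'} (F : ParamHom X Q X') (G : ParamHom Y Q Y')
    (h : ∀ {n k} (x : (X.level n).obj k) q, ap f' (F.ev x q) = G.ev (ap f x) q) :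
    ParamHom (cone f) Q (cone f') :=
  coneDesc f
    { ev := fun x q => coneL f' (F.ev x q.1) q.2
      ev_map := fun θ x q => congrArg (coneL f' · _) (F.ev_map θ x q.1)
      ev_pt := fun q => (congrArg (coneL f' · _) (F.ev_pt q.1)).trans (coneL_pt f' _)
      ev_perm := fun ρ x q => congrArg (coneL f' · _) (F.ev_perm ρ x q.1)
      ev_σ := fun x b q => congrArg (coneL f' · _) (F.ev_σ x b q.1) }
    (G.post (inR f'))
    (fun _ _ => coneL_zero f' _)
    (fun x q => (coneL_one f' _).trans (congrArg (coneR f') (h x q)))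

/-- The contraction of the mapping cone of an identity. -/
def coneContraction (X : SymSpectrum.{u}) : ParamHom (cone (𝟙 X)) delta1 (cone (𝟙 X)) :=
  coneDesc (𝟙 X) ((inL (𝟙 X)).pull (𝟙 X) (SSet.ofFun (X := delta1 ⊗ delta1) (Y := delta1)
      (fun _ p => inf1 p.2 p.1) (fun _ _ => rfl))) (inL (𝟙 X))
    (fun x q => (congrArg (coneL (𝟙 X) x) (zero_inf1 q)).trans (coneL_zero _ x))
    (fun x q => congrArg (coneL (𝟙 X) x) (one_inf1 q))

lemma coneContraction_zero (X : SymSpectrum.{u}) {n k} (z : ((cone (𝟙 X)).level n).obj k) :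
    (coneContraction X).ev z (vertex 0 k) = ((cone (𝟙 X)).level n).pt k := by
  induction z using cone_ind with
  | hl x a => exact (congrArg (coneL (𝟙 X) x) (inf1_zero a)).trans (coneL_zero _ x)
  | hr y => exact coneL_zero _ y

lemma coneContraction_one (X : SymSpectrum.{u}) {n k} (z : ((cone (𝟙 X)).level n).obj k) :
    (coneContraction X).ev z (vertex 1 k) = z := by
  induction z using cone_ind with
  | hl x a => exact congrArg (coneL (𝟙 X) x) (inf1_one a)
  | hr y => exact coneL_one _ y

lemma coneContraction_natural (f : X ⟶ Y) {n k} (z : ((cone (𝟙 X)).level n).obj k)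
    (s : delta1.{u}.obj k) (w : f ≫ 𝟙 Y = 𝟙 X ≫ f) :
    ap (coneMap f f w) ((coneContraction X).ev z s) =
      (coneContraction Y).ev (ap (coneMap f f w) z) s := by
  induction z using cone_ind with
  | hl x a => rfl
  | hr y => rfl

lemma isMono_inR (f : X ⟶ Y) : IsMono (inR f) := fun n _ => coneInr_injective (f.app n)

lemma coneMap_id (f : X ⟶ Y) (w : 𝟙 X ≫ f = f ≫ 𝟙 Y) : coneMap (𝟙 X) (𝟙 Y) w = 𝟙 _ :=
  hom_ext_ap fun n k z => by
    induction z using cone_ind with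
    | hl x a => rfl
    | hr y => rfl

lemma coneMap_comp {X'' Y'' : SymSpectrum.{u}} {f : X ⟶ Y} {f' : X' ⟶ Y'} {f'' : X'' ⟶ Y''}
    (p : X ⟶ X') (q : Y ⟶ Y') (w : p ≫ f' = f ≫ q) (p' : X' ⟶ X'') (q' : Y' ⟶ Y'')
    (w' : p' ≫ f'' = f' ≫ q') (w'' : (p ≫ p') ≫ f'' = f ≫ q ≫ q') :
    coneMap p q w ≫ coneMap p' q' w' = coneMap (p ≫ p') (q ≫ q') w'' :=
  hom_ext_ap fun n k z => by
    induction z using cone_ind with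
    | hl x a => rfl
    | hr y => rfl

end cone

end SymSpectrum

namespace SymSpectrum

/-! ### Stable equivalences -/

lemma HomotopyClasses.precomp_comp {X Y Z : SymSpectrum.{u}} (f : X ⟶ Y) (g : Y ⟶ Z)
    (E : SymSpectrum.{u}) : HomotopyClasses.precomp (f ≫ g) E =
      HomotopyClasses.precomp f E ∘ HomotopyClasses.precomp g E := by
  funext z
  obtain ⟨h⟩ := z
  rfl

lemma IsStableEquiv.comp {X Y Z : SymSpectrum.{u}} {f : X ⟶ Y} {g : Y ⟶ Z}
    (hf : IsStableEquiv f) (hg : IsStableEquiv g) : IsStableEquiv (f ≫ g) := fun E h h' => by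
  rw [HomotopyClasses.precomp_comp]
  exact (hf E h h').comp (hg E h h')

lemma IsStableEquiv.of_comp_right {X Y Z : SymSpectrum.{u}} {f : X ⟶ Y} {g : Y ⟶ Z}
    (hg : IsStableEquiv g) (hfg : IsStableEquiv (f ≫ g)) : IsStableEquiv f := fun E h h' => by
  have := hfg E h h'
  rw [HomotopyClasses.precomp_comp] at this
  exact (Function.Bijective.of_comp_iff _ (hg E h h')).1 this

lemma isStableEquiv_of_homotopyInverse {X Y : SymSpectrum.{u}} (f : X ⟶ Y) (r : Y ⟶ X)
    (h : Htpc (f ≫ r) (𝟙 X)) (h' : Htpc (r ≫ f) (𝟙 Y)) : IsStableEquiv f := by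
  rw [isStableEquiv_iff]
  intro E hE _
  refine ⟨fun g g' e => ?_, fun k => ⟨r ≫ k, ?_⟩⟩
  · have e1 : Htpc (r ≫ f ≫ g) g := by simpa using h'.postcomp g
    have e2 : Htpc (r ≫ f ≫ g') g' := by simpa using h'.postcomp g'
    exact hE.htpc_trans (hE.htpc_symm e1) (hE.htpc_trans (e.precomp r) e2)
  · simpa using h.postcomp k

lemma isStableEquiv_id (X : SymSpectrum.{u}) : IsStableEquiv (𝟙 X) :=
  isStableEquiv_of_homotopyInverse _ (𝟙 X) (htpc_refl _) (htpc_refl _)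

/-- The right lifting property of the restriction map of mapping spaces against monomorphisms, in
terms of parametrised maps. -/
def ParamLift {X X' : SymSpectrum.{u}} (i : X ⟶ X') (E : SymSpectrum.{u}) : Prop :=
  ∀ (ι : Type) (Q : SSet.{u}) (A : ι → SSet.{u}) (j : ∀ c, A c ⟶ Q)
    (b : ∀ c, ParamHom X' (A c) E) (g : ParamHom X Q E),
    (∀ {c c' k a a'}, (j c).app k a = (j c').app k a' → ∀ {n} (x : (X'.level n).obj k),
      (b c).ev x a = (b c').ev x a') →
    (∀ {c n k} a (x : (X.level n).obj k), (b c).ev (ap i x) a = g.ev x ((j c).app k a)) →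
    ∃ F : ParamHom X' Q E, (∀ {n k} (x : (X.level n).obj k) q, F.ev (ap i x) q = g.ev x q) ∧
      ∀ {c n k} a (x : (X'.level n).obj k), F.ev x ((j c).app k a) = (b c).ev x a

lemma IsStableEquiv.paramLift {X X' : SymSpectrum.{u}} {i : X ⟶ X'} (hs : IsStableEquiv i)
    (hi : IsMono i) {E : SymSpectrum.{u}} (hE : IsInjective E) (hE' : IsOmegaSpectrum E) :
    ParamLift i E := by
  intro ι Q A j b g hb hg
  have e (c : ι) : (b c).curry ≫ mapPre i E = j c ≫ g.curry := map_hom_ext fun n k a x =>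
    (mapEval_mapPre i E _ x).trans (((b c).mapEval_curry a _).trans
      ((hg a x).trans (g.mapEval_curry _ x).symm))
  obtain ⟨F, hF, hF'⟩ := hs.monoLift hi hE hE' ι Q A j (fun c => (b c).curry) g.curry
    (fun c c' k a a' h => MapObj.ext (funext fun n => funext₃ fun l θ x => by
      refine hb ?_ x
      rw [SSet.app_map, SSet.app_map, h]))
    (fun c k a => congr_app (e c) k a)
  refine ⟨uncurry F, fun x q => ?_, fun a x => ?_⟩
  · exact (mapEval_mapPre i E _ x).symm.trans ((congrArg (mapEval · x) (hF _ q)).trans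
      (g.mapEval_curry q x))
  · exact (congrArg (mapEval · x) (hF' _ _ a)).trans ((b _).mapEval_curry a x)

lemma isStableEquiv_of_paramLift {X X' : SymSpectrum.{u}} {i : X ⟶ X'}
    (h : ∀ E : SymSpectrum.{u}, IsInjective E → IsOmegaSpectrum E → ParamLift i E) :
    IsStableEquiv i := by
  rw [isStableEquiv_iff]
  intro E hE hE'
  refine ⟨fun g g' e => ?_, fun f => ?_⟩
  · obtain ⟨F, h0, h1⟩ := e.exists_param
    obtain ⟨G, -, hG⟩ := h E hE hE' Bool delta1 (fun _ => 𝟙_ SSet.{u})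
      (fun b => SSet.ofFun (X := 𝟙_ SSet.{u}) (fun k _ => vertex (bif b then 1 else 0) k)
        (fun _ _ => rfl))
      (fun b => ParamHom.const (bif b then g' else g) _) F
      (by
        rintro (_ | _) (_ | _) k a a' h n x
        · rfl
        · exact absurd h vertex_ne
        · exact absurd h.symm vertex_ne
        · rfl)
      (by
        rintro (_ | _) n k a x
        · exact (h0 x).symm
        · exact (h1 x).symm)
    exact .of G (fun x => hG (c := false) PUnit.unit x) (fun x => hG (c := true) PUnit.unit x)
  · obtain ⟨G, hG, -⟩ := h E hE hE' Empty (𝟙_ SSet.{u}) (fun _ => 𝟙_ SSet.{u}) (fun e => e.elim)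
      (fun e => e.elim) (ParamHom.const f _) (fun {c} => c.elim) (fun {c} => c.elim)
    refine ⟨G.fiber (fun _ => PUnit.unit) (fun _ => rfl), ?_⟩
    convert htpc_refl f
    exact hom_ext_ap fun n k x => hG x _

lemma ParamLift.coneMap {X Y X' Y' : SymSpectrum.{u}} {f : X ⟶ Y} {f' : X' ⟶ Y'} {p : X ⟶ X'}
    {q : Y ⟶ Y'} (w : p ≫ f' = f ≫ q) {E : SymSpectrum.{u}} (hp : ParamLift p E)
    (hq : ParamLift q E) : ParamLift (SymSpectrum.coneMap p q w) E := by
  intro ι Q A j b g hb hg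
  obtain ⟨G, hG, hG'⟩ := hq ι Q A j (fun c => (b c).pull (inR f') (𝟙 _))
    (g.pull (inR f) (𝟙 _)) (fun {_ _ _ _ _} h {_} x => hb h _) (fun {c n k} a x => hg a (coneR f x))
  have hw {n k} (x : (X.level n).obj k) : ap f' (ap p x) = ap q (ap f x) :=
    congrArg (ap · x) w
  obtain ⟨F, hF, hF'⟩ := hp (Option (Option ι)) (Q ⊗ delta1)
    (fun o => o.elim Q (fun o => o.elim Q (fun c => A c ⊗ delta1)))
    (fun o => match o with
      | none => ι₀
      | some none => ι₁
      | some (some c) => j c ▷ delta1)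
    (fun o => match o with
      | none => ParamHom.const (zeroHom X' E) Q
      | some none => G.pull f' (𝟙 _)
      | some (some c) => (b c).coneRes)
    g.coneRes
    (by
      have b0 : ∀ c {n k} (x : (X'.level n).obj k) a,
          (b c).ev (coneL f' x (vertex 0 k)) a = (E.level n).pt k := fun c n k x a =>
        (congrArg ((b c).ev · a) (coneL_zero f' x)).trans ((b c).ev_pt a)
      have b1 : ∀ c {n k} (x : (X'.level n).obj k) a,
          (b c).ev (coneL f' x (vertex 1 k)) a = G.ev (ap f' x) ((j c).app k a) :=
        fun c n k x a => (congrArg ((b c).ev · a) (coneL_one f' x)).trans (hG' a _).symm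
      rintro (_ | _ | c) (_ | _ | c') k a a' h n x
      · rfl
      · exact absurd (Prod.mk.inj h).2 vertex_ne
      · obtain ⟨a', t⟩ := a'
        obtain rfl : vertex 0 k = t := (Prod.mk.inj h).2
        exact (b0 c' x a').symm
      · exact absurd (Prod.mk.inj h).2.symm vertex_ne
      · obtain rfl : a = a' := (Prod.mk.inj h).1
        rfl
      · obtain ⟨a', t⟩ := a'
        obtain rfl : vertex 1 k = t := (Prod.mk.inj h).2
        obtain rfl : a = (j c').app k a' := (Prod.mk.inj h).1
        exact (b1 c' x a').symm
      · obtain ⟨a, t⟩ := a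
        obtain rfl : t = vertex 0 k := (Prod.mk.inj h).2
        exact b0 c x a
      · obtain ⟨a, t⟩ := a
        obtain rfl : t = vertex 1 k := (Prod.mk.inj h).2
        obtain rfl : (j c).app k a = a' := (Prod.mk.inj h).1
        exact b1 c x a
      · obtain ⟨a, t⟩ := a
        obtain ⟨a', t'⟩ := a'
        obtain rfl : t = t' := (Prod.mk.inj h).2
        exact hb (Prod.mk.inj h).1 _)
    (by
      rintro (_ | _ | c) n k a x
      · exact ((congrArg (g.ev · a) (coneL_zero f x)).trans (g.ev_pt a)).symm
      · refine (congrArg (G.ev · a) (hw x)).trans ((hG (ap f x) a).trans ?_)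
        exact (congrArg (g.ev · a) (coneL_one f x)).symm
      · exact hg a.1 (coneL f x a.2))
  refine ⟨coneDesc f' F G (fun x q => hF' (c := none) q x) (fun x q => hF' (c := some none) q x),
    fun z q => ?_, fun {c} {n k} a z => ?_⟩
  · induction z using cone_ind with
    | hl x a => exact hF x (q, a)
    | hr y => exact hG y q
  · induction z using cone_ind with
    | hl x t => exact hF' (c := some (some c)) (a, t) x
    | hr y => exact hG' a y

/-! ### Products -/

/-- The first projection. -/
def fst (X Y : SymSpectrum.{u}) : prod X Y ⟶ X :=
  homOfFun (fun _ _ p => p.1) (fun _ _ _ _ _ => rfl) (fun _ _ => rfl) (fun _ _ _ _ => rfl)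
    (fun _ _ _ _ => rfl)

/-- The second projection. -/
def snd (X Y : SymSpectrum.{u}) : prod X Y ⟶ Y :=
  homOfFun (fun _ _ p => p.2) (fun _ _ _ _ _ => rfl) (fun _ _ => rfl) (fun _ _ _ _ => rfl)
    (fun _ _ _ _ => rfl)

/-- The contraction of `X × cone (𝟙 Y)` to `X`. -/
def prodContraction (X Y : SymSpectrum.{u}) :
    ParamHom (prod X (cone (𝟙 Y))) delta1 (prod X (cone (𝟙 Y))) where
  ev x s := (x.1, (coneContraction Y).ev x.2 s)
  ev_map θ x s := Prod.ext rfl ((coneContraction Y).ev_map θ x.2 s)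
  ev_pt s := Prod.ext rfl ((coneContraction Y).ev_pt s)
  ev_perm ρ x s := Prod.ext rfl ((coneContraction Y).ev_perm ρ x.2 s)
  ev_σ x b s := Prod.ext rfl ((coneContraction Y).ev_σ x.2 b s)

lemma isStableEquiv_fst (X Y : SymSpectrum.{u}) : IsStableEquiv (fst X (cone (𝟙 Y))) := by
  refine isStableEquiv_of_homotopyInverse _ (prodLift (𝟙 X) (zeroHom X _)) ?_ ?_
  · exact .of (prodContraction X Y) (fun x => Prod.ext rfl (coneContraction_zero Y x.2))
      (fun x => Prod.ext rfl (coneContraction_one Y x.2))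
  · exact htpc_refl _

/-- Mapping cones preserve stable equivalences. -/
lemma isStableEquiv_coneMap {X Y X' Y' : SymSpectrum.{u}} {f : X ⟶ Y} {f' : X' ⟶ Y'} {p : X ⟶ X'}
    {q : Y ⟶ Y'} (w : p ≫ f' = f ≫ q) (hp : IsStableEquiv p) (hq : IsStableEquiv q) :
    IsStableEquiv (coneMap p q w) := by
  let C := coneMap f f ((Category.comp_id f).trans (Category.id_comp f).symm)
  let m : prod X' (cone (𝟙 X)) ⟶ prod Y' (cone (𝟙 Y)) :=
    prodLift (fst _ _ ≫ f') (snd _ _ ≫ C)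
  have w1 : prodLift p (inR (𝟙 X)) ≫ m = f ≫ prodLift q (inR (𝟙 Y)) :=
    hom_ext_ap fun n k x => Prod.ext (congrArg (ap · x) w) rfl
  have w2 : fst X' (cone (𝟙 X)) ≫ f' = m ≫ fst Y' (cone (𝟙 Y)) := rfl
  have w3 : prodLift (𝟙 X') (zeroHom X' _) ≫ m = f' ≫ prodLift (𝟙 Y') (zeroHom Y' _) :=
    hom_ext_ap fun n k x => Prod.ext rfl (ap_pt C)
  have e : coneMap p q w = coneMap _ _ w1 ≫ coneMap _ _ w2 :=
    (coneMap_comp _ _ w1 _ _ w2 w).symm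
  have mono {X X' : SymSpectrum.{u}} (p : X ⟶ X') : IsMono (prodLift p (inR (𝟙 X))) :=
    fun n k x y h => isMono_inR (𝟙 X) n k (congrArg Prod.snd h)
  have st {X X' : SymSpectrum.{u}} (p : X ⟶ X') (hp : IsStableEquiv p) :
      IsStableEquiv (prodLift p (inR (𝟙 X))) := (isStableEquiv_fst X' X).of_comp_right hp
  rw [e]
  refine .comp (isStableEquiv_of_paramLift fun E hE hE' =>
    ((st p hp).paramLift (mono p) hE hE').coneMap w1 ((st q hq).paramLift (mono q) hE hE'))
    (isStableEquiv_of_homotopyInverse _ (coneMap _ _ w3) ?_ ?_)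
  · refine .of (ParamHom.coneMap (prodContraction X' X) (prodContraction Y' Y)
      (fun x s => Prod.ext rfl (coneContraction_natural f x.2 s
        ((Category.comp_id f).trans (Category.id_comp f).symm)))) (fun z => ?_) (fun z => ?_)
    · induction z using cone_ind with
      | hl x a => exact congrArg (coneL m · a) (Prod.ext rfl (coneContraction_zero X x.2))
      | hr y => exact congrArg (coneR m) (Prod.ext rfl (coneContraction_zero Y y.2))
    · induction z using cone_ind with
      | hl x a => exact congrArg (coneL m · a) (Prod.ext rfl (coneContraction_one X x.2))
      | hr y => exact congrArg (coneR m) (Prod.ext rfl (coneContraction_one Y y.2))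
  · convert htpc_refl (𝟙 (cone f'))
    exact (coneMap_comp _ _ w3 _ _ w2 rfl).trans (coneMap_id f' rfl)

end SymSpectrum

namespace SymSpectrum

/-! ### Strict cofiber sequences -/

/-- A sequence `K ⟶ B ⟶ B'` exhibiting `B'` as the quotient of `B` by the subspectrum `K`. -/
structure IsQuotientSeq {K B B' : SymSpectrum.{u}} (i : K ⟶ B) (q : B ⟶ B') : Prop where
  mono : IsMono i
  surj : ∀ {n k} (z : (B'.level n).obj k), ∃ b, ap q b = z
  zero : ∀ {n k} (x : (K.level n).obj k), ap q (ap i x) = (B'.level n).pt k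
  eq : ∀ {n k} (b b' : (B.level n).obj k), ap q b = ap q b' →
    b = b' ∨ ((∃ x, ap i x = b) ∧ ∃ x, ap i x = b')

namespace IsQuotientSeq

variable {K B B' : SymSpectrum.{u}} {i : K ⟶ B} {q : B ⟶ B'}

lemma mem_range (h : IsQuotientSeq i q) {n k} {b : (B.level n).obj k} (hb : ap q b = (B'.level n).pt k) :
    ∃ x, ap i x = b := by
  obtain rfl | h' := h.eq b ((B.level n).pt k) (hb.trans (ap_pt q).symm)
  · exact ⟨_, ap_pt i⟩
  · exact h'.1

/-- Parametrised maps that are trivial on the subspectrum factor through the quotient. -/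
lemma exists_desc (h : IsQuotientSeq i q) {Q : SSet.{u}} {E : SymSpectrum.{u}}
    (F : ParamHom B Q E)
    (hF : ∀ {n k} (x : (K.level n).obj k) r, F.ev (ap i x) r = (E.level n).pt k) :
    ∃ G : ParamHom B' Q E, ∀ {n k} (b : (B.level n).obj k) r, G.ev (ap q b) r = F.ev b r := by
  have key : ∀ {n k} {b b' : (B.level n).obj k} r, ap q b = ap q b' → F.ev b r = F.ev b' r := by
    intro n k b b' r e
    obtain rfl | ⟨⟨x, rfl⟩, x', rfl⟩ := h.eq b b' e
    · rfl
    · rw [hF, hF]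
  have hs : ∀ {n k} (z : (B'.level n).obj k), ap q (h.surj z).choose = z :=
    fun z => (h.surj z).choose_spec
  refine ⟨⟨fun z r => F.ev (h.surj z).choose r, fun θ z r => ?_, fun r => ?_, fun ρ z r => ?_,
    fun z b r => ?_⟩, fun b r => key r (hs _)⟩
  · rw [← F.ev_map]
    exact key _ (by rw [hs, ap_map, hs])
  · rw [← F.ev_pt r]
    exact key _ (by rw [hs, ap_pt])
  · rw [← F.ev_perm]
    exact key _ (by rw [hs, ap_perm, hs])
  · rw [← F.ev_σ]
    exact key _ (by rw [hs, ap_σ, hs])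

/-- Collapsing a stably trivial subspectrum is a stable equivalence. -/
lemma isStableEquiv (h : IsQuotientSeq i q)
    (hK : IsStableEquiv (zeroHom SymSpectrum.zero K)) : IsStableEquiv q := by
  rw [isStableEquiv_iff]
  intro E hE hE'
  have lift := hK.paramLift (isMono_zeroHom K) hE hE'
  have hz (g : B' ⟶ E) {n k} (x : (K.level n).obj k) : ap (q ≫ g) (ap i x) = (E.level n).pt k := by
    rw [ap_comp, h.zero, ap_pt]
  refine ⟨fun g g' e => ?_, fun f => ?_⟩
  · obtain ⟨G, h0, h1⟩ := e.exists_param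
    let V (v : Bool) : 𝟙_ SSet.{u} ⟶ delta1 :=
      SSet.ofFun (fun k _ => vertex (bif v then 1 else 0) k) (fun _ _ => rfl)
    let b (o : Option (Option Bool)) : ParamHom K (o.elim delta1
        (fun o => o.elim delta1 (fun _ => delta1))) E := match o with
      | none => G.pull i (𝟙 _)
      | some none => ParamHom.const (zeroHom K E) _
      | some (some _) => ParamHom.const (zeroHom K E) _
    obtain ⟨HH, -, hHH⟩ := lift (Option (Option Bool)) (delta1 ⊗ delta1)
      (fun o => o.elim delta1 (fun o => o.elim delta1 (fun _ => delta1)))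
      (fun o => match o with
        | none => ι₁
        | some none => ι₀
        | some (some v) => SSet.ofFun (X := delta1) (Y := delta1 ⊗ delta1)
          (fun k t => (vertex (bif v then 1 else 0) k, t)) (fun _ _ => rfl))
      b (ParamHom.const (zeroHom _ E) _)
      (by
        have bv (v : Bool) {n k} (x : (K.level n).obj k) :
            G.ev (ap i x) (vertex (bif v then 1 else 0) k) = (E.level n).pt k := by
          obtain _ | _ := v
          · exact (h0 _).trans (hz g x)
          · exact (h1 _).trans (hz g' x)
        rintro (_ | _ | v) (_ | _ | v') k a a' e n x
        · obtain rfl : a = a' := (Prod.mk.inj e).1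
          rfl
        · exact absurd (Prod.mk.inj e).2.symm vertex_ne
        · obtain rfl : a = vertex (bif v' then 1 else 0) k := (Prod.mk.inj e).1
          exact bv v' x
        · exact absurd (Prod.mk.inj e).2 vertex_ne
        · rfl
        · rfl
        · obtain rfl : vertex (bif v then 1 else 0) k = a' := (Prod.mk.inj e).1
          exact (bv v x).symm
        · rfl
        · rfl)
      (fun {c n k} a x => (b c).ev_pt a)
    obtain ⟨F, hF, hF', -⟩ := hE.hep h.mono (ι := Bool) (Q := delta1) (fun _ => 𝟙_ SSet.{u}) V
      (fun v => ParamHom.const (bif v then q ≫ g' else q ≫ g) _) G HH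
      (by
        rintro (_ | _) (_ | _) k a a' e n x t
        · rfl
        · exact absurd e vertex_ne
        · exact absurd e.symm vertex_ne
        · rfl)
      (by
        rintro (_ | _) n k a x t
        · exact (hz g x).trans (hHH (c := some (some false)) t x).symm
        · exact (hz g' x).trans (hHH (c := some (some true)) t x).symm)
      (by
        rintro (_ | _) n k a x
        · exact (h0 x).symm
        · exact (h1 x).symm)
      (fun {n k} x t => (hHH (c := none) t x).symm)
    obtain ⟨D, hD⟩ := h.exists_desc (F.pull (𝟙 B) ι₀)
      (fun {n k} x t => (hF x t _).trans (hHH (c := some none) t x))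
    refine .of D (fun {n k} z => ?_) (fun {n k} z => ?_)
    · obtain ⟨x, rfl⟩ := h.surj z
      exact (hD x _).trans (hF' (c := false) PUnit.unit x (vertex 0 k))
    · obtain ⟨x, rfl⟩ := h.surj z
      exact (hD x _).trans (hF' (c := true) PUnit.unit x (vertex 0 k))
  · let b (v : Bool) : ParamHom K (𝟙_ SSet.{u}) E :=
      ParamHom.const (bif v then i ≫ f else zeroHom K E) _
    obtain ⟨G, -, hG⟩ := lift Bool delta1 (fun _ => 𝟙_ SSet.{u})
      (fun v => SSet.ofFun (X := 𝟙_ SSet.{u}) (fun k _ => vertex (bif v then 1 else 0) k)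
        (fun _ _ => rfl)) b (ParamHom.const (zeroHom _ E) _)
      (by
        rintro (_ | _) (_ | _) k a a' e n x
        · rfl
        · exact absurd e vertex_ne
        · exact absurd e.symm vertex_ne
        · rfl)
      (fun {c n k} a x => (b c).ev_pt a)
    obtain ⟨F, hF, -, hF'⟩ := hE.hep h.mono (ι := Empty) (Q := 𝟙_ SSet.{u}) (fun _ => 𝟙_ SSet.{u})
      (fun c => c.elim) (fun c => c.elim) (ParamHom.const f _)
      (G.pull (𝟙 K) (SSet.ofFun (fun _ p => p.2) (fun _ _ => rfl)))
      (fun {c} => c.elim) (fun {c} => c.elim) (fun {c} => c.elim)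
      (fun x _ => (hG (c := true) PUnit.unit x).symm)
    let F' : ParamHom B delta1 E := F.pull (𝟙 B) (SSet.ofFun (X := delta1)
      (Y := 𝟙_ SSet.{u} ⊗ delta1) (fun _ t => (PUnit.unit, t)) (fun _ _ => rfl))
    obtain ⟨D, hD⟩ := h.exists_desc (ParamHom.const (F'.fiber (vertex 0) (fun _ => rfl))
      (𝟙_ SSet.{u})) (fun x _ => (hF x PUnit.unit _).trans (hG (c := false) PUnit.unit x))
    refine ⟨D.fiber (fun _ => PUnit.unit) (fun _ => rfl), .of F' (fun {n k} x => ?_) (fun x => ?_)⟩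
    · exact (hD x PUnit.unit).symm
    · exact hF' x PUnit.unit

/-- Mapping cones of quotient sequences. -/
lemma coneMap {K₁ B₁ B₁' : SymSpectrum.{u}} {i₁ : K₁ ⟶ B₁} {q₁ : B₁ ⟶ B₁'}
    {K₂ B₂ B₂' : SymSpectrum.{u}} {i₂ : K₂ ⟶ B₂} {q₂ : B₂ ⟶ B₂'} (h₁ : IsQuotientSeq i₁ q₁)
    (h₂ : IsQuotientSeq i₂ q₂) {f : K₁ ⟶ K₂} {g : B₁ ⟶ B₂} {g' : B₁' ⟶ B₂'}
    (w : i₁ ≫ g = f ≫ i₂) (w' : q₁ ≫ g' = g ≫ q₂) :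
    IsQuotientSeq (SymSpectrum.coneMap i₁ i₂ w) (SymSpectrum.coneMap q₁ q₂ w') where
  mono n k z z' e := by
    have ne {x : (K₁.level n).obj k} (hx : x ≠ (K₁.level n).pt k) :
        ap i₁ x ≠ (B₁.level n).pt k := fun e => hx (h₁.mono n k (e.trans (ap_pt i₁).symm))
    induction z using cone_cases with
    | hl x a hx h0 h1 =>
      induction z' using cone_cases with
      | hl x' a' hx' h0' h1' =>
        obtain ⟨ex, rfl⟩ := coneInl_inj (g.app n) (ne hx) h0 h1 (ne hx') h0' h1' e
        rw [h₁.mono n k ex]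
      | hr y => exact absurd e (coneInl_ne_coneInr (g.app n) (ne hx) h0 h1 _)
    | hr y =>
      induction z' using cone_cases with
      | hl x' a' hx' h0' h1' =>
        exact absurd e.symm (coneInl_ne_coneInr (g.app n) (ne hx') h0' h1' _)
      | hr y' => exact congrArg _ (h₂.mono n k (coneInr_injective (g.app n) e))
  surj z := by
    induction z using cone_ind with
    | hl x a =>
      obtain ⟨x, rfl⟩ := h₁.surj x
      exact ⟨coneL g x a, rfl⟩
    | hr y =>
      obtain ⟨y, rfl⟩ := h₂.surj y
      exact ⟨coneR g y, rfl⟩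
  zero z := by
    induction z using cone_ind with
    | hl x a => exact (congrArg (coneL g' · a) (h₁.zero x)).trans (coneL_pt g' a)
    | hr y => exact congrArg (coneR g') (h₂.zero y)
  eq {n k} z z' e := by
    have range_inl {x : (B₁.level n).obj k} (a) (hx : ap q₁ x = (B₁'.level n).pt k) :
        ∃ y, ap (SymSpectrum.coneMap i₁ i₂ w) y = coneL g x a := by
      obtain ⟨x, rfl⟩ := h₁.mem_range hx
      exact ⟨coneL f x a, rfl⟩
    have range_inr {y : (B₂.level n).obj k} (hy : ap q₂ y = (B₂'.level n).pt k) :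
        ∃ z, ap (SymSpectrum.coneMap i₁ i₂ w) z = coneR g y := by
      obtain ⟨y, rfl⟩ := h₂.mem_range hy
      exact ⟨coneR f y, rfl⟩
    have pt_inl {x : (B₁.level n).obj k} (a) (hx : ap q₁ x = (B₁'.level n).pt k) :
        coneL g' (ap q₁ x) a = coneR g' ((B₂'.level n).pt k) := by
      rw [hx]
      exact coneL_pt g' a
    have inl_pt {x : (B₁.level n).obj k} {a} (h0 : a ≠ vertex 0 k) (h1 : a ≠ vertex 1 k) {y}
        (hx : coneL g' (ap q₁ x) a = coneR g' y) : ap q₁ x = (B₁'.level n).pt k := by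
      by_contra hne
      exact coneInl_ne_coneInr (g'.app n) hne h0 h1 _ hx
    induction z using cone_cases with
    | hl x a hx h0 h1 =>
      induction z' using cone_cases with
      | hl x' a' hx' h0' h1' =>
        by_cases hq : ap q₁ x = (B₁'.level n).pt k
        · exact Or.inr ⟨range_inl a hq, range_inl a' (inl_pt h0' h1' (e.symm.trans (pt_inl a hq)))⟩
        · by_cases hq' : ap q₁ x' = (B₁'.level n).pt k
          · exact absurd (inl_pt h0 h1 (e.trans (pt_inl a' hq'))) hq
          · obtain ⟨ex, rfl⟩ := coneInl_inj (g'.app n) hq h0 h1 hq' h0' h1' e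
            obtain rfl | ⟨⟨y, rfl⟩, -⟩ := h₁.eq _ _ ex
            · exact Or.inl rfl
            · exact absurd (h₁.zero y) hq
      | hr y =>
        have hq := inl_pt h0 h1 e
        refine Or.inr ⟨range_inl a hq, range_inr ?_⟩
        exact coneInr_injective (g'.app n) (e.symm.trans (pt_inl a hq))
    | hr y =>
      induction z' using cone_cases with
      | hl x' a' hx' h0' h1' =>
        have hq := inl_pt h0' h1' e.symm
        refine Or.inr ⟨range_inr ?_, range_inl a' hq⟩
        exact coneInr_injective (g'.app n) (e.trans (pt_inl a' hq))
      | hr y' =>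
        obtain rfl | ⟨⟨z, rfl⟩, z', rfl⟩ := h₂.eq _ _ (coneInr_injective (g'.app n) e)
        · exact Or.inl rfl
        · exact Or.inr ⟨⟨coneR f z, rfl⟩, coneR f z', rfl⟩

end IsQuotientSeq

lemma isStableEquiv_zeroHom_of_contraction {K : SymSpectrum.{u}} (D : ParamHom K delta1 K)
    (h0 : ∀ {n k} (x : (K.level n).obj k), D.ev x (vertex 0 k) = (K.level n).pt k)
    (h1 : ∀ {n k} (x : (K.level n).obj k), D.ev x (vertex 1 k) = x) :
    IsStableEquiv (zeroHom zero K) := by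
  refine isStableEquiv_of_homotopyInverse _ (zeroHom K zero) ?_ (.of D h0 h1)
  convert htpc_refl (𝟙 zero)
  exact hom_ext_ap fun _ _ _ => zero_ext _ _

lemma isStableEquiv_zeroHom_cone_id (X : SymSpectrum.{u}) :
    IsStableEquiv (zeroHom zero (cone (𝟙 X))) :=
  isStableEquiv_zeroHom_of_contraction (coneContraction X) (coneContraction_zero X)
    (coneContraction_one X)

end SymSpectrum

namespace PSSet

section loop

variable {Y : PSSet.{u}} {k l m : SimplexCategoryᵒᵖ}

/-- Evaluation of a simplex of a loop space after applying an operator. -/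
def loopVal (v : (loop Y).obj k) (θ : k ⟶ l) (b : circle.{u}.obj l) : Y.obj l :=
  loopEval ((loop Y).map θ v) b

lemma loopVal_ext {v w : (loop Y).obj k}
    (h : ∀ l (θ : k ⟶ l) b, loopVal v θ b = loopVal w θ b) : v = w := loop_ext h

lemma loopVal_map (v : (loop Y).obj k) (θ : k ⟶ l) (θ' : l ⟶ m) (b : circle.{u}.obj m) :
    loopVal ((loop Y).map θ v) θ' b = loopVal v (θ ≫ θ') b := by
  rw [loopVal, loopVal, map_comp_app]

lemma map_loopVal (v : (loop Y).obj k) (θ : k ⟶ l) (θ' : l ⟶ m) (b : circle.{u}.obj l) :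
    loopVal v (θ ≫ θ') (circle.map θ' b) = Y.map θ' (loopVal v θ b) := by
  rw [loopVal, map_comp_app, map_loopEval]
  rfl

lemma loopVal_pt (v : (loop Y).obj k) (θ : k ⟶ l) : loopVal v θ (circle.pt l) = Y.pt l :=
  loopEval_pt _

/-- The simplex of a loop space with given values. -/
def loopOf (φ : ∀ l (_ : k ⟶ l), circle.{u}.obj l → Y.obj l)
    (nat : ∀ {l m} (θ : k ⟶ l) (θ' : l ⟶ m) b,
      φ m (θ ≫ θ') (circle.map θ' b) = Y.map θ' (φ l θ b))
    (hpt : ∀ l θ, φ l θ (circle.pt l) = Y.pt l) : (loop Y).obj k :=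
  ⟨SSet.ofFun (fun l p => φ l (stdSimplex.objEquiv p.1).op p.2) (fun θ' p =>
    nat (stdSimplex.objEquiv p.1).op θ' p.2), fun _ _ => hpt _ _⟩

@[simp] lemma loopVal_loopOf (φ : ∀ l (_ : k ⟶ l), circle.{u}.obj l → Y.obj l) (nat) (hpt)
    (θ : k ⟶ l) (b : circle.{u}.obj l) : loopVal (loopOf φ nat hpt) θ b = φ l θ b :=
  loopEval_map θ _ b

lemma loopVal_toLoop {X : PSSet.{u}} (σ : smash X circle ⟶ Y) (x : X.obj k) (θ : k ⟶ l)
    (b : circle.{u}.obj l) :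
    loopVal ((toLoop σ).app k x) θ b = PSSet.app σ l (smashMk (X.map θ x) b) := by
  rw [loopVal, ← SSet.app_map, loopEval_toLoop]

end loop

/-- The loop space, pointed at the constant loop. -/
def loopP (Y : PSSet.{u}) : PSSet.{u} where
  toSSet := loop Y
  pt _ := loopOf (fun l _ _ => Y.pt l) (fun _ θ' _ => (Y.map_pt θ').symm) (fun _ _ => rfl)
  map_pt θ := loopVal_ext fun l θ' b => by
    rw [loopVal_map, loopVal_loopOf, loopVal_loopOf]

lemma loopVal_loopP_pt (Y : PSSet.{u}) {k l} (θ : k ⟶ l) (b : circle.{u}.obj l) :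
    loopVal ((loopP Y).pt k) θ b = Y.pt l := loopVal_loopOf _ _ _ θ b

/-- The simplex of the circle represented by a simplex of the interval. -/
def circleMk {k} (a : delta1.{u}.obj k) : circle.{u}.obj k := Quot.mk _ a

lemma circleMk_zero (k) : circleMk (vertex 0 k) = circle.{u}.pt k := rfl

lemma circleMk_of_mem {k} {a : delta1.{u}.obj k} (h : a ∈ (SSet.boundary.{u} 1).obj k) :
    circleMk a = circle.pt k :=
  Quot.sound ⟨h, (mem_boundary_iff _).2 (Or.inl rfl)⟩

lemma circleMk_one (k) : circleMk (vertex 1 k) = circle.{u}.pt k :=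
  circleMk_of_mem ((mem_boundary_iff _).2 (Or.inr rfl))

end PSSet

namespace SymSpectrum

section loopShift

variable (E : SymSpectrum.{u}) {n : ℕ} {k l : SimplexCategoryᵒᵖ}

/-- The action of a permutation on the looped shift of a symmetric spectrum. -/
def loopPerm (ρ : Equiv.Perm (Fin n)) (v : (loop (E.level (n + 1))).obj k) :
    (loop (E.level (n + 1))).obj k :=
  loopOf (fun _ θ b => E.perm (liftPerm ρ) (loopVal v θ b))
    (fun θ θ' b => (congrArg _ (map_loopVal v θ θ' b)).trans (map_perm E.toSpectrumData _ _ _))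
    (fun _ θ => (congrArg _ (loopVal_pt v θ)).trans (perm_pt _ _ _))

lemma loopVal_loopPerm (ρ : Equiv.Perm (Fin n)) (v : (loop (E.level (n + 1))).obj k)
    (θ : k ⟶ l) (b : PSSet.circle.{u}.obj l) :
    loopVal (loopPerm E ρ v) θ b = E.perm (liftPerm ρ) (loopVal v θ b) := loopVal_loopOf _ _ _ θ b

/-- The structure maps of the looped shift of a symmetric spectrum. -/
def loopStr (v : (loop (E.level (n + 1))).obj k) (b : PSSet.circle.{u}.obj k) :
    (loop (E.level (n + 2))).obj k :=
  loopOf (fun _ θ b' => E.perm (lastSwap n) (E.σ (loopVal v θ b') (PSSet.circle.map θ b)))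
    (fun θ θ' b' => by rw [map_loopVal, PSSet.map_comp circle, ← map_perm, ← map_σ])
    (fun _ θ => by rw [loopVal_pt, σ_pt_left, perm_pt])

lemma loopVal_loopStr (v : (loop (E.level (n + 1))).obj k) (b : PSSet.circle.{u}.obj k)
    (θ : k ⟶ l) (b' : PSSet.circle.{u}.obj l) : loopVal (loopStr E v b) θ b' =
      E.perm (lastSwap n) (E.σ (loopVal v θ b') (PSSet.circle.map θ b)) :=
  loopVal_loopOf _ _ _ θ b'

lemma loopStr_loopPerm (ρ : Equiv.Perm (Fin n)) (v : (loop (E.level (n + 1))).obj k)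
    (b : PSSet.circle.{u}.obj k) :
    loopStr E (loopPerm E ρ v) b = loopPerm E (liftPerm ρ) (loopStr E v b) :=
  loopVal_ext fun l θ b' => by
    rw [loopVal_loopStr, loopVal_loopPerm, loopVal_loopPerm, loopVal_loopStr, perm_σ, ← perm_mul,
      ← perm_mul, liftPerm_liftPerm_mul_lastSwap]

lemma loopStr_loopStr (v : (loop (E.level (n + 1))).obj k) (a b : PSSet.circle.{u}.obj k) :
    loopStr E (loopStr E v b) a = loopPerm E (lastSwap n) (loopStr E (loopStr E v a) b) :=
  loopVal_ext fun l θ b' => by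
    rw [loopVal_loopStr, loopVal_loopStr, loopVal_loopPerm, loopVal_loopStr, loopVal_loopStr,
      perm_σ, perm_σ, σ_σ E _ (PSSet.circle.map θ a), ← perm_mul, ← perm_mul, ← perm_mul,
      ← perm_mul, lastSwap_braid]

/-- The looped shift of a symmetric spectrum, with levels `Ω E (n + 1)`. -/
def loopShift : SymSpectrum.{u} :=
  ofFun (fun n => loopP (E.level (n + 1))) (fun _ ρ _ => loopPerm E ρ) (fun _ _ => loopStr E)
    (fun n ρ k l θ v => loopVal_ext (Y := E.level (n + 1)) fun m θ' b => Eq.symm <|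
      (loopVal_map (loopPerm E ρ v) θ θ' b).trans ((loopVal_loopPerm E ρ v _ b).trans
        ((congrArg _ (loopVal_map (Y := E.level (n + 1)) v θ θ' b)).symm.trans
          (loopVal_loopPerm E ρ _ θ' b).symm)))
    (fun n ρ k => loopVal_ext (Y := E.level (n + 1)) fun l θ b =>
      (loopVal_loopPerm E ρ _ θ b).trans ((congrArg _ (loopVal_loopP_pt _ θ b)).trans
        ((perm_pt _ _ _).trans (loopVal_loopP_pt _ θ b).symm)))
    (fun n k v => loopVal_ext (Y := E.level (n + 1)) fun l θ b =>
      (loopVal_loopPerm E 1 v θ b).trans (by rw [liftPerm_one, perm_one]))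
    (fun n ρ ρ' k v => loopVal_ext (Y := E.level (n + 1)) fun l θ b =>
      (loopVal_loopPerm E _ v θ b).trans (by
        rw [liftPerm_mul, perm_mul, loopVal_loopPerm]
        exact congrArg _ (loopVal_loopPerm E ρ' v θ b).symm))
    (fun n k l θ v b => loopVal_ext (Y := E.level (n + 2)) fun m θ' b' => Eq.symm <|
      (loopVal_map (loopStr E v b) θ θ' b').trans ((loopVal_loopStr E v b _ b').trans
        ((congrArg₂ (fun z b => E.perm _ (E.σ z b)) (loopVal_map (Y := E.level (n + 1)) v θ θ' b')
          (PSSet.map_comp circle θ θ' b).symm).symm.trans (loopVal_loopStr E _ _ θ' b').symm)))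
    (fun n k b => loopVal_ext (Y := E.level (n + 2)) fun l θ b' =>
      (loopVal_loopStr E _ b θ b').trans (((congrArg (fun z => E.perm _ (E.σ z _))
        (loopVal_loopP_pt (E.level (n + 1)) θ b')).trans (by rw [σ_pt_left, perm_pt])).trans
          (loopVal_loopP_pt (E.level (n + 2)) θ b').symm))
    (fun n k v => loopVal_ext (Y := E.level (n + 2)) fun l θ b' =>
      (loopVal_loopStr E v _ θ b').trans (((congrArg (fun z => E.perm _ (E.σ _ z))
        (circle.map_pt θ)).trans (by rw [σ_pt_right, perm_pt])).trans
          (loopVal_loopP_pt (E.level (n + 2)) θ b').symm))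
    (fun _ ρ _ => loopStr_loopPerm E ρ) (fun _ _ => loopStr_loopStr E)

lemma perm_loopShift (ρ : Equiv.Perm (Fin n))
    (v : ((loopShift E).level n).obj k) (θ : k ⟶ l) (b : PSSet.circle.{u}.obj l) :
    loopVal (Y := E.level (n + 1)) ((loopShift E).perm ρ v) θ b =
      E.perm (liftPerm ρ) (loopVal (Y := E.level (n + 1)) v θ b) := loopVal_loopPerm E ρ v θ b

lemma σ_loopShift (v : ((loopShift E).level n).obj k)
    (b : PSSet.circle.{u}.obj k) (θ : k ⟶ l) (b' : PSSet.circle.{u}.obj l) :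
    loopVal (Y := E.level (n + 2)) ((loopShift E).σ v b) θ b' = E.perm (lastSwap n)
      (E.σ (loopVal (Y := E.level (n + 1)) v θ b') (PSSet.circle.map θ b)) :=
  loopVal_loopStr E v b θ b'

end loopShift

/-- The map from a symmetric spectrum to its looped shift given by the structure maps. -/
def toLoopShift (E : SymSpectrum.{u}) : E ⟶ loopShift E :=
  homOfFun (fun n k x => (toLoop (E.str n)).app k x)
    (fun n _ _ θ x => SSet.app_map (toLoop (E.str n)) θ x)
    (fun n k => loopVal_ext fun l θ b => by
      refine Eq.trans ?_ (loopVal_loopP_pt (E.level (n + 1)) θ b).symm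
      refine (loopVal_toLoop _ _ θ b).trans ?_
      exact (congrArg (E.σ · b) (PSSet.map_pt _ θ)).trans (σ_pt_left _ b))
    (fun n ρ k x => loopVal_ext (Y := E.level (n + 1)) fun l θ b => by
      refine Eq.trans ?_ (perm_loopShift E ρ _ θ b).symm
      rw [loopVal_toLoop, loopVal_toLoop, ← map_perm]
      exact perm_σ E ρ _ b)
    (fun n k x b => loopVal_ext (Y := E.level (n + 2)) fun l θ b' => by
      refine Eq.trans ?_ (σ_loopShift E _ b θ b').symm
      rw [loopVal_toLoop, loopVal_toLoop, ← map_σ]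
      exact σ_σ E _ _ _)

lemma loopVal_toLoopShift (E : SymSpectrum.{u}) {n k l} (x : (E.level n).obj k) (θ : k ⟶ l)
    (b : PSSet.circle.{u}.obj l) : loopVal (Y := E.level (n + 1)) (ap (toLoopShift E) x) θ b =
      E.σ ((E.level n).map θ x) b := loopVal_toLoop _ _ _ _

lemma Htpc.homotopic {X Y : SymSpectrum.{u}} {f g : X ⟶ Y} (h : Htpc f g) (n : ℕ) :
    Homotopic (f.app n).toHom (g.app n).toHom := by
  obtain ⟨H⟩ := h
  exact .of_comp (H.h n) (H.h_zero n) (H.h_one n)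

/-- Maps to an injective `Ω`-spectrum are homotopic if they are so after composition with the map
to its looped shift. -/
lemma htpc_of_toLoopShift {E : SymSpectrum.{u}} (hE : IsInjective E) (hE' : IsOmegaSpectrum E)
    {X : SymSpectrum.{u}} {f g : X ⟶ E} (h : Htpc (f ≫ toLoopShift E) (g ≫ toLoopShift E)) :
    Htpc f g := by
  have hfst : IsLevelEquiv (fst (loopShift E) (cone (𝟙 E))) := fun n => by
    refine isWeakEquiv_of_homotopyInverse _
      ((prodLift (𝟙 (loopShift E)) (zeroHom _ (cone (𝟙 E)))).app n).toHom (.rel _ _ ?_)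
      (.rel _ _ (homotopic_refl _))
    exact Htpc.homotopic (f := fst (loopShift E) (cone (𝟙 E)) ≫ prodLift (𝟙 _) (zeroHom _ _))
      (g := 𝟙 _) (.of (prodContraction _ E) (fun x => Prod.ext rfl (coneContraction_zero E x.2))
      (fun x => Prod.ext rfl (coneContraction_one E x.2))) n
  let m : E ⟶ prod (loopShift E) (cone (𝟙 E)) := prodLift (toLoopShift E) (inR (𝟙 E))
  obtain ⟨r, hr⟩ := hE _ _ m (fun n k x y e => isMono_inR (𝟙 E) n k (congrArg Prod.snd e))
    (fun n => (hfst n).of_comp_right (f := (m.app n).toHom) (hE' n).2) (𝟙 E)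
  have key (f : X ⟶ E) : Htpc (prodLift (f ≫ toLoopShift E) (zeroHom X (cone (𝟙 E))) ≫ r) f := by
    have : Htpc (prodLift (f ≫ toLoopShift E) (zeroHom X (cone (𝟙 E)))) (f ≫ m) :=
      .of ((prodContraction (loopShift E) E).pull (f ≫ m) (𝟙 _))
        (fun x => Prod.ext rfl (coneContraction_zero E (coneR (𝟙 E) (ap f x))))
        (fun x => Prod.ext rfl (coneContraction_one E (coneR (𝟙 E) (ap f x))))
    have := this.postcomp r
    rwa [Category.assoc, hr, Category.comp_id] at this
  have : Htpc (prodLift (f ≫ toLoopShift E) (zeroHom X (cone (𝟙 E))))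
      (prodLift (g ≫ toLoopShift E) (zeroHom X (cone (𝟙 E)))) := by
    obtain ⟨F, h0, h1⟩ := h.exists_param
    exact .of (F.post (prodLift (𝟙 _) (zeroHom _ _))) (fun x => Prod.ext (h0 x) rfl)
      (fun x => Prod.ext (h1 x) rfl)
  exact hE.htpc_trans (hE.htpc_symm (key f)) (hE.htpc_trans (this.postcomp r) (key g))

/-! ### Quotients -/

/-- The quotient of a symmetric spectrum by the image of a map. -/
def collapse {K B : SymSpectrum.{u}} (i : K ⟶ B) : SymSpectrum.{u} :=
  ofFun (fun n => PSSet.ofData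
      (fun k => Quot fun b b' : (B.level n).obj k => (∃ x, ap i x = b) ∧ ∃ x, ap i x = b')
      (fun θ => Quot.map ((B.level n).map θ) (by
        rintro _ _ ⟨⟨x, rfl⟩, x', rfl⟩
        exact ⟨⟨_, ap_map i θ x⟩, _, ap_map i θ x'⟩))
      (by rintro k ⟨b⟩; exact congrArg (Quot.mk _) (PSSet.map_id _ b))
      (by rintro k l m θ θ' ⟨b⟩; exact congrArg (Quot.mk _) (PSSet.map_comp _ θ θ' b))
      (fun k => Quot.mk _ ((B.level n).pt k))
      (fun θ => congrArg (Quot.mk _) (PSSet.map_pt _ θ)))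
    (fun n ρ k => Quot.map (B.perm ρ) (by
      rintro _ _ ⟨⟨x, rfl⟩, x', rfl⟩
      exact ⟨⟨_, ap_perm i ρ x⟩, _, ap_perm i ρ x'⟩))
    (fun n k z b => Quot.map (B.σ · b) (by
      rintro _ _ ⟨⟨x, rfl⟩, x', rfl⟩
      exact ⟨⟨_, ap_σ i x b⟩, _, ap_σ i x' b⟩) z)
    (by rintro n ρ k l θ ⟨x⟩; exact congrArg (Quot.mk _) (map_perm _ ρ θ x))
    (fun n ρ k => congrArg (Quot.mk _) (perm_pt _ ρ k))
    (by rintro n k ⟨x⟩; exact congrArg (Quot.mk _) (perm_one _ k x))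
    (by rintro n ρ ρ' k ⟨x⟩; exact congrArg (Quot.mk _) (perm_mul _ ρ ρ' k x))
    (by rintro n k l θ ⟨x⟩ b; exact congrArg (Quot.mk _) (map_σ _ θ x b))
    (fun n k b => congrArg (Quot.mk _) (σ_pt_left _ b))
    (by rintro n k ⟨x⟩; exact congrArg (Quot.mk _) (σ_pt_right _ x))
    (by rintro n ρ k ⟨x⟩ b; exact congrArg (Quot.mk _) (perm_σ B ρ x b))
    (by rintro n k ⟨x⟩ a b; exact congrArg (Quot.mk _) (σ_σ B x a b))

/-- The projection to the quotient. -/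
def toCollapse {K B : SymSpectrum.{u}} (i : K ⟶ B) : B ⟶ collapse i :=
  homOfFun (fun _ _ b => Quot.mk _ b) (fun _ _ _ _ _ => rfl) (fun _ _ => rfl)
    (fun _ _ _ _ => rfl) (fun _ _ _ _ => rfl)

lemma isQuotientSeq_toCollapse {K B : SymSpectrum.{u}} (i : K ⟶ B) (hi : IsMono i) :
    IsQuotientSeq i (toCollapse i) where
  mono := hi
  surj := by rintro n k ⟨b⟩; exact ⟨b, rfl⟩
  zero {n k} x := Quot.sound ⟨⟨x, rfl⟩, _, ap_pt i⟩
  eq b b' h := (quot_mk_eq_iff_of_collapse (fun b => ∃ x, ap i x = b) (fun _ _ => Iff.rfl) b b').1 h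

lemma IsQuotientSeq.exists_hom {K B B' : SymSpectrum.{u}} {i : K ⟶ B} {q : B ⟶ B'}
    (h : IsQuotientSeq i q) {E : SymSpectrum.{u}} (f : B ⟶ E)
    (hf : ∀ {n k} (x : (K.level n).obj k), ap f (ap i x) = (E.level n).pt k) :
    ∃ g : B' ⟶ E, q ≫ g = f := by
  obtain ⟨G, hG⟩ := h.exists_desc (ParamHom.const f (𝟙_ SSet.{u})) (fun x _ => hf x)
  exact ⟨G.fiber (fun _ => PUnit.unit) (fun _ => rfl), hom_ext_ap fun n k x => hG x PUnit.unit⟩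

end SymSpectrum

namespace SymSpectrum

/-! ### Collapsing a factor of a product -/

variable {X Y E : SymSpectrum.{u}}

/-- A simplex of the product. -/
def pair {n k} (x : (X.level n).obj k) (y : (Y.level n).obj k) : ((prod X Y).level n).obj k :=
  (x, y)

/-- For a map `f : X × Y ⟶ E` that is trivial on `* × Y`, the value of `f` on the product of the
suspension coordinate `b` on `x` and the smaller coordinate `min b s` on `y`. -/
def slideVal (f : prod X Y ⟶ E)
    (hf : ∀ {n k} (y : (Y.level n).obj k), ap f (pair ((X.level n).pt k) y) = (E.level n).pt k)
    {n k} (x : (X.level n).obj k) (y : (Y.level n).obj k) (s : delta1.{u}.obj k)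
    (b : PSSet.circle.{u}.obj k) : (E.level (n + 1)).obj k :=
  Quot.lift (fun a : delta1.{u}.obj k => ap f (pair (X.σ x (circleMk a))
      (Y.σ y (circleMk (inf1 a s))))) (by
    have key (a : delta1.{u}.obj k) (h : a ∈ (SSet.boundary.{u} 1).obj k) :
        ap f (pair (X.σ x (circleMk a)) (Y.σ y (circleMk (inf1 a s)))) =
          (E.level (n + 1)).pt k := by
      rw [circleMk_of_mem h, σ_pt_right, hf]
    rintro a a' ⟨h, h'⟩
    exact (key a h).trans (key a' h').symm) b

section slideVal

variable (f : prod X Y ⟶ E)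
  (hf : ∀ {n k} (y : (Y.level n).obj k), ap f (pair ((X.level n).pt k) y) = (E.level n).pt k)
  {n : ℕ} {k l : SimplexCategoryᵒᵖ} (x : (X.level n).obj k) (y : (Y.level n).obj k)

lemma slideVal_circleMk (s a : delta1.{u}.obj k) : slideVal f hf x y s (circleMk a) =
    ap f (pair (X.σ x (circleMk a)) (Y.σ y (circleMk (inf1 a s)))) := rfl

lemma slideVal_map (θ : k ⟶ l) (s : delta1.{u}.obj k) (b : PSSet.circle.{u}.obj k) :
    slideVal f hf ((X.level n).map θ x) ((Y.level n).map θ y) (delta1.map θ s)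
      (PSSet.circle.map θ b) = (E.level (n + 1)).map θ (slideVal f hf x y s b) := by
  obtain ⟨a⟩ := b
  refine Eq.trans (congrArg (ap f) (Prod.ext ?_ ?_)) (ap_map f θ (pair (X.σ x (circleMk a))
    (Y.σ y (circleMk (inf1 a s)))))
  · exact map_σ X.toSpectrumData θ x (circleMk a)
  · exact map_σ Y.toSpectrumData θ y (circleMk (inf1 a s))

lemma slideVal_pt_left (s : delta1.{u}.obj k) (b : PSSet.circle.{u}.obj k) :
    slideVal f hf ((X.level n).pt k) y s b = (E.level (n + 1)).pt k := by
  obtain ⟨a⟩ := b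
  refine (slideVal_circleMk f hf _ _ s a).trans ?_
  rw [σ_pt_left, hf]

lemma slideVal_pt_right (s : delta1.{u}.obj k) :
    slideVal f hf x y s (PSSet.circle.pt k) = (E.level (n + 1)).pt k := by
  refine (slideVal_circleMk f hf x y s (vertex 0 k)).trans ?_
  rw [circleMk_zero, σ_pt_right, hf]

lemma slideVal_perm (ρ : Equiv.Perm (Fin n)) (s : delta1.{u}.obj k) (b : PSSet.circle.{u}.obj k) :
    slideVal f hf (X.perm ρ x) (Y.perm ρ y) s b = E.perm (liftPerm ρ) (slideVal f hf x y s b) := by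
  obtain ⟨a⟩ := b
  exact (congrArg₂ (fun z w => ap f (pair z w)) (perm_σ X ρ x _) (perm_σ Y ρ y _)).trans
    (ap_perm f (liftPerm ρ) (pair _ _))

lemma slideVal_σ (c : PSSet.circle.{u}.obj k) (s : delta1.{u}.obj k)
    (b : PSSet.circle.{u}.obj k) : slideVal f hf (X.σ x c) (Y.σ y c) s b =
      E.perm (lastSwap n) (E.σ (slideVal f hf x y s b) c) := by
  obtain ⟨a⟩ := b
  exact ((congrArg₂ (fun z w => ap f (pair z w)) (σ_σ X x _ c) (σ_σ Y y _ c)).trans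
    (ap_perm f (lastSwap n) (pair _ _))).trans (congrArg _ (ap_σ f (pair _ _) c))

lemma slideVal_zero (b : PSSet.circle.{u}.obj k) :
    slideVal f hf x y (vertex 0 k) b = ap f (pair (X.σ x b) ((Y.level (n + 1)).pt k)) := by
  obtain ⟨a⟩ := b
  refine (slideVal_circleMk f hf x y _ a).trans ?_
  rw [inf1_zero, circleMk_zero, σ_pt_right]
  rfl

lemma slideVal_one (b : PSSet.circle.{u}.obj k) :
    slideVal f hf x y (vertex 1 k) b = ap f (pair (X.σ x b) (Y.σ y b)) := by
  obtain ⟨a⟩ := b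
  refine (slideVal_circleMk f hf x y _ a).trans ?_
  rw [inf1_one]
  rfl

/-- The loop of values of `f`. -/
def slideLoop (s : delta1.{u}.obj k) : (loop (E.level (n + 1))).obj k :=
  loopOf (fun _ θ b => slideVal f hf ((X.level n).map θ x) ((Y.level n).map θ y)
      (delta1.map θ s) b)
    (fun θ θ' b => by
      rw [← slideVal_map, PSSet.map_comp, PSSet.map_comp, SSet.map_comp_app])
    (fun _ _ => slideVal_pt_right f hf _ _ _)

lemma loopVal_slideLoop (s : delta1.{u}.obj k) (θ : k ⟶ l) (b : PSSet.circle.{u}.obj l) :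
    loopVal (slideLoop f hf x y s) θ b =
      slideVal f hf ((X.level n).map θ x) ((Y.level n).map θ y) (delta1.map θ s) b :=
  loopVal_loopOf _ _ _ θ b

lemma slideLoop_pt_left (s : delta1.{u}.obj k) :
    slideLoop f hf ((X.level n).pt k) y s = (loopP (E.level (n + 1))).pt k :=
  loopVal_ext fun _ θ b => (loopVal_slideLoop f hf _ _ s θ b).trans
    (((congrArg (slideVal f hf · _ _ b) (PSSet.map_pt _ θ)).trans
      (slideVal_pt_left f hf _ _ b)).trans (loopVal_loopP_pt _ θ b).symm)

/-- The homotopy between the looped shifts of `f` and of its restriction to `X × *`. -/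
def slide : ParamHom (prod X Y) delta1 (loopShift E) where
  ev z s := slideLoop f hf z.1 z.2 s
  ev_map {n k l} θ z s := loopVal_ext (Y := E.level (n + 1)) fun m θ' b => by
    refine (loopVal_slideLoop f hf _ _ _ θ' b).trans (Eq.trans ?_
      ((loopVal_map (slideLoop f hf z.1 z.2 s) θ θ' b).trans
        (loopVal_slideLoop f hf z.1 z.2 s _ b)).symm)
    rw [PSSet.map_comp, PSSet.map_comp, SSet.map_comp_app]
    rfl
  ev_pt s := slideLoop_pt_left f hf _ s
  ev_perm {n k} ρ z s := loopVal_ext (Y := E.level (n + 1)) fun m θ b => by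
    refine (loopVal_slideLoop f hf _ _ _ θ b).trans (Eq.trans ?_ (perm_loopShift E ρ _ θ b).symm)
    refine Eq.trans ?_ (congrArg _ (loopVal_slideLoop f hf z.1 z.2 s θ b).symm)
    rw [← slideVal_perm, map_perm, map_perm]
    rfl
  ev_σ {n k} z c s := loopVal_ext (Y := E.level (n + 2)) fun m θ b => by
    refine (loopVal_slideLoop f hf _ _ _ θ b).trans (Eq.trans ?_ (σ_loopShift E _ c θ b).symm)
    refine Eq.trans ?_ (congrArg (fun w => E.perm (lastSwap n) (E.σ w _))
      (loopVal_slideLoop f hf z.1 z.2 s θ b).symm)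
    rw [← slideVal_σ, map_σ, map_σ]
    rfl

lemma slide_zero (z : ((prod X Y).level n).obj k) : (slide f hf).ev z (vertex 0 k) =
    ap (toLoopShift E) (ap f (pair z.1 ((Y.level n).pt k))) :=
  loopVal_ext (Y := E.level (n + 1)) fun m θ b => by
    refine (loopVal_slideLoop f hf _ _ _ θ b).trans
      (Eq.trans ?_ (loopVal_toLoopShift E _ θ b).symm)
    refine (slideVal_zero f hf _ _ b).trans ?_
    rw [← ap_map, ← ap_σ]
    refine congrArg (ap f) (Prod.ext rfl ?_)
    exact ((congrArg (Y.σ · b) (PSSet.map_pt _ θ)).trans (σ_pt_left _ b)).symm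

lemma slide_one (z : ((prod X Y).level n).obj k) : (slide f hf).ev z (vertex 1 k) =
    ap (toLoopShift E) (ap f z) :=
  loopVal_ext (Y := E.level (n + 1)) fun m θ b => by
    refine (loopVal_slideLoop f hf _ _ _ θ b).trans
      (Eq.trans ?_ (loopVal_toLoopShift E _ θ b).symm)
    refine (slideVal_one f hf _ _ b).trans ?_
    rw [← ap_map, ← ap_σ]
    rfl

end slideVal

lemma IsQuotientSeq.isStableEquiv_of_fst {Z : SymSpectrum.{u}} {q : prod X Y ⟶ Z}
    (h : IsQuotientSeq (prodLift (zeroHom Y X) (𝟙 Y)) q) {p : Z ⟶ X} (hp : q ≫ p = fst X Y) :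
    IsStableEquiv p := by
  let r : X ⟶ Z := prodLift (𝟙 X) (zeroHom X Y) ≫ q
  have hr : r ≫ p = 𝟙 X := by
    rw [Category.assoc, hp]
    rfl
  rw [isStableEquiv_iff]
  intro E hE hE'
  refine ⟨fun g g' e => ?_, fun f => ⟨r ≫ f, htpc_of_toLoopShift hE hE' ?_⟩⟩
  · simpa [reassoc_of% hr] using e.precomp r
  · have hf {n k} (y : (Y.level n).obj k) :
        ap (q ≫ f) (pair ((X.level n).pt k) y) = (E.level n).pt k := by
      rw [ap_comp]
      exact (congrArg (ap f) (h.zero y)).trans (ap_pt f)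
    obtain ⟨G, hG⟩ := h.exists_desc (slide (q ≫ f) hf)
      (fun y s => slideLoop_pt_left (q ≫ f) hf y s)
    refine .of G (fun z => ?_) (fun z => ?_)
    · obtain ⟨z, rfl⟩ := h.surj z
      refine ((hG z _).trans (slide_zero (q ≫ f) hf z)).trans ?_
      have : ap p (ap q z) = z.1 := congrArg (ap · z) hp
      simp only [ap_comp, this]
      rfl
    · obtain ⟨z, rfl⟩ := h.surj z
      exact (hG z _).trans (slide_one (q ≫ f) hf z)

end SymSpectrum

namespace SymSpectrum

/-! ### Trivial maps and stably trivial spectra -/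

section

variable {X Y Z : SymSpectrum.{u}}

@[simp] lemma comp_zeroHom (f : X ⟶ Y) : f ≫ zeroHom Y Z = zeroHom X Z := rfl

@[simp] lemma zeroHom_comp (f : Y ⟶ Z) : zeroHom X Y ≫ f = zeroHom X Z :=
  hom_ext_ap fun _ _ _ => ap_pt f

@[simp] lemma zeroHom_zero : zeroHom zero.{u} zero = 𝟙 zero :=
  hom_ext_ap fun _ _ _ => zero_ext _ _

@[simp] lemma prodLift_fst (f : Z ⟶ X) (g : Z ⟶ Y) : prodLift f g ≫ fst X Y = f := rfl

@[simp] lemma prodLift_snd (f : Z ⟶ X) (g : Z ⟶ Y) : prodLift f g ≫ snd X Y = g := rfl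

lemma isStableEquiv_zeroHom_cone (f : X ⟶ Y) (hX : IsStableEquiv (zeroHom zero X))
    (hY : IsStableEquiv (zeroHom zero Y)) : IsStableEquiv (zeroHom zero (cone f)) := by
  have := (isStableEquiv_zeroHom_cone_id zero).comp
    (isStableEquiv_coneMap (f := 𝟙 zero) (f' := f) (by simp) hX hY)
  rwa [zeroHom_comp] at this

lemma IsStableEquiv.zeroHom_cone {f : X ⟶ Y} (hf : IsStableEquiv f) :
    IsStableEquiv (zeroHom zero (cone f)) := by
  refine (isStableEquiv_coneMap (f := f) (f' := 𝟙 Y) (p := f) (q := 𝟙 Y) rfl hf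
    (isStableEquiv_id Y)).of_comp_right ?_
  rw [zeroHom_comp]
  exact isStableEquiv_zeroHom_cone_id Y

lemma isQuotientSeq_zeroHom_id (X : SymSpectrum.{u}) : IsQuotientSeq (zeroHom zero X) (𝟙 X) where
  mono := isMono_zeroHom X
  surj z := ⟨z, rfl⟩
  zero _ := rfl
  eq _ _ h := Or.inl h

lemma isQuotientSeq_id_zeroHom (X : SymSpectrum.{u}) : IsQuotientSeq (𝟙 X) (zeroHom X zero) where
  mono _ _ _ _ h := h
  surj {n k} _ := ⟨(X.level n).pt k, zero_ext _ _⟩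
  zero _ := rfl
  eq b b' _ := Or.inr ⟨⟨b, rfl⟩, b', rfl⟩

/-! ### Wedges -/

/-- The inclusion of the left summand. -/
def wedgeL (X Y : SymSpectrum.{u}) : X ⟶ wedge X Y :=
  homOfFun (fun _ _ x => PSSet.wedgeInl x) (fun _ _ _ _ _ => rfl) (fun _ _ => rfl)
    (fun _ _ _ _ => rfl) (fun _ _ _ _ => rfl)

/-- The inclusion of the right summand. -/
def wedgeR (X Y : SymSpectrum.{u}) : Y ⟶ wedge X Y :=
  homOfFun (fun _ _ y => PSSet.wedgeInr y) (fun _ _ _ _ _ => rfl) (fun _ _ => wedgeInr_pt)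
    (fun _ _ _ _ => rfl) (fun _ _ _ _ => rfl)

@[simp] lemma wedgeL_wedgeDesc (f : X ⟶ Z) (g : Y ⟶ Z) : wedgeL X Y ≫ wedgeDesc f g = f := rfl

@[simp] lemma wedgeR_wedgeDesc (f : X ⟶ Z) (g : Y ⟶ Z) : wedgeR X Y ≫ wedgeDesc f g = g := rfl

lemma wedgeDesc_comp {W : SymSpectrum.{u}} (f : X ⟶ Z) (g : Y ⟶ Z) (h : Z ⟶ W) :
    wedgeDesc f g ≫ h = wedgeDesc (f ≫ h) (g ≫ h) :=
  hom_ext_ap fun n k z => by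
    induction z using PSSet.wedge_ind with
    | hl x => rfl
    | hr y => rfl

lemma isQuotientSeq_wedgeR (X Y : SymSpectrum.{u}) :
    IsQuotientSeq (wedgeR X Y) (wedgeDesc (𝟙 X) (zeroHom Y X)) where
  mono n k y y' h := congrArg (ap (wedgeDesc (zeroHom X Y) (𝟙 Y))) h
  surj x := ⟨PSSet.wedgeInl x, rfl⟩
  zero _ := rfl
  eq {n k} b b' h := by
    have pt : ap (wedgeR X Y) ((Y.level n).pt k) = PSSet.wedgeInl ((X.level n).pt k) := wedgeInr_pt
    induction b using PSSet.wedge_ind with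
    | hl x =>
      induction b' using PSSet.wedge_ind with
      | hl x' => exact Or.inl (congrArg PSSet.wedgeInl h)
      | hr y' =>
        obtain rfl : x = (X.level n).pt k := h
        exact Or.inr ⟨⟨_, pt⟩, y', rfl⟩
    | hr y =>
      induction b' using PSSet.wedge_ind with
      | hl x' =>
        obtain rfl : (X.level n).pt k = x' := h
        exact Or.inr ⟨⟨y, rfl⟩, _, pt⟩
      | hr y' => exact Or.inr ⟨⟨y, rfl⟩, y', rfl⟩

/-! ### The suspension as a quotient of the mapping cone -/

/-- The map from the mapping cone of `f : X ⟶ Y` to the suspension of `X` collapsing `Y`. -/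
def coneToSusp (f : X ⟶ Y) : cone f ⟶ susp X :=
  homOfFun (fun n k => PSSet.coneLiftAt (f.app n)
      (fun x a => (PSSet.smashMk x (circleMk a) : (PSSet.smash (X.level n) circle).obj k))
      (fun _ => (PSSet.smash (X.level n) circle).pt k)
      (fun _ => smashMk_pt_left _) (fun x => smashMk_pt_right x)
      (fun x => (congrArg (PSSet.smashMk x) (circleMk_one k)).trans (smashMk_pt_right x)))
    (fun n k l θ z => by
      induction z using cone_ind with
      | hl x a => rfl
      | hr y => exact (((susp X).level n).map_pt θ).symm)
    (fun _ _ => rfl)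
    (fun n ρ k z => by
      induction z using cone_ind with
      | hl x a => rfl
      | hr y => exact (perm_pt (susp X).toSpectrumData ρ k).symm)
    (fun n k z b => by
      induction z using cone_ind with
      | hl x a => rfl
      | hr y => exact (σ_pt_left (susp X).toSpectrumData b).symm)

lemma circleMk_eq_iff {k} (a a' : delta1.{u}.obj k) : circleMk a = circleMk a' ↔ a = a' ∨
    (a ∈ (SSet.boundary.{u} 1).obj k ∧ a' ∈ (SSet.boundary.{u} 1).obj k) :=
  quot_mk_eq_iff_of_collapse _ (r := circleRel k) (fun _ _ => Iff.rfl) a a'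

lemma circleMk_eq_pt_iff {k} (a : delta1.{u}.obj k) :
    circleMk a = circle.pt k ↔ a = vertex 0 k ∨ a = vertex 1 k := by
  rw [← circleMk_zero, circleMk_eq_iff, mem_boundary_iff, mem_boundary_iff]
  tauto

lemma isQuotientSeq_coneToSusp (f : X ⟶ Y) : IsQuotientSeq (inR f) (coneToSusp f) where
  mono := isMono_inR f
  surj {n k} z := by
    obtain ⟨x, ⟨a⟩⟩ := z
    exact ⟨coneL f x a, rfl⟩
  zero _ := rfl
  eq {n k} z z' h := by
    have ne {x : (X.level n).obj k} {a : delta1.{u}.obj k} (hx : x ≠ (X.level n).pt k)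
        (h0 : a ≠ vertex 0 k) (h1 : a ≠ vertex 1 k) :
        ¬ (x = (X.level n).pt k ∨ circleMk a = circle.pt k) := by
      rw [circleMk_eq_pt_iff]
      tauto
    induction z using cone_cases with
    | hl x a hx h0 h1 =>
      induction z' using cone_cases with
      | hl x' a' hx' h0' h1' =>
        obtain ⟨rfl, e⟩ := ((smashMk_eq_iff x x' (circleMk a) (circleMk a')).1 h).resolve_right
          (fun h => ne hx h0 h1 h.1)
        obtain rfl | ⟨h, -⟩ := (circleMk_eq_iff a a').1 e
        · exact Or.inl rfl
        · exact absurd ((mem_boundary_iff _).1 h) (by tauto)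
      | hr y => exact absurd ((smashMk_eq_pt_iff x (circleMk a)).1 h) (ne hx h0 h1)
    | hr y =>
      induction z' using cone_cases with
      | hl x' a' hx' h0' h1' =>
        exact absurd ((smashMk_eq_pt_iff x' (circleMk a')).1 h.symm) (ne hx' h0' h1')
      | hr y' => exact Or.inr ⟨⟨y, rfl⟩, y', rfl⟩

end

/-! ### Maps of cubes -/

lemma isStableEquiv_higherCofiber_map {n : ℕ} {A B : Arrow (Cube.{u} n)} (φ : A ⟶ B)
    (hl : IsStableEquiv ((higherCofiber n).map φ.left))
    (hr : IsStableEquiv ((higherCofiber n).map φ.right)) :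
    IsStableEquiv ((higherCofiber (n + 1)).map (X := A) (Y := B) φ) :=
  isStableEquiv_coneMap ((higherCofiber n).mapArrow.map φ).w hl hr

lemma isQuotientSeq_higherCofiber_map {n : ℕ} {A B C : Arrow (Cube.{u} n)} (φ : A ⟶ B)
    (ψ : B ⟶ C)
    (hl : IsQuotientSeq ((higherCofiber n).map φ.left) ((higherCofiber n).map ψ.left))
    (hr : IsQuotientSeq ((higherCofiber n).map φ.right) ((higherCofiber n).map ψ.right)) :
    IsQuotientSeq ((higherCofiber (n + 1)).map (X := A) (Y := B) φ)
      ((higherCofiber (n + 1)).map (X := B) (Y := C) ψ) :=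
  hl.coneMap hr ((higherCofiber n).mapArrow.map φ).w ((higherCofiber n).mapArrow.map ψ).w

namespace CubeDiagram

/-- A map of cubes. -/
structure Map (N N' : CubeDiagram.{u}) where
  f₀₀₀ : N.N₀₀₀ ⟶ N'.N₀₀₀
  f₀₀₁ : N.N₀₀₁ ⟶ N'.N₀₀₁
  f₀₁₀ : N.N₀₁₀ ⟶ N'.N₀₁₀
  f₀₁₁ : N.N₀₁₁ ⟶ N'.N₀₁₁
  f₁₀₀ : N.N₁₀₀ ⟶ N'.N₁₀₀
  f₁₀₁ : N.N₁₀₁ ⟶ N'.N₁₀₁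
  f₁₁₀ : N.N₁₁₀ ⟶ N'.N₁₁₀
  f₁₁₁ : N.N₁₁₁ ⟶ N'.N₁₁₁
  α : f₀₀₁ ≫ N'.α = N.α ≫ f₀₁₁ := by simp
  β : f₀₀₁ ≫ N'.β = N.β ≫ f₁₀₁ := by simp
  γ : f₁₀₁ ≫ N'.γ = N.γ ≫ f₁₁₁ := by simp
  δ : f₀₁₁ ≫ N'.δ = N.δ ≫ f₁₁₁ := by simp
  ε : f₁₀₀ ≫ N'.ε = N.ε ≫ f₁₀₁ := by simp
  ζ : f₀₀₀ ≫ N'.ζ = N.ζ ≫ f₀₀₁ := by simp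
  η : f₀₀₀ ≫ N'.η = N.η ≫ f₁₀₀ := by simp
  κ : f₀₁₀ ≫ N'.κ = N.κ ≫ f₀₁₁ := by simp
  lam : f₀₁₀ ≫ N'.lam = N.lam ≫ f₁₁₀ := by simp
  μ : f₁₀₀ ≫ N'.μ = N.μ ≫ f₁₁₀ := by simp
  ν : f₀₀₀ ≫ N'.ν = N.ν ≫ f₀₁₀ := by simp
  π : f₁₁₀ ≫ N'.π = N.π ≫ f₁₁₁ := by simp

variable {N N' N'' : CubeDiagram.{u}}

/-- The third higher cofiber of a cube. -/
abbrev cofiber (N : CubeDiagram.{u}) : SymSpectrum.{u} := (higherCofiber 3).obj N.toCube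

/-- The map of cubes as a morphism of functors. -/
def Map.toHom (f : Map N N') : N.toCube ⟶ N'.toCube :=
  Arrow.homMk (f := (show Arrow (Cube.{u} 2) from N.toCube))
    (g := (show Arrow (Cube.{u} 2) from N'.toCube))
    (Arrow.homMk (f := (square N.η N.lam N.ν N.μ N.bottom : Arrow (Arrow SymSpectrum.{u})))
      (g := (square N'.η N'.lam N'.ν N'.μ N'.bottom : Arrow (Arrow SymSpectrum.{u})))
      (Arrow.homMk f.f₀₀₀ f.f₁₀₀ f.η : Arrow.mk N.η ⟶ Arrow.mk N'.η)
      (Arrow.homMk f.f₀₁₀ f.f₁₁₀ f.lam : Arrow.mk N.lam ⟶ Arrow.mk N'.lam)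
      (Arrow.hom_ext _ _ f.ν f.μ))
    (Arrow.homMk (f := (square N.β N.δ N.α N.γ N.top : Arrow (Arrow SymSpectrum.{u})))
      (g := (square N'.β N'.δ N'.α N'.γ N'.top : Arrow (Arrow SymSpectrum.{u})))
      (Arrow.homMk f.f₀₀₁ f.f₁₀₁ f.β : Arrow.mk N.β ⟶ Arrow.mk N'.β)
      (Arrow.homMk f.f₀₁₁ f.f₁₁₁ f.δ : Arrow.mk N.δ ⟶ Arrow.mk N'.δ)
      (Arrow.hom_ext _ _ f.α f.γ))
    (Arrow.hom_ext _ _ (Arrow.hom_ext _ _ f.ζ f.ε) (Arrow.hom_ext _ _ f.κ f.π))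

/-- The map of higher cofibers given by a map of cubes. -/
def Map.cofiber (f : Map N N') : N.cofiber ⟶ N'.cofiber := (higherCofiber 3).map f.toHom

lemma Map.isStableEquiv (f : Map N N') (h₀₀₀ : IsStableEquiv f.f₀₀₀) (h₀₀₁ : IsStableEquiv f.f₀₀₁)
    (h₀₁₀ : IsStableEquiv f.f₀₁₀) (h₀₁₁ : IsStableEquiv f.f₀₁₁) (h₁₀₀ : IsStableEquiv f.f₁₀₀)
    (h₁₀₁ : IsStableEquiv f.f₁₀₁) (h₁₁₀ : IsStableEquiv f.f₁₁₀) (h₁₁₁ : IsStableEquiv f.f₁₁₁) :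
    IsStableEquiv f.cofiber :=
  isStableEquiv_higherCofiber_map _
    (isStableEquiv_higherCofiber_map _ (isStableEquiv_higherCofiber_map _ h₀₀₀ h₁₀₀)
      (isStableEquiv_higherCofiber_map _ h₀₁₀ h₁₁₀))
    (isStableEquiv_higherCofiber_map _ (isStableEquiv_higherCofiber_map _ h₀₀₁ h₁₀₁)
      (isStableEquiv_higherCofiber_map _ h₀₁₁ h₁₁₁))

lemma Map.isQuotientSeq (i : Map N N') (q : Map N' N'') (h₀₀₀ : IsQuotientSeq i.f₀₀₀ q.f₀₀₀)
    (h₀₀₁ : IsQuotientSeq i.f₀₀₁ q.f₀₀₁) (h₀₁₀ : IsQuotientSeq i.f₀₁₀ q.f₀₁₀)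
    (h₀₁₁ : IsQuotientSeq i.f₀₁₁ q.f₀₁₁) (h₁₀₀ : IsQuotientSeq i.f₁₀₀ q.f₁₀₀)
    (h₁₀₁ : IsQuotientSeq i.f₁₀₁ q.f₁₀₁) (h₁₁₀ : IsQuotientSeq i.f₁₁₀ q.f₁₁₀)
    (h₁₁₁ : IsQuotientSeq i.f₁₁₁ q.f₁₁₁) : IsQuotientSeq i.cofiber q.cofiber :=
  isQuotientSeq_higherCofiber_map _ _
    (isQuotientSeq_higherCofiber_map _ _ (isQuotientSeq_higherCofiber_map _ _ h₀₀₀ h₁₀₀)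
      (isQuotientSeq_higherCofiber_map _ _ h₀₁₀ h₁₁₀))
    (isQuotientSeq_higherCofiber_map _ _ (isQuotientSeq_higherCofiber_map _ _ h₀₀₁ h₁₀₁)
      (isQuotientSeq_higherCofiber_map _ _ h₀₁₁ h₁₁₁))

end CubeDiagram

end SymSpectrum

namespace SymSpectrum

namespace CubeDiagram

/-! ### Stably trivial cubes -/

/-- The cube with `Y` at the vertices `101` and `111`. -/
abbrev topEdge (Y : SymSpectrum.{u}) : CubeDiagram.{u} where
  N₀₀₀ := zero
  N₀₀₁ := zero
  N₀₁₀ := zero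
  N₀₁₁ := zero
  N₁₀₀ := zero
  N₁₀₁ := Y
  N₁₁₀ := zero
  N₁₁₁ := Y
  α := 𝟙 zero
  β := zeroHom zero Y
  γ := 𝟙 Y
  δ := zeroHom zero Y
  ε := zeroHom zero Y
  ζ := 𝟙 zero
  η := 𝟙 zero
  κ := 𝟙 zero
  lam := 𝟙 zero
  μ := 𝟙 zero
  ν := 𝟙 zero
  π := zeroHom zero Y
  top := by simp
  bottom := by simp
  left := by simp
  right := by simp
  front := by simp
  back := by simp

/-- The cube with `Y` at the vertices `110` and `111`. -/
abbrev verticalEdge (Y : SymSpectrum.{u}) : CubeDiagram.{u} where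
  N₀₀₀ := zero
  N₀₀₁ := zero
  N₀₁₀ := zero
  N₀₁₁ := zero
  N₁₀₀ := zero
  N₁₀₁ := zero
  N₁₁₀ := Y
  N₁₁₁ := Y
  α := 𝟙 zero
  β := 𝟙 zero
  γ := zeroHom zero Y
  δ := zeroHom zero Y
  ε := 𝟙 zero
  ζ := 𝟙 zero
  η := 𝟙 zero
  κ := 𝟙 zero
  lam := zeroHom zero Y
  μ := zeroHom zero Y
  ν := 𝟙 zero
  π := 𝟙 Y
  top := by simp
  bottom := by simp
  left := by simp
  right := by simp
  front := by simp
  back := by simp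

lemma isStableEquiv_zeroHom_cofiber_topEdge (Y : SymSpectrum.{u}) :
    IsStableEquiv (zeroHom zero (topEdge Y).cofiber) := by
  let A : Arrow (Arrow (Arrow SymSpectrum.{u})) := (topEdge Y).toCube
  have h₀ : IsStableEquiv ((higherCofiber 1).map A.left.hom) :=
    isStableEquiv_higherCofiber_map (n := 0) A.left.hom (isStableEquiv_id zero)
      (isStableEquiv_id zero)
  have h₁ : IsStableEquiv ((higherCofiber 1).map A.right.hom) :=
    isStableEquiv_higherCofiber_map (n := 0) A.right.hom (isStableEquiv_id zero)
      (isStableEquiv_id Y)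
  exact isStableEquiv_zeroHom_cone _ h₀.zeroHom_cone h₁.zeroHom_cone

lemma isStableEquiv_zeroHom_cofiber_verticalEdge (Y : SymSpectrum.{u}) :
    IsStableEquiv (zeroHom zero (verticalEdge Y).cofiber) := by
  let A : Arrow (Arrow (Arrow SymSpectrum.{u})) := (verticalEdge Y).toCube
  have h₀ : IsStableEquiv ((higherCofiber 1).map A.hom.left) :=
    isStableEquiv_higherCofiber_map (n := 0) A.hom.left (isStableEquiv_id zero)
      (isStableEquiv_id zero)
  have h₁ : IsStableEquiv ((higherCofiber 1).map A.hom.right) :=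
    isStableEquiv_higherCofiber_map (n := 0) A.hom.right (isStableEquiv_id zero)
      (isStableEquiv_id Y)
  have h : IsStableEquiv ((higherCofiber 2).map A.hom) :=
    isStableEquiv_higherCofiber_map (n := 1) A.hom h₀ h₁
  exact h.zeroHom_cone

variable (N : CubeDiagram.{u})

/-- The cube with `N₁₀₁` replaced by `N₀₀₁ ∨ N₁₁₁`. -/
abbrev wedged (t : N.N₁₀₀ ⟶ N.N₀₀₁) (hβt : t ≫ N.β = N.ε) (hηt : N.η ≫ t = N.ζ) :
    CubeDiagram.{u} :=
  { N with
    N₁₀₁ := wedge N.N₀₀₁ N.N₁₁₁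
    β := wedgeL _ _
    γ := wedgeDesc (N.α ≫ N.δ) (𝟙 _)
    ε := t ≫ wedgeL _ _
    top := by simp
    left := by rw [reassoc_of% hηt]
    back := by rw [N.back, ← hβt, Category.assoc, N.top, Category.assoc, wedgeL_wedgeDesc] }

/-- The cube with `N₁₀₁` replaced by `N₀₀₁` and `N₁₁₁` replaced by the trivial spectrum. -/
abbrev reduced (t : N.N₁₀₀ ⟶ N.N₀₀₁) (hηt : N.η ≫ t = N.ζ) : CubeDiagram.{u} :=
  { N with
    N₁₀₁ := N.N₀₀₁
    N₁₁₁ := zero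
    β := 𝟙 _
    γ := zeroHom _ _
    δ := zeroHom _ _
    ε := t
    π := zeroHom _ _
    top := by simp
    left := by simp [hηt]
    right := by simp
    back := by simp }

/-- The cube with the folded square as bottom and the square `α`, `α` as top. -/
abbrev folded (t : N.N₁₀₀ ⟶ N.N₀₀₁) (hηt : N.η ≫ t = N.ζ) : CubeDiagram.{u} :=
  { N with
    N₁₁₀ := prod N.N₁₁₀ N.N₀₁₁
    N₁₀₁ := N.N₀₀₁
    N₁₁₁ := N.N₀₁₁
    β := 𝟙 _
    γ := N.α
    δ := 𝟙 _
    ε := t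
    lam := prodLift N.lam N.κ
    μ := prodLift N.μ (t ≫ N.α)
    π := snd _ _
    top := by simp
    bottom := by rw [comp_prodLift, comp_prodLift, N.bottom, N.front, ← hηt, Category.assoc]
    left := by simp [hηt]
    right := by simp
    back := by simp }

/-- The reduced cube with `N₁₁₀` replaced by a quotient of `N₁₁₀ × N₀₁₁`. -/
abbrev reducedQuotient (t : N.N₁₀₀ ⟶ N.N₀₀₁) (hηt : N.η ≫ t = N.ζ) {Z : SymSpectrum.{u}}
    (q : prod N.N₁₁₀ N.N₀₁₁ ⟶ Z) : CubeDiagram.{u} :=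
  { N with
    N₁₁₀ := Z
    N₁₀₁ := N.N₀₀₁
    N₁₁₁ := zero
    β := 𝟙 _
    γ := zeroHom _ _
    δ := zeroHom _ _
    ε := t
    lam := prodLift N.lam N.κ ≫ q
    μ := prodLift N.μ (t ≫ N.α) ≫ q
    π := zeroHom _ _
    top := by simp
    bottom := by
      rw [← Category.assoc, ← Category.assoc, comp_prodLift, comp_prodLift, N.bottom, N.front,
        ← hηt, Category.assoc]
    left := by simp [hηt]
    right := by simp
    back := by simp }

section

variable {N} {t : N.N₁₀₀ ⟶ N.N₀₀₁}

lemma exists_wedged_to (s : N.N₁₁₁ ⟶ N.N₁₀₁) (hs : s ≫ N.γ = 𝟙 N.N₁₁₁)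
    (hβs : IsStableEquiv (wedgeDesc N.β s)) (hβt : t ≫ N.β = N.ε) (hηt : N.η ≫ t = N.ζ) :
    ∃ f : (N.wedged t hβt hηt).cofiber ⟶ N.cofiber, IsStableEquiv f :=
  let F : Map (N.wedged t hβt hηt) N :=
    { f₀₀₀ := 𝟙 _
      f₀₀₁ := 𝟙 _
      f₀₁₀ := 𝟙 _
      f₀₁₁ := 𝟙 _
      f₁₀₀ := 𝟙 _
      f₁₀₁ := wedgeDesc N.β s
      f₁₁₀ := 𝟙 _
      f₁₁₁ := 𝟙 _
      γ := by rw [wedgeDesc_comp, N.top, hs]; exact (Category.comp_id _).symm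
      ε := by simp [hβt] }
  ⟨F.cofiber, F.isStableEquiv (isStableEquiv_id _) (isStableEquiv_id _) (isStableEquiv_id _)
    (isStableEquiv_id _) (isStableEquiv_id _) hβs (isStableEquiv_id _) (isStableEquiv_id _)⟩

lemma exists_wedged_to_reduced (hβt : t ≫ N.β = N.ε) (hηt : N.η ≫ t = N.ζ) :
    ∃ f : (N.wedged t hβt hηt).cofiber ⟶ (N.reduced t hηt).cofiber, IsStableEquiv f :=
  let I : Map (topEdge N.N₁₁₁) (N.wedged t hβt hηt) :=
    { f₀₀₀ := zeroHom _ _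
      f₀₀₁ := zeroHom _ _
      f₀₁₀ := zeroHom _ _
      f₀₁₁ := zeroHom _ _
      f₁₀₀ := zeroHom _ _
      f₁₀₁ := wedgeR _ _
      f₁₁₀ := zeroHom _ _
      f₁₁₁ := 𝟙 _ }
  let F : Map (N.wedged t hβt hηt) (N.reduced t hηt) :=
    { f₀₀₀ := 𝟙 _
      f₀₀₁ := 𝟙 _
      f₀₁₀ := 𝟙 _
      f₀₁₁ := 𝟙 _
      f₁₀₀ := 𝟙 _
      f₁₀₁ := wedgeDesc (𝟙 _) (zeroHom _ _)
      f₁₁₀ := 𝟙 _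
      f₁₁₁ := zeroHom _ _ }
  ⟨F.cofiber, (I.isQuotientSeq F (isQuotientSeq_zeroHom_id _) (isQuotientSeq_zeroHom_id _)
    (isQuotientSeq_zeroHom_id _) (isQuotientSeq_zeroHom_id _) (isQuotientSeq_zeroHom_id _)
    (isQuotientSeq_wedgeR _ _) (isQuotientSeq_zeroHom_id _)
    (isQuotientSeq_id_zeroHom _)).isStableEquiv (isStableEquiv_zeroHom_cofiber_topEdge _)⟩

lemma exists_folded_to_reducedQuotient (hηt : N.η ≫ t = N.ζ) {Z : SymSpectrum.{u}}
    {q : prod N.N₁₁₀ N.N₀₁₁ ⟶ Z} (hq : IsQuotientSeq (prodLift (zeroHom _ _) (𝟙 _)) q) :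
    ∃ f : (N.folded t hηt).cofiber ⟶ (N.reducedQuotient t hηt q).cofiber, IsStableEquiv f :=
  let I : Map (verticalEdge N.N₀₁₁) (N.folded t hηt) :=
    { f₀₀₀ := zeroHom _ _
      f₀₀₁ := zeroHom _ _
      f₀₁₀ := zeroHom _ _
      f₀₁₁ := zeroHom _ _
      f₁₀₀ := zeroHom _ _
      f₁₀₁ := zeroHom _ _
      f₁₁₀ := prodLift (zeroHom _ _) (𝟙 _)
      f₁₁₁ := 𝟙 _ }
  let F : Map (N.folded t hηt) (N.reducedQuotient t hηt q) :=
    { f₀₀₀ := 𝟙 _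
      f₀₀₁ := 𝟙 _
      f₀₁₀ := 𝟙 _
      f₀₁₁ := 𝟙 _
      f₁₀₀ := 𝟙 _
      f₁₀₁ := 𝟙 _
      f₁₁₀ := q
      f₁₁₁ := zeroHom _ _ }
  ⟨F.cofiber, (I.isQuotientSeq F (isQuotientSeq_zeroHom_id _) (isQuotientSeq_zeroHom_id _)
    (isQuotientSeq_zeroHom_id _) (isQuotientSeq_zeroHom_id _) (isQuotientSeq_zeroHom_id _)
    (isQuotientSeq_zeroHom_id _) hq (isQuotientSeq_id_zeroHom _)).isStableEquiv
      (isStableEquiv_zeroHom_cofiber_verticalEdge _)⟩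

lemma exists_reducedQuotient_to_reduced (hηt : N.η ≫ t = N.ζ) {Z : SymSpectrum.{u}}
    {q : prod N.N₁₁₀ N.N₀₁₁ ⟶ Z} {p : Z ⟶ N.N₁₁₀} (hp : q ≫ p = fst _ _)
    (hp' : IsStableEquiv p) :
    ∃ f : (N.reducedQuotient t hηt q).cofiber ⟶ (N.reduced t hηt).cofiber, IsStableEquiv f :=
  let F : Map (N.reducedQuotient t hηt q) (N.reduced t hηt) :=
    { f₀₀₀ := 𝟙 _
      f₀₀₁ := 𝟙 _
      f₀₁₀ := 𝟙 _
      f₀₁₁ := 𝟙 _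
      f₁₀₀ := 𝟙 _
      f₁₀₁ := 𝟙 _
      f₁₁₀ := p
      f₁₁₁ := 𝟙 _
      lam := by simp [hp]
      μ := by simp [hp] }
  ⟨F.cofiber, F.isStableEquiv (isStableEquiv_id _) (isStableEquiv_id _) (isStableEquiv_id _)
    (isStableEquiv_id _) (isStableEquiv_id _) (isStableEquiv_id _) hp' (isStableEquiv_id _)⟩

lemma exists_folded_to_susp (hηt : N.η ≫ t = N.ζ) :
    ∃ f : (N.folded t hηt).cofiber ⟶ susp ((higherCofiber 2).obj (N.foldedSquare t hηt)),
      IsStableEquiv f :=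
  ⟨_, (isQuotientSeq_coneToSusp _).isStableEquiv (isStableEquiv_zeroHom_cone _
    (isStableEquiv_zeroHom_cone_id _) (isStableEquiv_zeroHom_cone_id _))⟩

end

end CubeDiagram

end SymSpectrum

open SymSpectrum in
theorem lemma5p2 (N : CubeDiagram.{u})
    (s : N.N₁₁₁ ⟶ N.N₁₀₁) (hs : s ≫ N.γ = 𝟙 N.N₁₁₁) (hβs : IsStableEquiv (wedgeDesc N.β s))
    (t : N.N₁₀₀ ⟶ N.N₀₀₁) (hβt : t ≫ N.β = N.ε) (hηt : N.η ≫ t = N.ζ) :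
    Equivalent ((higherCofiber 3).obj N.toCube)
      (susp ((higherCofiber 2).obj (N.foldedSquare t hηt))) := by
  let i : N.N₀₁₁ ⟶ prod N.N₁₁₀ N.N₀₁₁ := prodLift (zeroHom _ _) (𝟙 _)
  have hq : IsQuotientSeq i (toCollapse i) :=
    isQuotientSeq_toCollapse i (fun _ _ _ _ h => congrArg Prod.snd h)
  obtain ⟨p, hp⟩ := hq.exists_hom (fst _ _) (fun _ => rfl)
  exact ((Relation.EqvGen.rel _ _ (CubeDiagram.exists_wedged_to s hs hβs hβt hηt)).symm.trans _ _ _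
    (.rel _ _ (CubeDiagram.exists_wedged_to_reduced hβt hηt))).trans _ _ _
    ((Relation.EqvGen.rel _ _ (CubeDiagram.exists_reducedQuotient_to_reduced hηt hp
      (hq.isStableEquiv_of_fst hp))).symm.trans _ _ _
    ((Relation.EqvGen.rel _ _ (CubeDiagram.exists_folded_to_reducedQuotient hηt hq)).symm.trans _ _
      _ (.rel _ _ (CubeDiagram.exists_folded_to_susp hηt))))
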